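/- **Setting.** Let $p,q\ge 1$ and let $\mathbf Z=(z_{kl})\in\mathbb R^{p\times q}$ be a random matrix with finite eighth moments whose components are mutually independent with $\mathrm E(z_{kl})=0$ and $\mathrm{var}(z_{kl})=1$. Write $\beta_{kl}=\mathrm E(z_{kl}^4)$, $\omega_{kl}=\mathrm{var}(z_{kl}^3)$, $\bar\beta_{k\cdot}=\frac1q\sum_l\beta_{kl}$, $\bar\beta_{\cdot l}=\frac1p\sum_k\beta_{kl}$, $\bar\omega_{k\cdot}=\frac1q\sum_l\omega_{kl}$ and $\delta_{kk'}=\frac1q\sum_l\beta_{kl}\beta_{k'l}-\bar\beta_{k\cdot}\bar\beta_{k'\cdot}$. Assume that $\bar\beta_{1\cdot},\dots,\bar\beta_{p\cdot}$ are distinct and that $\bar\beta_{\cdot1},\dots,\bar\beta_{\cdot q}$ are distinct. Let $\mathbf Z_1,\mathbf Z_2,\dots$ be i.i.d. copies of $\mathbf Z$ and let $N\in\{0,1\}$. **Estimates.** For sample size $n$ let $\bar{\mathbf Z}=\frac1n\sum_{i\le n}\mathbf Z_i$, $\bar{\mathbf S}_L=\frac1{nq}\sum_{i\le n}(\mathbf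 Z_i-\mathbf C)(\mathbf Z_i-\mathbf C)^\top$ and $\bar{\mathbf S}_R=\frac1{np}\sum_{i\le n}(\mathbf Z_i-\mathbf C)^\top(\mathbf Z_i-\mathbf C)$, where either $\mathbf C=\bar{\mathbf Z}$ for all $n$ or $\mathbf C=\mathbf 0$ for all $n$ (the result holds for both conventions). When both matrices are positive definite, let $\bar{\mathbf S}_L^{-1/2},\bar{\mathbf S}_R^{-1/2}$ be their symmetric positive definite inverse square roots, put $\mathbf Y_i=\bar{\mathbf S}_L^{-1/2}(\mathbf Z_i-\bar{\mathbf Z})\bar{\mathbf S}_R^{-1/2}$ and $$\bar{\mathbf B}^0=\frac1{nq}\sum_{i\le n}\mathbf Y_i\mathbf Y_i^\top\mathbf Y_i\mathbf Y_i^\top,\qquad \bar{\mathbf B}^1=\frac1{nq}\sum_{i\le n}\|\mathbf Y_i\|_F^2\,\mathbf Y_i\mathbf Y_i^\top .$$ A left MFOBI estimate is any matrix $\hat{\boldsymbol\Gamma}=\hat{\mathbf W}^\top\bar{\mathbf S}_L^{-1/2}$ with $\hat{\mathbf W}$ orthogonal and $\hat{\mathbf W}^\top\bar{\mathbf B}^N\hat{\mathbf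 W}$ diagonal. A sequence of left MFOBI estimates is a sequence of random $p\times p$ matrices $\hat{\boldsymbol\Gamma}_n$ such that, for each $n$, almost surely, $\hat{\boldsymbol\Gamma}_n$ is a left MFOBI estimate of the first $n$ observations whenever $\bar{\mathbf S}_L$ and $\bar{\mathbf S}_R$ are positive definite. **Claim.** There exists a sequence of left MFOBI estimates with $\hat{\boldsymbol\Gamma}_n\to_P\mathbf I_p$. Moreover there is a positive semidefinite $p^2\times p^2$ matrix $\mathbf V$ such that every sequence of left MFOBI estimates with $\hat{\boldsymbol\Gamma}_n\to_P\mathbf I_p$ satisfies $$\sqrt n\,\mathrm{vec}(\hat{\boldsymbol\Gamma}_n-\mathbf I_p)\;\to_d\;\mathcal N_{p^2}(\mathbf 0,\mathbf V),$$ and the diagonal entries of $\mathbf V$, i.e. the asymptotic variances of the entries $\hat\gamma_{kk'}$, are $$\mathrm{ASV}(\hat\gamma_{kk})=\frac{\bar\beta_{k\cdot}-1}{4q},$$ $$\mathrm{ASV}(\hat\gamma_{kk'})=\frac{\bar\omega_{k\cdot}+\bar\omega_{k'\cdot}-\bar\beta_{k\cdot}^2+2\delta_{kk'}+(q-1)\bar\beta_{k\cdot}+(q-7)\bar\beta_{k'\cdot}+c_N}{q(\bar\beta_{k\cdot}-\bar\beta_{k'\cdot})^2},\qquad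 k\ne k',$$ where $c_0=\sum_{m\ne k,k'}\bar\beta_{m\cdot}+pq-2p-4q+15$ and $c_1=q\sum_{m\ne k,k'}\bar\beta_{m\cdot}-pq+11$. -/

import Mathlib

open MeasureTheory ProbabilityTheory Filter Topology
open scoped Matrix

noncomputable section

namespace MFOBI

/-! ### Moments of a random matrix -/

section Moments

variable {Ω : Type*} [MeasurableSpace Ω] {p q : ℕ}

/-- `β_{kl} = E(z_{kl}^4)`. -/
def kurt (P : Measure Ω) (Z : Ω → Matrix (Fin p) (Fin q) ℝ) (k : Fin p) (l : Fin q) : ℝ :=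
  ∫ ω, (Z ω k l) ^ 4 ∂P

/-- `ω_{kl} = var(z_{kl}^3)`. -/
def varCube (P : Measure Ω) (Z : Ω → Matrix (Fin p) (Fin q) ℝ) (k : Fin p) (l : Fin q) : ℝ :=
  Var[fun ω => (Z ω k l) ^ 3; P]

/-- Average over the column index: `ᾱ_{k·} = (1/q) ∑_l α_{kl}`. -/
def rowAvg (α : Fin p → Fin q → ℝ) (k : Fin p) : ℝ := (q : ℝ)⁻¹ * ∑ l, α k l

/-- Average over the row index: `ᾱ_{·l} = (1/p) ∑_k α_{kl}`. -/
def colAvg (α : Fin p → Fin q → ℝ) (l : Fin q) : ℝ := (p : ℝ)⁻¹ * ∑ k, α k l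

/-- Covariance of two rows of an array:
`δ_{kk'} = (1/q) ∑_l β_{kl} β_{k'l} - β̄_{k·} β̄_{k'·}`. -/
def rowCov (β : Fin p → Fin q → ℝ) (k k' : Fin p) : ℝ :=
  (q : ℝ)⁻¹ * ∑ l, β k l * β k' l - rowAvg β k * rowAvg β k'

/-- The constants `c_0` and `c_1` for the pair `(k, k')`, where `b = β̄`. -/
def cConst (N : Fin 2) (q : ℕ) (b : Fin p → ℝ) (k k' : Fin p) : ℝ :=
  if N = 0 then
    (∑ m ∈ Finset.univ \ {k, k'}, b m) + (p : ℝ) * q - 2 * p - 4 * q + 15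
  else
    (q : ℝ) * (∑ m ∈ Finset.univ \ {k, k'}, b m) - (p : ℝ) * q + 11

/-- Asymptotic variance of the diagonal entry `γ̂_{kk}`. -/
def asvDiag (P : Measure Ω) (Z : Ω → Matrix (Fin p) (Fin q) ℝ) (k : Fin p) : ℝ :=
  (rowAvg (kurt P Z) k - 1) / (4 * q)

/-- Asymptotic variance of the off-diagonal entry `γ̂_{kk'}`. -/
def asvOff (N : Fin 2) (P : Measure Ω) (Z : Ω → Matrix (Fin p) (Fin q) ℝ) (k k' : Fin p) : ℝ :=
  (rowAvg (varCube P Z) k + rowAvg (varCube P Z) k' - rowAvg (kurt P Z) k ^ 2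
      + 2 * rowCov (kurt P Z) k k' + ((q : ℝ) - 1) * rowAvg (kurt P Z) k
      + ((q : ℝ) - 7) * rowAvg (kurt P Z) k' + cConst N q (rowAvg (kurt P Z)) k k')
    / (q * (rowAvg (kurt P Z) k - rowAvg (kurt P Z) k') ^ 2)

end Moments

/-! ### The left MFOBI estimate of a sample `x 0, …, x (n - 1)` of matrices -/

section Estimate

variable {p q : ℕ}

/-- The sample mean. -/
def sampleMean (n : ℕ) (x : ℕ → Matrix (Fin p) (Fin q) ℝ) : Matrix (Fin p) (Fin q) ℝ :=
  (n : ℝ)⁻¹ • ∑ i ∈ Finset.range n, x i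

/-- The point about which the sample covariance matrices are formed: the sample mean, or the
known population mean `0`. -/
def center (centered : Bool) (n : ℕ) (x : ℕ → Matrix (Fin p) (Fin q) ℝ) :
    Matrix (Fin p) (Fin q) ℝ :=
  if centered then sampleMean n x else 0

/-- The sample left covariance matrix. -/
def sampleCovL (centered : Bool) (n : ℕ) (x : ℕ → Matrix (Fin p) (Fin q) ℝ) :
    Matrix (Fin p) (Fin p) ℝ :=
  (q : ℝ)⁻¹ • (n : ℝ)⁻¹ • ∑ i ∈ Finset.range n,
    (x i - center centered n x) * (x i - center centered n x)ᵀ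

/-- The sample right covariance matrix. -/
def sampleCovR (centered : Bool) (n : ℕ) (x : ℕ → Matrix (Fin p) (Fin q) ℝ) :
    Matrix (Fin q) (Fin q) ℝ :=
  (p : ℝ)⁻¹ • (n : ℝ)⁻¹ • ∑ i ∈ Finset.range n,
    (x i - center centered n x)ᵀ * (x i - center centered n x)

/-- `G` is the symmetric (positive definite) inverse square root of `S`. Such a `G` exists, and
is then unique, exactly when `S` is symmetric positive definite. -/
def IsSymmInvSqrt {r : ℕ} (S G : Matrix (Fin r) (Fin r) ℝ) : Prop :=
  G.PosDef ∧ G * S * Gᵀ = 1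

/-- The integrand of the FOBI functional: `Y Yᵀ Y Yᵀ` if `N = 0` and `‖Y‖_F² Y Yᵀ` if `N = 1`. -/
def fobiKernel (N : Fin 2) (Y : Matrix (Fin p) (Fin q) ℝ) : Matrix (Fin p) (Fin p) ℝ :=
  if N = 0 then Y * Yᵀ * Y * Yᵀ else (∑ k, ∑ l, Y k l ^ 2) • (Y * Yᵀ)

/-- The sample left FOBI matrix of the observations, centered at the sample mean and standardized
by `L` from the left and by `R` from the right. -/
def sampleFobiL (N : Fin 2) (L : Matrix (Fin p) (Fin p) ℝ) (R : Matrix (Fin q) (Fin q) ℝ)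
    (n : ℕ) (x : ℕ → Matrix (Fin p) (Fin q) ℝ) : Matrix (Fin p) (Fin p) ℝ :=
  (q : ℝ)⁻¹ • (n : ℝ)⁻¹ • ∑ i ∈ Finset.range n,
    fobiKernel N (L * (x i - sampleMean n x) * Rᵀ)

/-- `G = Wᵀ S_L^{-1/2}` is a left MFOBI estimate computed from `x 0, …, x (n - 1)`: the columns of
the orthogonal matrix `W` are eigenvectors of the sample left FOBI matrix. -/
def IsLeftEstimate (N : Fin 2) (centered : Bool) (n : ℕ) (x : ℕ → Matrix (Fin p) (Fin q) ℝ)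
    (G : Matrix (Fin p) (Fin p) ℝ) : Prop :=
  ∃ (L : Matrix (Fin p) (Fin p) ℝ) (R : Matrix (Fin q) (Fin q) ℝ) (W : Matrix (Fin p) (Fin p) ℝ),
    IsSymmInvSqrt (sampleCovL centered n x) L ∧ IsSymmInvSqrt (sampleCovR centered n x) R ∧
    W ∈ Matrix.orthogonalGroup (Fin p) ℝ ∧
    (Wᵀ * sampleFobiL N L R n x * W).IsDiag ∧
    G = Wᵀ * L

variable {Ω : Type*} [MeasurableSpace Ω]

/-- `Γ` is a sequence of (random) left MFOBI estimates based on `Z_0, Z_1, …`: the `n`-th one is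
computed from the first `n` observations whenever both sample covariance matrices are positive
definite, that is, whenever their inverse square roots exist. -/
def IsLeftEstimateSeq (N : Fin 2) (centered : Bool) (P : Measure Ω)
    (Z : ℕ → Ω → Matrix (Fin p) (Fin q) ℝ) (Γ : ℕ → Ω → Matrix (Fin p) (Fin p) ℝ) : Prop :=
  (∀ n k k', AEMeasurable (fun ω => Γ n ω k k') P) ∧
  ∀ n, ∀ᵐ ω ∂P,
    (sampleCovL centered n fun i => Z i ω).PosDef →
    (sampleCovR centered n fun i => Z i ω).PosDef →
    IsLeftEstimate N centered n (fun i => Z i ω) (Γ n ω)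

/-- `Γ_n → I_p` in probability. -/
def IsConsistent (P : Measure Ω) (Γ : ℕ → Ω → Matrix (Fin p) (Fin p) ℝ) : Prop :=
  ∀ k k', TendstoInMeasure P (fun n ω => Γ n ω k k') atTop
    (fun _ => (1 : Matrix (Fin p) (Fin p) ℝ) k k')

end Estimate

end MFOBI

end

/-! The estimate depends on the data only through the empirical moments of degree at most four in
the entries, collected in a tensor `m`. Independence and the eighth moments make the mean square of
the distance `ρ` of `m` from the population moments of order 1/n. Up to the limit theorem, the
argument is deterministic perturbation theory in `ρ`. Convergence in probability is convergence
along the filter `probFilter` on pairs (n, ω), so the usual Landau calculus applies.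

If the left covariance matrix is 1 + s + O(ρ²), its inverse square root is 1 - s/2 + O(ρ²)
(`FirstOrder.invSqrt`). The FOBI matrix tends to a diagonal matrix whose entries b_k differ from
β̄_k by a constant, hence are distinct. An orthogonal diagonalizer U near the identity therefore has
U_kk' ≈ B_kk' / (b_k - b_k') off the diagonal and U_kk = 1 + o(ρ) (`isLittleO_eigenvectors`). The
off-diagonal entries of B are linearized in `firstOrder_fobiMatrix`; the right standardization drops
out because it only meets moments that vanish by independence. Altogether the estimate is 1 +
`estimateLin` + o(ρ) (`isLittleO_estimate`). Since `estimateLin` is affine in `m`, at the empirical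
moments it is an average of independent copies of `influence`. The central limit theorem and
Slutsky's lemma then give the limit, V being the covariance matrix of `influence`.

For the diagonal of V, `influence` is split into combinations of products of centered powers of the
entries. Products involving different sets of entries are orthogonal, so the variance is a sum of
explicit second moments (`estimateLin_eq_sum`, `sum_integral_sq_offComponent`).

For existence, a measurable selection picks, among the orthogonal diagonalizers, one closest to the
identity; compactness of the orthogonal group shows that it tends to the identity
(`tendsto_sqDistOne_diagonalizer`). -/

open Asymptotics

namespace MFOBI

/-! ### Multivariate central limit theorem -/

section CentralLimit

variable {Ω ι : Type*} [MeasurableSpace Ω] {P : Measure Ω} [Fintype ι]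

/-- The covariance matrix of a family of random variables. -/
noncomputable def covMatrix (P : Measure Ω) (X : ι → Ω → ℝ) : Matrix ι ι ℝ :=
  Matrix.of fun i j => cov[X i, X j; P]

/-- Matches the exponent of the Gaussian characteristic function at `t` with the variance of the
projection on `t`. -/
lemma dotProduct_covMatrix_mulVec [IsProbabilityMeasure P] {X : ι → Ω → ℝ}
    (hX : ∀ i, MemLp (X i) 2 P) (t : ι → ℝ) :
    t ⬝ᵥ covMatrix P X *ᵥ t = Var[fun ω => ∑ i, t i * X i ω; P] := by
  have h := variance_sum (μ := P) (X := fun i ω => t i * X i ω)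
    (fun i => (hX i).const_mul (t i))
  have e : (∑ i, fun ω => t i * X i ω) = fun ω => ∑ i, t i * X i ω := by
    ext ω; simp
  rw [← e, h]
  simp only [dotProduct, Matrix.mulVec, covMatrix, Matrix.of_apply, Finset.mul_sum,
    covariance_const_mul_left, covariance_const_mul_right]
  refine Finset.sum_congr rfl fun i _ => Finset.sum_congr rfl fun j _ => ?_
  ring

lemma posSemidef_covMatrix [IsProbabilityMeasure P] {X : ι → Ω → ℝ}
    (hX : ∀ i, MemLp (X i) 2 P) : (covMatrix P X).PosSemidef := by
  refine Matrix.PosSemidef.of_dotProduct_mulVec_nonneg ?_ fun t => ?_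
  · ext i j
    simp [covMatrix, covariance_comm]
  · rw [star_trivial, dotProduct_covMatrix_mulVec hX]
    exact variance_nonneg _ _

/-- The multivariate central limit theorem for centered random vectors. -/
theorem tendstoInDistribution_sqrt_smul_sum [IsProbabilityMeasure P] [DecidableEq ι]
    {X : ℕ → ι → Ω → ℝ}
    (hX : ∀ i, MemLp (X 0 i) 2 P) (h0 : ∀ i, ∫ ω, X 0 i ω ∂P = 0)
    (hindep : iIndepFun (fun n ω i => X n i ω) P)
    (hident : ∀ n, IdentDistrib (fun ω i => X n i ω) (fun ω i => X 0 i ω) P P) :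
    TendstoInDistribution
      (fun (n : ℕ) ω => WithLp.toLp 2 fun i => (√(n : ℝ))⁻¹ * ∑ k ∈ Finset.range n, X k i ω)
      atTop id (fun _ => P) (multivariateGaussian 0 (covMatrix P (X 0))) where
  forall_aemeasurable n := by
    have hm : ∀ k i, AEMeasurable (X k i) P := fun k i =>
      (measurable_pi_apply i).comp_aemeasurable (hident k).aemeasurable_fst
    refine (WithLp.measurable_toLp 2 (ι → ℝ)).comp_aemeasurable (aemeasurable_pi_lambda _ fun i => ?_)
    exact (Finset.aemeasurable_fun_sum _ fun k _ => hm k i).const_mul _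
  tendsto := by
    have hm : ∀ k i, AEMeasurable (X k i) P := fun k i =>
      (measurable_pi_apply i).comp_aemeasurable (hident k).aemeasurable_fst
    refine ProbabilityMeasure.tendsto_iff_tendsto_charFun.2 fun t => ?_
    have hmeas : ∀ n : ℕ, AEMeasurable (fun ω => WithLp.toLp 2 fun i =>
        (√(n : ℝ))⁻¹ * ∑ k ∈ Finset.range n, X k i ω) P := fun n =>
      (WithLp.measurable_toLp 2 (ι → ℝ)).comp_aemeasurable (aemeasurable_pi_lambda _ fun i =>
        (Finset.aemeasurable_fun_sum _ fun k _ => hm k i).const_mul _)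
    -- Cramér–Wold: the characteristic function of a vector at `t` is that of its projection on `t`
    -- at the argument 1, so the one-dimensional theorem is applied to the projections.
    let g : (ι → ℝ) → ℝ := fun x => ∑ i, t i * x i
    have hg : Measurable g := by fun_prop
    have hY : MemLp (fun ω => ∑ i, t i * X 0 i ω) 2 P :=
      memLp_finsetSum _ fun i _ => (hX i).const_mul (t i)
    have hYint : ∫ ω, ∑ i, t i * X 0 i ω ∂P = 0 := by
      rw [integral_finsetSum _ fun i _ => ((hX i).integrable one_le_two).const_mul (t i)]
      simp [integral_const_mul, h0]
    have clt := tendstoInDistribution_inv_sqrt_mul_sum_sub (P := P)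
      (P' := gaussianReal 0 Var[fun ω => ∑ i, t i * X 0 i ω; P].toNNReal)
      (X := fun n ω => ∑ i, t i * X n i ω) (Y := id) ⟨aemeasurable_id, by simp⟩ hY
      (hindep.comp (fun _ => g) fun _ => hg) (fun n => (hident n).comp hg)
    have h1 := ProbabilityMeasure.tendsto_iff_tendsto_charFun.1 clt.tendsto 1
    have hlim : charFun ((multivariateGaussian 0 (covMatrix P (X 0))).map id) t
        = charFun ((gaussianReal 0 Var[fun ω => ∑ i, t i * X 0 i ω; P].toNNReal).map id) 1 := by
      rw [Measure.map_id, Measure.map_id, charFun_multivariateGaussian (posSemidef_covMatrix hX),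
        charFun_gaussianReal, dotProduct_covMatrix_mulVec hX,
        Real.coe_toNNReal _ (variance_nonneg _ _)]
      simp
    simp only [ProbabilityMeasure.coe_mk] at h1 ⊢
    rw [hlim]
    refine h1.congr fun n => ?_
    have hm1 : AEMeasurable (fun ω => (√(n : ℝ))⁻¹ *
        (∑ k ∈ Finset.range n, ∑ i, t i * X k i ω - n * ∫ ω, ∑ i, t i * X 0 i ω ∂P)) P :=
      clt.forall_aemeasurable n
    rw [charFun_apply, charFun_apply, integral_map hm1 (by fun_prop),
      integral_map (hmeas n) (by fun_prop)]
    refine integral_congr_ae (ae_of_all _ fun ω => ?_)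
    have e : inner ℝ ((√(n : ℝ))⁻¹ *
        (∑ k ∈ Finset.range n, ∑ i, t i * X k i ω - n * ∫ ω, ∑ i, t i * X 0 i ω ∂P)) 1
        = inner ℝ (WithLp.toLp 2 fun i => (√(n : ℝ))⁻¹ * ∑ k ∈ Finset.range n, X k i ω) t := by
      rw [hYint]
      simp only [PiLp.inner_apply, RCLike.inner_apply, conj_trivial, mul_zero, sub_zero, one_mul,
        Finset.mul_sum]
      rw [Finset.sum_comm]
      refine Finset.sum_congr rfl fun i _ => Finset.sum_congr rfl fun k _ => ?_
      ring
    simp only [e]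

end CentralLimit

/-! ### Measurable selection from compact-valued multifunctions -/

section Selection

variable {α E : Type*} [MeasurableSpace α] [TopologicalSpace E]

/-- A multifunction with nonempty compact values whose lower inverse images of closed sets are
measurable. -/
structure IsCompactMultifunction (F : α → Set E) : Prop where
  nonempty : ∀ x, (F x).Nonempty
  isCompact : ∀ x, IsCompact (F x)
  measurableSet_hit : ∀ C, IsClosed C → MeasurableSet {x | (F x ∩ C).Nonempty}

/-- The minimizers of `g` among the values of a multifunction. -/
def argminOn (g : E → ℝ) (F : α → Set E) (x : α) : Set E :=
  {y ∈ F x | ∀ y' ∈ F x, g y ≤ g y'}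

lemma IsCompactMultifunction.argminOn {F : α → Set E} (hF : IsCompactMultifunction F) {g : E → ℝ}
    (hg : Continuous g) : IsCompactMultifunction (argminOn g F) where
  nonempty x := by
    obtain ⟨y, hy, h⟩ := (hF.isCompact x).exists_isMinOn (hF.nonempty x) hg.continuousOn
    exact ⟨y, hy, fun y' hy' => h hy'⟩
  isCompact x := by
    obtain ⟨y, hy, h⟩ := (hF.isCompact x).exists_isMinOn (hF.nonempty x) hg.continuousOn
    have e : MFOBI.argminOn g F x = F x ∩ {z | g z ≤ g y} := by
      ext z
      exact ⟨fun hz => ⟨hz.1, hz.2 y hy⟩, fun hz => ⟨hz.1, fun y' hy' => hz.2.trans (h hy')⟩⟩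
    rw [e]
    exact (hF.isCompact x).inter_right (isClosed_le hg continuous_const)
  measurableSet_hit C hC := by
    -- Some minimizer lies in `C` iff the minimum over `F x ∩ C` does not exceed that over `F x`.
    -- Testing this at rational levels leaves only countably many hit conditions.
    have e : {x | (MFOBI.argminOn g F x ∩ C).Nonempty} = {x | (F x ∩ C).Nonempty} ∩
        ⋂ r : ℚ, ({x | (F x ∩ {z | g z ≤ r}).Nonempty}ᶜ ∪
          {x | (F x ∩ (C ∩ {z | g z ≤ r})).Nonempty}) := by
      ext x
      simp only [Set.mem_ofPred_eq, Set.mem_inter_iff, Set.mem_iInter, Set.mem_union,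
        Set.mem_compl_iff]
      constructor
      · rintro ⟨y, hy, hyC⟩
        refine ⟨⟨y, hy.1, hyC⟩, fun r => ?_⟩
        by_cases h : (F x ∩ {z | g z ≤ r}).Nonempty
        · obtain ⟨y', hy', hr⟩ := h
          exact Or.inr ⟨y, hy.1, hyC, (hy.2 y' hy').trans hr⟩
        · exact Or.inl h
      · rintro ⟨hne, hr⟩
        obtain ⟨y, hy, h⟩ := ((hF.isCompact x).inter_right hC).exists_isMinOn hne hg.continuousOn
        refine ⟨y, ⟨hy.1, fun y' hy' => ?_⟩, hy.2⟩
        by_contra! hlt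
        obtain ⟨r, h1, h2⟩ := exists_rat_btwn hlt
        rcases hr r with hr | ⟨z, hz, hzC, hzr⟩
        · exact hr ⟨y', hy', h1.le⟩
        · exact absurd (h ⟨hz, hzC⟩) (not_le.2 (lt_of_le_of_lt hzr h2))
    rw [e]
    refine (hF.measurableSet_hit C hC).inter (MeasurableSet.iInter fun r => ?_)
    have hr : IsClosed {z | g z ≤ (r : ℝ)} := isClosed_le hg continuous_const
    exact (hF.measurableSet_hit _ hr).compl.union (hF.measurableSet_hit _ (hC.inter hr))

/-- Minimizing the functions one after another makes each of them constant on the remaining values,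
while compactness and measurability survive each round. -/
lemma IsCompactMultifunction.exists_refinement (gs : List (E → ℝ)) :
    ∀ {F : α → Set E}, IsCompactMultifunction F → (∀ g ∈ gs, Continuous g) →
      ∃ F' : α → Set E, IsCompactMultifunction F' ∧ (∀ x, F' x ⊆ F x) ∧
        ∀ g ∈ gs, ∀ x, ∀ y ∈ F' x, ∀ z ∈ F' x, g y = g z := by
  induction gs with
  | nil => exact fun hF _ => ⟨_, hF, fun _ => subset_rfl, by simp⟩
  | cons g gs ih =>
    intro F hF hg
    obtain ⟨F', h1, h2, h3⟩ := ih (hF.argminOn (hg g (by simp)))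
      fun g' hg' => hg g' (List.mem_cons_of_mem _ hg')
    refine ⟨F', h1, fun x => (h2 x).trans fun _ hy => hy.1, fun g' hg' x y hy z hz => ?_⟩
    rcases List.mem_cons.1 hg' with rfl | hg'
    · exact le_antisymm ((h2 x hy).2 z (h2 x hz).1) ((h2 x hz).2 y (h2 x hy).1)
    · exact h3 g' hg' x y hy z hz

/-- Measurable selection, for values separated by finitely many continuous functions. -/
theorem IsCompactMultifunction.exists_measurable_selection [MeasurableSpace E] [BorelSpace E]
    {F : α → Set E} (hF : IsCompactMultifunction F) (gs : List (E → ℝ))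
    (hg : ∀ g ∈ gs, Continuous g) (hsep : ∀ y z, (∀ g ∈ gs, g y = g z) → y = z) :
    ∃ s : α → E, Measurable s ∧ ∀ x, s x ∈ F x := by
  obtain ⟨F', h1, h2, h3⟩ := hF.exists_refinement gs hg
  choose s hs using h1.nonempty
  refine ⟨s, measurable_of_isClosed fun C hC => ?_, fun x => h2 x (hs x)⟩
  convert h1.measurableSet_hit C hC using 1
  ext x
  refine ⟨fun h => ⟨s x, hs x, h⟩, fun ⟨y, hy, hyC⟩ => ?_⟩
  -- After the refinement `F' x` is a single point, so the preimage of `C` under `s` is a hit set.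
  have : s x = y := hsep _ _ fun g hg => h3 g hg x _ (hs x) _ hy
  simpa [this] using hyC

end Selection

/-! ### Orthogonal diagonalization with measurable dependence on the matrix -/

section Diagonalizers

variable {m n r : ℕ}

instance : MeasurableSpace (Matrix (Fin m) (Fin n) ℝ) := MeasurableSpace.pi

instance : BorelSpace (Matrix (Fin m) (Fin n) ℝ) :=
  inferInstanceAs (BorelSpace (Fin m → Fin n → ℝ))

lemma measurable_matrix_iff {α : Type*} [MeasurableSpace α] {f : α → Matrix (Fin m) (Fin n) ℝ} :
    Measurable f ↔ ∀ i j, Measurable fun x => f x i j := by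
  refine ⟨fun h i j => ?_, fun h => measurable_pi_lambda _ fun i => measurable_pi_lambda _ fun j =>
    h i j⟩
  exact (measurable_pi_apply j).comp ((measurable_pi_apply i).comp h)

/-- The orthogonal matrices that diagonalize the symmetric part of `B`. -/
def diagonalizers (B : Matrix (Fin r) (Fin r) ℝ) : Set (Matrix (Fin r) (Fin r) ℝ) :=
  {W | W ∈ Matrix.orthogonalGroup (Fin r) ℝ ∧ (Wᵀ * (B + Bᵀ) * W).IsDiag}

lemma isDiag_of_mem_diagonalizers {B W : Matrix (Fin r) (Fin r) ℝ} (hB : B.IsSymm)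
    (hW : W ∈ diagonalizers B) : (Wᵀ * B * W).IsDiag := by
  have h := hW.2
  rw [hB.eq, Matrix.mul_add, Matrix.add_mul] at h
  intro i j hij
  have := h hij
  simp only [Matrix.add_apply] at this
  linarith

lemma abs_entry_le_one {W : Matrix (Fin r) (Fin r) ℝ}
    (hW : W ∈ Matrix.orthogonalGroup (Fin r) ℝ) (i j : Fin r) : |W i j| ≤ 1 := by
  have h := congrFun (congrFun ((Matrix.mem_orthogonalGroup_iff _ _).1 hW) i) i
  simp only [Matrix.mul_apply, Matrix.transpose_apply, Matrix.one_apply_eq] at h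
  rw [← sq_le_one_iff_abs_le_one, sq, ← h]
  exact Finset.single_le_sum (f := fun j => W i j * W i j) (fun j _ => mul_self_nonneg _)
    (Finset.mem_univ j)

lemma isCompact_orthogonalGroup :
    IsCompact {W : Matrix (Fin r) (Fin r) ℝ | W ∈ Matrix.orthogonalGroup (Fin r) ℝ} := by
  have hK : IsCompact (Set.univ.pi fun _ : Fin r => Set.univ.pi fun _ : Fin r =>
      Set.Icc (-1 : ℝ) 1) := isCompact_univ_pi fun _ => isCompact_univ_pi fun _ => isCompact_Icc
  refine hK.of_isClosed_subset ?_ fun W hW i _ j _ => abs_le.1 (abs_entry_le_one hW i j)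
  have e : {W : Matrix (Fin r) (Fin r) ℝ | W ∈ Matrix.orthogonalGroup (Fin r) ℝ}
      = {W | W * Wᵀ = 1} := by ext W; exact Matrix.mem_orthogonalGroup_iff _ _
  rw [e]
  exact isClosed_eq (by fun_prop) continuous_const

lemma isClosed_isDiag : IsClosed {A : Matrix (Fin r) (Fin r) ℝ | A.IsDiag} := by
  have e : {A : Matrix (Fin r) (Fin r) ℝ | A.IsDiag} = ⋂ i, ⋂ j, ⋂ _ : i ≠ j, {A | A i j = 0} := by
    ext A
    simp only [Set.mem_ofPred_eq, Set.mem_iInter]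
    exact ⟨fun h i j hij => h hij, fun h i j hij => h i j hij⟩
  rw [e]
  refine isClosed_iInter fun i => isClosed_iInter fun j => isClosed_iInter fun _ => ?_
  exact isClosed_eq (by fun_prop) continuous_const

lemma isClosed_graph_diagonalizers :
    IsClosed {x : Matrix (Fin r) (Fin r) ℝ × Matrix (Fin r) (Fin r) ℝ |
      (x.2ᵀ * (x.1 + x.1ᵀ) * x.2).IsDiag} :=
  isClosed_isDiag.preimage (f := fun x : Matrix (Fin r) (Fin r) ℝ × Matrix (Fin r) (Fin r) ℝ =>
    x.2ᵀ * (x.1 + x.1ᵀ) * x.2) (by fun_prop)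

/-- By the spectral theorem applied to the symmetric part. Symmetrizing makes the set nonempty for
every matrix, so the selection below is total. -/
lemma exists_mem_diagonalizers (B : Matrix (Fin r) (Fin r) ℝ) : (diagonalizers B).Nonempty := by
  have hH : (B + Bᵀ).IsHermitian := by
    rw [Matrix.IsHermitian, Matrix.conjTranspose_eq_transpose_of_trivial, Matrix.transpose_add,
      Matrix.transpose_transpose, add_comm]
  refine ⟨hH.eigenvectorUnitary, hH.eigenvectorUnitary.2, ?_⟩
  have h := hH.conjStarAlgAut_star_eigenvectorUnitary
  rw [Unitary.conjStarAlgAut_star_apply] at h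
  have e : star (hH.eigenvectorUnitary : Matrix (Fin r) (Fin r) ℝ)
      = (hH.eigenvectorUnitary : Matrix (Fin r) (Fin r) ℝ)ᵀ := by
    rw [Matrix.star_eq_conjTranspose, Matrix.conjTranspose_eq_transpose_of_trivial]
  rw [e] at h
  rw [h]
  exact Matrix.isDiag_diagonal _

lemma isCompactMultifunction_diagonalizers :
    IsCompactMultifunction (diagonalizers (r := r)) where
  nonempty := exists_mem_diagonalizers
  isCompact B := by
    refine isCompact_orthogonalGroup.inter_right ?_
    exact isClosed_graph_diagonalizers.preimage
      (f := fun W : Matrix (Fin r) (Fin r) ℝ => (B, W)) (by fun_prop)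
  measurableSet_hit C hC := by
    have : CompactSpace {W : Matrix (Fin r) (Fin r) ℝ | W ∈ Matrix.orthogonalGroup (Fin r) ℝ} :=
      isCompact_iff_compactSpace.1 isCompact_orthogonalGroup
    -- The hit set is the projection of this closed set along the compact orthogonal group, hence is
    -- closed.
    have hcl : IsClosed {x : Matrix (Fin r) (Fin r) ℝ ×
        {W : Matrix (Fin r) (Fin r) ℝ | W ∈ Matrix.orthogonalGroup (Fin r) ℝ} |
        ((x.2 : Matrix (Fin r) (Fin r) ℝ)ᵀ * (x.1 + x.1ᵀ) * x.2).IsDiag ∧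
          (x.2 : Matrix (Fin r) (Fin r) ℝ) ∈ C} := by
      refine (isClosed_graph_diagonalizers.preimage (f := fun x : Matrix (Fin r) (Fin r) ℝ ×
        {W : Matrix (Fin r) (Fin r) ℝ | W ∈ Matrix.orthogonalGroup (Fin r) ℝ} =>
        (x.1, (x.2 : Matrix (Fin r) (Fin r) ℝ))) (by fun_prop)).inter
        (hC.preimage (continuous_subtype_val.comp continuous_snd))
    have h := (isClosedMap_fst_of_compactSpace _ hcl).measurableSet
    convert h using 1
    ext B
    simp only [Set.mem_ofPred_eq, Set.mem_image, Prod.exists, exists_and_right, exists_eq_right]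
    constructor
    · rintro ⟨W, hW, hWC⟩
      exact ⟨⟨W, hW.1⟩, hW.2, hWC⟩
    · rintro ⟨W, hW, hWC⟩
      exact ⟨W, ⟨W.2, hW⟩, hWC⟩

/-- The squared Frobenius distance from the identity matrix. -/
def sqDistOne (W : Matrix (Fin r) (Fin r) ℝ) : ℝ :=
  ∑ i, ∑ j, (W i j - (1 : Matrix (Fin r) (Fin r) ℝ) i j) ^ 2

lemma continuous_sqDistOne : Continuous (sqDistOne (r := r)) := by
  unfold sqDistOne; fun_prop

lemma sqDistOne_nonneg (W : Matrix (Fin r) (Fin r) ℝ) : 0 ≤ sqDistOne W :=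
  Finset.sum_nonneg fun _ _ => Finset.sum_nonneg fun _ _ => sq_nonneg _

lemma sq_sub_le_sqDistOne (W : Matrix (Fin r) (Fin r) ℝ) (i j : Fin r) :
    (W i j - (1 : Matrix (Fin r) (Fin r) ℝ) i j) ^ 2 ≤ sqDistOne W :=
  (Finset.single_le_sum (f := fun j => (W i j - (1 : Matrix (Fin r) (Fin r) ℝ) i j) ^ 2)
    (fun _ _ => sq_nonneg _) (Finset.mem_univ j)).trans
  (Finset.single_le_sum (f := fun i => ∑ j, (W i j - (1 : Matrix (Fin r) (Fin r) ℝ) i j) ^ 2)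
    (fun _ _ => Finset.sum_nonneg fun _ _ => sq_nonneg _) (Finset.mem_univ i))

-- Minimizing the distance to the identity comes before the tie-breaking, which uses the matrix
-- entries as separating functions; so the selected diagonalizer is both measurable and a closest
-- one.
variable (r) in
theorem exists_diagonalizer_selection :
    ∃ s : Matrix (Fin r) (Fin r) ℝ → Matrix (Fin r) (Fin r) ℝ, Measurable s ∧
      ∀ B, s B ∈ argminOn sqDistOne diagonalizers B := by
  refine (isCompactMultifunction_diagonalizers.argminOn
    continuous_sqDistOne).exists_measurable_selection
    ((Finset.univ : Finset (Fin r × Fin r)).toList.map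
      fun ij (W : Matrix (Fin r) (Fin r) ℝ) => W ij.1 ij.2) ?_ ?_
  · intro g hg
    obtain ⟨ij, -, rfl⟩ := List.mem_map.1 hg
    fun_prop
  · intro y z h
    ext i j
    exact h (fun W => W i j) (List.mem_map.2 ⟨(i, j), by simp, rfl⟩)

/-- A measurable choice of an orthogonal diagonalizer closest to the identity. -/
noncomputable def diagonalizer (B : Matrix (Fin r) (Fin r) ℝ) : Matrix (Fin r) (Fin r) ℝ :=
  (exists_diagonalizer_selection r).choose B

lemma measurable_diagonalizer : Measurable (diagonalizer (r := r)) :=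
  (exists_diagonalizer_selection r).choose_spec.1

lemma diagonalizer_mem (B : Matrix (Fin r) (Fin r) ℝ) :
    diagonalizer B ∈ argminOn sqDistOne diagonalizers B :=
  (exists_diagonalizer_selection r).choose_spec.2 B

/-- The inverse square root of the symmetric part of a matrix. -/
noncomputable def invSqrt (S : Matrix (Fin r) (Fin r) ℝ) : Matrix (Fin r) (Fin r) ℝ :=
  diagonalizer S * Matrix.diagonal (fun i => (√(((diagonalizer S)ᵀ * S * diagonalizer S) i i))⁻¹) *
    (diagonalizer S)ᵀ

lemma measurable_invSqrt : Measurable (invSqrt (r := r)) := by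
  have h1 := measurable_matrix_iff.1 (measurable_diagonalizer (r := r))
  have h2 := measurable_matrix_iff.1 (measurable_id (α := Matrix (Fin r) (Fin r) ℝ))
  simp only [id] at h2
  refine measurable_matrix_iff.2 fun i j => ?_
  simp only [invSqrt, Matrix.mul_apply, Matrix.transpose_apply]
  fun_prop

lemma isSymmInvSqrt_invSqrt {S : Matrix (Fin r) (Fin r) ℝ} (hS : S.PosDef) :
    IsSymmInvSqrt S (invSqrt S) := by
  set W := diagonalizer S with hW
  have hmem := (diagonalizer_mem S).1
  have hO : W * Wᵀ = 1 := (Matrix.mem_orthogonalGroup_iff _ _).1 hmem.1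
  have hO' : Wᵀ * W = 1 := (Matrix.mem_orthogonalGroup_iff' _ _).1 hmem.1
  have hsymm : S.IsSymm := by
    have := hS.1
    rwa [Matrix.IsHermitian, Matrix.conjTranspose_eq_transpose_of_trivial] at this
  have hdiag := isDiag_of_mem_diagonalizers hsymm hmem
  set d : Fin r → ℝ := fun i => (Wᵀ * S * W) i i with hd
  have hdW : Wᵀ * S * W = Matrix.diagonal d := by
    rw [← hdiag.diagonal_diag]; rfl
  have hinj : Function.Injective W.mulVec := fun x y h => by
    have := congrArg Wᵀ.mulVec h
    simpa [hO'] using this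
  have hpd : (Matrix.diagonal d).PosDef := by
    rw [← hdW, ← Matrix.conjTranspose_eq_transpose_of_trivial]
    exact hS.conjTranspose_mul_mul_same hinj
  have hdpos : ∀ i, 0 < d i := fun i => Matrix.posDef_diagonal_iff.1 hpd i
  have hG : invSqrt S = W * Matrix.diagonal (fun i => (√(d i))⁻¹) * Wᵀ := rfl
  have hinj' : Function.Injective Wᵀ.mulVec := fun x y h => by
    have := congrArg W.mulVec h
    simpa [hO] using this
  constructor
  · rw [hG]
    have h1 : (Matrix.diagonal (fun i => (√(d i))⁻¹)).PosDef :=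
      Matrix.posDef_diagonal_iff.2 fun i => inv_pos.2 (Real.sqrt_pos.2 (hdpos i))
    have h2 := h1.conjTranspose_mul_mul_same hinj'
    rwa [Matrix.conjTranspose_eq_transpose_of_trivial, Matrix.transpose_transpose] at h2
  · rw [hG]
    have e : W * Matrix.diagonal (fun i => (√(d i))⁻¹) * Wᵀ * S *
        (W * Matrix.diagonal (fun i => (√(d i))⁻¹) * Wᵀ)ᵀ
        = W * (Matrix.diagonal (fun i => (√(d i))⁻¹) * (Wᵀ * S * W) *
          Matrix.diagonal (fun i => (√(d i))⁻¹)) * Wᵀ := by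
      simp only [Matrix.transpose_mul, Matrix.transpose_transpose, Matrix.diagonal_transpose,
        Matrix.mul_assoc]
    have e2 : (fun i => (√(d i))⁻¹ * d i * (√(d i))⁻¹) = fun _ => (1 : ℝ) := by
      funext i
      have h := Real.sq_sqrt (hdpos i).le
      have h' := (Real.sqrt_pos.2 (hdpos i)).ne'
      field_simp
      exact h.symm
    rw [e, hdW, Matrix.diagonal_mul_diagonal, Matrix.diagonal_mul_diagonal, e2,
      Matrix.diagonal_one, Matrix.mul_one, hO]

/-- Near a diagonal matrix with distinct diagonal entries, a symmetric matrix has orthogonal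
diagonalizers near the identity. -/
theorem tendsto_sqDistOne_diagonalizer {d : Fin r → ℝ} (hd : Function.Injective d) :
    Tendsto (fun B : Matrix (Fin r) (Fin r) ℝ => sqDistOne (diagonalizer B))
      (𝓝 (Matrix.diagonal d)) (𝓝 0) := by
  have : FirstCountableTopology (Matrix (Fin r) (Fin r) ℝ) :=
    inferInstanceAs (FirstCountableTopology (Fin r → Fin r → ℝ))
  refine tendsto_of_seq_tendsto fun B hB => ?_
  refine tendsto_of_subseq_tendsto fun ns hns => ?_
  -- Arbitrary diagonalizers are chosen along the subsequence; by compactness a further subsequence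
  -- converges to an orthogonal `V`, which diagonalizes the limit `diagonal d`. `V` need not be the
  -- identity.
  choose W hW using fun k => exists_mem_diagonalizers (B (ns k))
  obtain ⟨V, hV, φ, hφ, hlim⟩ := isCompact_orthogonalGroup.tendsto_subseq fun k => (hW k).1
  refine ⟨φ, ?_⟩
  have hV1 : V * Vᵀ = 1 := (Matrix.mem_orthogonalGroup_iff _ _).1 hV
  have hV2 : Vᵀ * V = 1 := (Matrix.mem_orthogonalGroup_iff' _ _).1 hV
  have hBlim : Tendsto (fun k => B (ns (φ k))) atTop (𝓝 (Matrix.diagonal d)) :=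
    hB.comp (hns.comp hφ.tendsto_atTop)
  have hVd : (Vᵀ * (Matrix.diagonal d + (Matrix.diagonal d)ᵀ) * V).IsDiag :=
    isClosed_graph_diagonalizers.mem_of_tendsto (hBlim.prodMk_nhds hlim)
      (Eventually.of_forall fun k => (hW (φ k)).2)
  have hVd' := isDiag_of_mem_diagonalizers (Matrix.isSymm_diagonal d) ⟨hV, hVd⟩
  -- The columns of `V` are eigenvectors of `diagonal d`. As the `d k` are distinct, each column has
  -- at most one nonzero entry: `V` is a signed permutation.
  have hVprod : ∀ k k' j, k ≠ k' → V k j * V k' j = 0 := by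
    intro k k' j hkk
    have h : Matrix.diagonal d * V = V * (Vᵀ * Matrix.diagonal d * V) := by
      rw [Matrix.mul_assoc, ← Matrix.mul_assoc V, hV1, Matrix.one_mul]
    rw [← hVd'.diagonal_diag] at h
    have h1 := congrFun (congrFun h k) j
    have h2 := congrFun (congrFun h k') j
    simp only [Matrix.diagonal_mul, Matrix.mul_diagonal] at h1 h2
    have h3 : (d k - d k') * (V k j * V k' j) = 0 := by linear_combination V k' j * h1 - V k j * h2
    exact (mul_eq_zero.1 h3).resolve_left (sub_ne_zero.2 (hd.ne hkk))
  have hdiag : ∀ e : Fin r → ℝ, (V * Matrix.diagonal e * Vᵀ).IsDiag := by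
    intro e k k' hkk
    rw [Matrix.mul_apply]
    refine Finset.sum_eq_zero fun j _ => ?_
    rw [Matrix.mul_diagonal, Matrix.transpose_apply]
    linear_combination e j * hVprod k k' j hkk
  -- Undoing the signed permutation keeps a diagonalizer a diagonalizer. The competitor `W * Vᵀ`
  -- tends to `V * Vᵀ = 1`, and the selected one is at least as close to the identity.
  have hmem : ∀ k, W (φ k) * Vᵀ ∈ diagonalizers (B (ns (φ k))) := by
    intro k
    refine ⟨(Matrix.mem_orthogonalGroup_iff _ _).2 ?_, ?_⟩
    · have h := (Matrix.mem_orthogonalGroup_iff _ _).1 (hW (φ k)).1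
      rw [Matrix.transpose_mul, Matrix.transpose_transpose, Matrix.mul_assoc,
        ← Matrix.mul_assoc Vᵀ, hV2, Matrix.one_mul, h]
    · have e : (W (φ k) * Vᵀ)ᵀ * (B (ns (φ k)) + (B (ns (φ k)))ᵀ) * (W (φ k) * Vᵀ)
          = V * ((W (φ k))ᵀ * (B (ns (φ k)) + (B (ns (φ k)))ᵀ) * W (φ k)) * Vᵀ := by
        simp only [Matrix.transpose_mul, Matrix.transpose_transpose, Matrix.mul_assoc]
      rw [e, ← (hW (φ k)).2.diagonal_diag]
      exact hdiag _
  have hto : Tendsto (fun k => sqDistOne (W (φ k) * Vᵀ)) atTop (𝓝 0) := by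
    have hc : Continuous fun X : Matrix (Fin r) (Fin r) ℝ => sqDistOne (X * Vᵀ) :=
      continuous_sqDistOne.comp (by fun_prop)
    have := (hc.tendsto V).comp hlim
    rw [hV1] at this
    simpa [sqDistOne, Function.comp_def] using this
  refine squeeze_zero (fun k => ?_) (fun k => (diagonalizer_mem (B (ns (φ k)))).2 _ (hmem k)) hto
  exact sqDistOne_nonneg _

end Diagonalizers

/-! ### Calculus of first-order expansions along a filter -/

section FirstOrder

variable {ι κ : Type*} {f : Filter ι} {ρ : ι → ℝ}

/-- `T = t + l + O(ρ²)` with `l = O(ρ)` along the filter `f`. -/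
structure FirstOrder (f : Filter ι) (ρ : ι → ℝ) (T : ι → ℝ) (t : ℝ) (l : ι → ℝ) : Prop where
  lin : l =O[f] ρ
  rem : (fun i => T i - t - l i) =O[f] fun i => ρ i ^ 2

lemma isBigO_sq_self (hρ : Tendsto ρ f (𝓝 0)) : (fun i => ρ i ^ 2) =O[f] ρ := by
  have := (hρ.isBigO_one ℝ).mul (isBigO_refl ρ f)
  simpa [sq] using this

lemma isLittleO_sq_self (hρ : Tendsto ρ f (𝓝 0)) : (fun i => ρ i ^ 2) =o[f] ρ := by
  have := ((isLittleO_one_iff ℝ).2 hρ).mul_isBigO (isBigO_refl ρ f)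
  simpa [sq] using this

lemma IsBigO.mul_sq {u v : ι → ℝ} (hu : u =O[f] ρ) (hv : v =O[f] ρ) :
    (fun i => u i * v i) =O[f] fun i => ρ i ^ 2 := by
  simpa [sq] using hu.mul hv

namespace FirstOrder

variable {T S : ι → ℝ} {t s : ℝ} {l k : ι → ℝ}

lemma congr (h : FirstOrder f ρ T t l) {s : ℝ} (ht : t = s) (hl : ∀ i, l i = k i) :
    FirstOrder f ρ T s k := by
  obtain rfl : l = k := funext hl
  exact ht ▸ h

lemma congr_left (h : FirstOrder f ρ T t l) (hT : ∀ i, T i = S i) : FirstOrder f ρ S t l := by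
  obtain rfl : T = S := funext hT
  exact h

lemma of_isBigO (h : (fun i => T i - t) =O[f] ρ) : FirstOrder f ρ T t fun i => T i - t :=
  ⟨h, by simpa using isBigO_zero _ _⟩

lemma sub_isBigO (h : FirstOrder f ρ T t l) (hρ : Tendsto ρ f (𝓝 0)) :
    (fun i => T i - t) =O[f] ρ := by
  simpa using (h.rem.trans (isBigO_sq_self hρ)).add h.lin

lemma tendsto (h : FirstOrder f ρ T t l) (hρ : Tendsto ρ f (𝓝 0)) : Tendsto T f (𝓝 t) := by
  simpa using ((h.sub_isBigO hρ).trans_tendsto hρ).add_const t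

lemma add (hT : FirstOrder f ρ T t l) (hS : FirstOrder f ρ S s k) :
    FirstOrder f ρ (fun i => T i + S i) (t + s) fun i => l i + k i :=
  ⟨hT.lin.add hS.lin, (hT.rem.add hS.rem).congr_left fun i => by ring⟩

lemma mul (hρ : Tendsto ρ f (𝓝 0)) (hT : FirstOrder f ρ T t l) (hS : FirstOrder f ρ S s k) :
    FirstOrder f ρ (fun i => T i * S i) (t * s) fun i => l i * s + t * k i := by
  have hl1 : l =O[f] fun _ => (1 : ℝ) := hT.lin.trans (hρ.isBigO_one ℝ)
  refine ⟨?_, ?_⟩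
  · have h1 := hT.lin.const_mul_left s
    have h2 := hS.lin.const_mul_left t
    exact (h1.add h2).congr_left fun i => by ring
  · have h1 := hT.rem.mul ((hS.tendsto hρ).isBigO_one ℝ)
    have h2 := ((isBigO_const_const t (one_ne_zero (α := ℝ)) f).add hl1).mul hS.rem
    have h3 := IsBigO.mul_sq hT.lin hS.lin
    simp only [mul_one, one_mul] at h1 h2
    exact ((h1.add h2).add h3).congr_left fun i => by ring

lemma const_mul (c : ℝ) (hT : FirstOrder f ρ T t l) :
    FirstOrder f ρ (fun i => c * T i) (c * t) fun i => c * l i :=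
  ⟨hT.lin.const_mul_left c, (hT.rem.const_mul_left c).congr_left fun i => by ring⟩

lemma sum {A : Finset κ} {T : κ → ι → ℝ} {t : κ → ℝ} {l : κ → ι → ℝ}
    (h : ∀ a ∈ A, FirstOrder f ρ (T a) (t a) (l a)) :
    FirstOrder f ρ (fun i => ∑ a ∈ A, T a i) (∑ a ∈ A, t a) fun i => ∑ a ∈ A, l a i :=
  ⟨IsBigO.fun_sum fun a ha => (h a ha).lin,
    (IsBigO.fun_sum fun a ha => (h a ha).rem).congr_left fun i => by
      simp only [Finset.sum_sub_distrib]⟩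

end FirstOrder

end FirstOrder

/-! ### Expansion of the inverse square root -/

section MatrixExpansion

variable {ι : Type*} {f : Filter ι} {ρ σ : ι → ℝ} {r : ℕ}

lemma isBigO_matrix_mul {A B : ι → Matrix (Fin r) (Fin r) ℝ}
    (hA : ∀ i j, (fun t => A t i j) =O[f] ρ) (hB : ∀ i j, (fun t => B t i j) =O[f] σ)
    (i j : Fin r) : (fun t => (A t * B t) i j) =O[f] fun t => ρ t * σ t := by
  simp only [Matrix.mul_apply]
  exact IsBigO.fun_sum fun k _ => (hA i k).mul (hB k j)

/-- For positive definite `L`, `L - 1` is bounded by `L² - 1` in Frobenius norm. -/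
lemma sq_sub_one_le_of_posDef {L : Matrix (Fin r) (Fin r) ℝ} (hL : L.PosDef) (i j : Fin r) :
    ((L - 1) i j) ^ 2 ≤ ∑ i, ∑ j, ((L * L - 1) i j) ^ 2 := by
  set X := L - 1 with hX
  have frob : ∀ A : Matrix (Fin r) (Fin r) ℝ, ∑ i, ∑ j, (A i j) ^ 2 = (A * Aᵀ).trace := by
    intro A
    simp [Matrix.trace, Matrix.mul_apply, sq]
  have hLt : Lᵀ = L := by
    have := hL.1
    rwa [Matrix.IsHermitian, Matrix.conjTranspose_eq_transpose_of_trivial] at this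
  -- The squared norm of `X * L + X` is ‖XL‖² + 2 tr(XLXᵀ) + ‖X‖², and the middle term is
  -- nonnegative because `L` is positive definite.
  have e : L * L - 1 = X * L + X := by
    rw [hX, Matrix.sub_mul, Matrix.one_mul]; abel
  have h1 : 0 ≤ (X * L * Xᵀ).trace := by
    have := (hL.posSemidef.mul_mul_conjTranspose_same X).trace_nonneg
    rwa [Matrix.conjTranspose_eq_transpose_of_trivial] at this
  have h2 : 0 ≤ (X * L * (X * L)ᵀ).trace := by
    rw [← frob]; exact Finset.sum_nonneg fun _ _ => Finset.sum_nonneg fun _ _ => sq_nonneg _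
  have h3 : (X * (X * L)ᵀ).trace = (X * L * Xᵀ).trace := by
    rw [Matrix.transpose_mul, hLt, Matrix.mul_assoc]
  have h4 : ((L * L - 1) * (L * L - 1)ᵀ).trace
      = (X * L * (X * L)ᵀ).trace + 2 * (X * L * Xᵀ).trace + (X * Xᵀ).trace := by
    rw [e, Matrix.transpose_add, Matrix.add_mul, Matrix.mul_add, Matrix.mul_add, Matrix.trace_add,
      Matrix.trace_add, Matrix.trace_add, h3]
    ring
  have h5 : (X i j) ^ 2 ≤ ∑ i, ∑ j, (X i j) ^ 2 :=
    (Finset.single_le_sum (f := fun j => (X i j) ^ 2) (fun _ _ => sq_nonneg _)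
      (Finset.mem_univ j)).trans
    (Finset.single_le_sum (f := fun i => ∑ j, (X i j) ^ 2)
      (fun _ _ => Finset.sum_nonneg fun _ _ => sq_nonneg _) (Finset.mem_univ i))
  rw [frob] at h5 ⊢
  linarith

lemma IsSymmInvSqrt.sq_mul {S L : Matrix (Fin r) (Fin r) ℝ} (h : IsSymmInvSqrt S L) :
    L * L * S = 1 := by
  have hLt : Lᵀ = L := by
    have := h.1.1
    rwa [Matrix.IsHermitian, Matrix.conjTranspose_eq_transpose_of_trivial] at this
  have h2 := h.2
  rw [hLt] at h2
  rw [Matrix.mul_assoc]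
  exact mul_eq_one_comm.1 h2

lemma tendsto_matrix_iff {A : ι → Matrix (Fin r) (Fin r) ℝ} {B : Matrix (Fin r) (Fin r) ℝ} :
    Tendsto A f (𝓝 B) ↔ ∀ i j, Tendsto (fun t => A t i j) f (𝓝 (B i j)) := by
  refine tendsto_pi_nhds.trans (forall_congr' fun i => ?_)
  exact tendsto_pi_nhds

/-- From `L * L * S = 1`, L² - 1 = S⁻¹(1 - S) is O(ρ), and positive definiteness passes this bound
on to L - 1. Then 2(L - 1) = (L² - 1) - (L - 1)² and L² - 1 = (1 - S) + (L² - 1)(1 - S) leave (1 -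
S)/2 up to O(ρ²). -/
theorem FirstOrder.invSqrt (hρ : Tendsto ρ f (𝓝 0)) {S L s : ι → Matrix (Fin r) (Fin r) ℝ}
    (hS : ∀ i j, FirstOrder f ρ (fun t => S t i j) ((1 : Matrix (Fin r) (Fin r) ℝ) i j)
      fun t => s t i j)
    (hL : ∀ᶠ t in f, IsSymmInvSqrt (S t) (L t)) (i j : Fin r) :
    FirstOrder f ρ (fun t => L t i j) ((1 : Matrix (Fin r) (Fin r) ℝ) i j)
      fun t => -(1 / 2) * s t i j := by
  have hS1 : ∀ i j, (fun t => (1 - S t) i j) =O[f] ρ := fun i j =>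
    ((hS i j).sub_isBigO hρ).neg_left.congr_left fun t => by simp
  have hSlim : Tendsto S f (𝓝 1) := tendsto_matrix_iff.2 fun i j => (hS i j).tendsto hρ
  have hinv : Tendsto (fun t => (S t)⁻¹) f (𝓝 1) := by
    have hdet : Tendsto (fun t => (S t).det) f (𝓝 1) := by
      have := (continuous_id.matrix_det.tendsto (1 : Matrix (Fin r) (Fin r) ℝ)).comp hSlim
      simpa [Function.comp_def] using this
    have hadj : Tendsto (fun t => (S t).adjugate) f (𝓝 1) := by
      have := (continuous_id.matrix_adjugate.tendsto (1 : Matrix (Fin r) (Fin r) ℝ)).comp hSlim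
      simpa [Function.comp_def] using this
    have := (hdet.inv₀ one_ne_zero).smul hadj
    simpa [Matrix.inv_def, Ring.inverse_eq_inv'] using this
  have hsq : ∀ᶠ t in f, L t * L t - 1 = (S t)⁻¹ * (1 - S t) := by
    filter_upwards [hL] with t ht
    have h := ht.sq_mul
    rw [Matrix.inv_eq_left_inv h, Matrix.mul_sub, h, Matrix.mul_one]
  have hD : ∀ i j, (fun t => (L t * L t - 1) i j) =O[f] ρ := by
    intro i j
    have h := isBigO_matrix_mul (fun i j => (tendsto_matrix_iff.1 hinv i j).isBigO_one ℝ) hS1 i j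
    simp only [one_mul] at h
    refine h.congr' ?_ EventuallyEq.rfl
    filter_upwards [hsq] with t ht
    rw [ht]
  have hL1 : ∀ i j, (fun t => (L t - 1) i j) =O[f] ρ := by
    intro i j
    have h : (fun t => ∑ i, ∑ j, |(L t * L t - 1) i j|) =O[f] ρ :=
      IsBigO.fun_sum fun i _ => IsBigO.fun_sum fun j _ => (hD i j).norm_left
    refine (IsBigO.of_bound 1 ?_).trans h
    filter_upwards [hL] with t ht
    have h0 : 0 ≤ ∑ i, ∑ j, |(L t * L t - 1) i j| :=
      Finset.sum_nonneg fun _ _ => Finset.sum_nonneg fun _ _ => abs_nonneg _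
    rw [one_mul, Real.norm_eq_abs, Real.norm_of_nonneg h0]
    refine abs_le_of_sq_le_sq ?_ h0
    refine (sq_sub_one_le_of_posDef ht.1 i j).trans ?_
    have h1 := Finset.sum_sq_le_sq_sum_of_nonneg (s := Finset.univ)
      (f := fun x : Fin r × Fin r => |(L t * L t - 1) x.1 x.2|) fun _ _ => abs_nonneg _
    simpa only [sq_abs, Fintype.sum_prod_type] using h1
  refine ⟨(hS i j).lin.const_mul_left _, ?_⟩
  have h1 : (fun t => (1 - S t) i j + s t i j) =O[f] fun t => ρ t ^ 2 :=
    (hS i j).rem.neg_left.congr_left fun t => by simp only [Matrix.sub_apply]; ring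
  have h2 := isBigO_matrix_mul hD hS1 i j
  have h3 := isBigO_matrix_mul hL1 hL1 i j
  have hsq' : (fun t => ρ t * ρ t) = fun t => ρ t ^ 2 := funext fun t => (sq _).symm
  rw [hsq'] at h2 h3
  refine (((h1.add h2).sub h3).const_mul_left (1 / 2)).congr' ?_ EventuallyEq.rfl
  filter_upwards [hL] with t ht
  have hmul := ht.sq_mul
  have e : (L t * L t - 1) * (1 - S t) = L t * L t - 1 - 1 + S t := by
    rw [Matrix.sub_mul, Matrix.mul_sub, hmul, Matrix.mul_one, Matrix.one_mul]; abel
  have e2 : (L t - 1) * (L t - 1) = L t * L t - L t - L t + 1 := by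
    rw [Matrix.sub_mul, Matrix.mul_sub, Matrix.mul_one, Matrix.one_mul]; abel
  rw [e, e2]
  simp only [Matrix.sub_apply, Matrix.add_apply]
  ring

end MatrixExpansion

/-! ### Perturbation of eigenvectors -/

section Eigenvectors

variable {ι : Type*} {f : Filter ι} {ρ : ι → ℝ} {r : ℕ}

/-- Perturbation of the eigenvectors of a diagonal matrix with distinct entries. -/
theorem isLittleO_eigenvectors (hρ : Tendsto ρ f (𝓝 0)) {b : Fin r → ℝ}
    {B U l : ι → Matrix (Fin r) (Fin r) ℝ} (hb : Function.Injective b)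
    (hB0 : Tendsto B f (𝓝 (Matrix.diagonal b)))
    (hB : ∀ k k', k ≠ k' → FirstOrder f ρ (fun t => B t k k') 0 fun t => l t k k')
    (hU : Tendsto U f (𝓝 1)) (horth : ∀ᶠ t in f, U t ∈ Matrix.orthogonalGroup (Fin r) ℝ)
    (hdiag : ∀ᶠ t in f, (U t * B t * (U t)ᵀ).IsDiag) :
    (∀ k k', k ≠ k' → (fun t => U t k k' - l t k k' / (b k - b k')) =o[f] ρ) ∧
      ∀ k, (fun t => U t k k - 1) =o[f] ρ := by
  have hBO : ∀ k k', k ≠ k' → (fun t => B t k k') =O[f] ρ := fun k k' h => by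
    simpa using (hB k k' h).sub_isBigO hρ
  have hU1 : ∀ k j, Tendsto (fun t => U t k j - (1 : Matrix (Fin r) (Fin r) ℝ) k j) f (𝓝 0) :=
    fun k j => by
      simpa using (tendsto_matrix_iff.1 hU k j).sub_const ((1 : Matrix (Fin r) (Fin r) ℝ) k j)
  have hD : Tendsto (fun t => U t * B t * (U t)ᵀ) f (𝓝 (Matrix.diagonal b)) := by
    have hc : Continuous fun x : Matrix (Fin r) (Fin r) ℝ × Matrix (Fin r) (Fin r) ℝ =>
        x.1 * x.2 * x.1ᵀ := by fun_prop
    have := (hc.tendsto (1, Matrix.diagonal b)).comp (hU.prodMk_nhds hB0)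
    simpa [Function.comp_def] using this
  -- Entry (k, k') of U B = D U, where D = U B Uᵀ is diagonal. On the right, `U` is compared with
  -- the identity, so each product there is o(1) times O(ρ).
  have key : ∀ k k', k ≠ k' → ∀ᶠ t in f,
      U t k k' * ((U t * B t * (U t)ᵀ) k k - B t k' k') - l t k k'
        = ∑ j ∈ Finset.univ.erase k', (U t k j - (1 : Matrix (Fin r) (Fin r) ℝ) k j) * B t j k'
          + (B t k k' - 0 - l t k k') := by
    intro k k' hk
    filter_upwards [horth, hdiag] with t ho hd
    have h1 := (Matrix.mem_orthogonalGroup_iff' _ _).1 ho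
    have h2 : U t * B t = (U t * B t * (U t)ᵀ) * U t := by
      rw [Matrix.mul_assoc (U t * B t), h1, Matrix.mul_one]
    have h3 := congrFun (congrFun h2 k) k'
    rw [← hd.diagonal_diag, Matrix.diagonal_mul, Matrix.mul_apply, Matrix.diag_apply,
      ← Finset.add_sum_erase _ _ (Finset.mem_univ k')] at h3
    have h4 : ∑ j ∈ Finset.univ.erase k', (1 : Matrix (Fin r) (Fin r) ℝ) k j * B t j k'
        = B t k k' := by
      rw [Finset.sum_eq_single_of_mem k (by simp [hk])]
      · simp
      · intro j _ hj; simp [Matrix.one_apply_ne' hj]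
    simp only [sub_mul, Finset.sum_sub_distrib, h4]
    linear_combination -h3
  have off : ∀ k k', k ≠ k' → (fun t => U t k k' - l t k k' / (b k - b k')) =o[f] ρ := by
    intro k k' hk
    have hc : b k - b k' ≠ 0 := sub_ne_zero.2 (hb.ne hk)
    have hv : Tendsto (fun t => (U t * B t * (U t)ᵀ) k k - B t k' k') f (𝓝 (b k - b k')) := by
      have h1 := tendsto_matrix_iff.1 hD k k
      have h2 := tendsto_matrix_iff.1 hB0 k' k'
      rw [Matrix.diagonal_apply_eq] at h1 h2
      exact h1.sub h2
    have hR : (fun t => U t k k' * ((U t * B t * (U t)ᵀ) k k - B t k' k') - l t k k') =o[f] ρ := by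
      refine IsLittleO.congr' ?_ ((key k k' hk).mono fun t ht => ht.symm) EventuallyEq.rfl
      refine IsLittleO.add (IsLittleO.fun_sum fun j hj => ?_)
        ((hB k k' hk).rem.trans_isLittleO (isLittleO_sq_self hρ))
      simpa using ((isLittleO_one_iff ℝ).2 (hU1 k j)).mul_isBigO (hBO j k' (Finset.ne_of_mem_erase hj))
    -- Replacing the varying denominator by its limit `b k - b k'` costs O(ρ) times o(1).
    have hvi : Tendsto (fun t => ((U t * B t * (U t)ᵀ) k k - B t k' k')⁻¹ - (b k - b k')⁻¹) f
        (𝓝 0) := by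
      simpa using (hv.inv₀ hc).sub_const (b k - b k')⁻¹
    have h1 := hR.mul_isBigO ((hv.inv₀ hc).isBigO_one ℝ)
    have h2 := (hB k k' hk).lin.mul_isLittleO ((isLittleO_one_iff ℝ).2 hvi)
    simp only [mul_one] at h1 h2
    refine (h1.add h2).congr' ?_ EventuallyEq.rfl
    filter_upwards [hv.eventually_ne hc] with t ht
    field_simp
    ring
  refine ⟨off, fun k => ?_⟩
  have hO : ∀ j, j ≠ k → (fun t => U t k j) =O[f] ρ := fun j hj => by
    have h1 := (off k j hj.symm).isBigO.add ((hB k j hj.symm).lin.const_mul_left (b k - b j)⁻¹)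
    exact h1.congr_left fun t => by ring
  -- Row `k` of `U` has norm one, so (U_kk - 1)(U_kk + 1) is minus this sum of squares, which is of
  -- second order.
  have hS : (fun t => ∑ j ∈ Finset.univ.erase k, U t k j * U t k j) =o[f] ρ :=
    IsLittleO.fun_sum fun j hj => (IsBigO.mul_sq (hO j (Finset.ne_of_mem_erase hj))
      (hO j (Finset.ne_of_mem_erase hj))).trans_isLittleO (isLittleO_sq_self hρ)
  have hk : Tendsto (fun t => U t k k + 1) f (𝓝 2) := by
    have h := (tendsto_matrix_iff.1 hU k k).add_const 1
    rw [Matrix.one_apply_eq] at h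
    convert h using 2
    norm_num
  have h1 := (hS.neg_left).mul_isBigO ((hk.inv₀ two_ne_zero).isBigO_one ℝ)
  simp only [mul_one] at h1
  refine h1.congr' ?_ EventuallyEq.rfl
  filter_upwards [horth, hk.eventually_ne two_ne_zero] with t ho hne
  have h2 := congrFun (congrFun ((Matrix.mem_orthogonalGroup_iff _ _).1 ho) k) k
  rw [Matrix.mul_apply, Matrix.one_apply_eq, ← Finset.add_sum_erase _ _ (Finset.mem_univ k)] at h2
  simp only [Matrix.transpose_apply] at h2
  rw [← div_eq_mul_inv, div_eq_iff hne]
  linear_combination -h2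

/-- First-order expansion of `U * L` when `U` and `L` tend to the identity. -/
lemma isLittleO_mul_sub_one {U L : ι → Matrix (Fin r) (Fin r) ℝ} (hU : Tendsto U f (𝓝 1))
    (hL : ∀ i j, (fun t => (L t - 1) i j) =O[f] ρ) (i j : Fin r) :
    (fun t => (U t * L t - 1) i j - (U t - 1) i j - (L t - 1) i j) =o[f] ρ := by
  have hU1 : ∀ k j : Fin r, Tendsto (fun t => (U t - 1) k j) f (𝓝 0) := fun k j => by
    simpa using (tendsto_matrix_iff.1 hU k j).sub_const ((1 : Matrix (Fin r) (Fin r) ℝ) k j)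
  have h : (fun t => ((U t - 1) * (L t - 1)) i j) =o[f] ρ := by
    simp only [Matrix.mul_apply]
    refine IsLittleO.fun_sum fun k _ => ?_
    simpa using ((isLittleO_one_iff ℝ).2 (hU1 i k)).mul_isBigO (hL k j)
  refine h.congr_left fun t => ?_
  have e : (U t - 1) * (L t - 1) = (U t * L t - 1) - (U t - 1) - (L t - 1) := by
    rw [Matrix.sub_mul, Matrix.mul_sub, Matrix.mul_one, Matrix.one_mul]; abel
  rw [e]
  rfl

end Eigenvectors

/-! ### Covariance and FOBI matrices as functions of the moments -/

section Tensors

variable {p q : ℕ}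

/-- Indices of the components of a matrix, and `none` for the constant `1`. -/
abbrev Idx (p q : ℕ) := Option (Fin p × Fin q)

/-- Arrays of moments up to the fourth order. -/
abbrev Tensor (p q : ℕ) := Idx p q → Idx p q → Idx p q → Idx p q → ℝ

/-- The components of a matrix, augmented by the constant `1`. -/
def aug (x : Matrix (Fin p) (Fin q) ℝ) : Idx p q → ℝ
  | none => 1
  | some a => x a.1 a.2

/-- The monomials of degree at most four in the components of a matrix. -/
def monomials (x : Matrix (Fin p) (Fin q) ℝ) : Tensor p q :=
  fun a b c d => aug x a * aug x b * aug x c * aug x d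

/-- The left covariance matrix as a function of the moments. -/
noncomputable def leftCov (centered : Bool) (m : Tensor p q) : Matrix (Fin p) (Fin p) ℝ :=
  fun k k' => (q : ℝ)⁻¹ * ∑ l, (m none none (some (k, l)) (some (k', l)) -
    if centered then m none none none (some (k, l)) * m none none none (some (k', l)) else 0)

/-- The right covariance matrix as a function of the moments. -/
noncomputable def rightCov (centered : Bool) (m : Tensor p q) : Matrix (Fin q) (Fin q) ℝ :=
  fun l l' => (p : ℝ)⁻¹ * ∑ k, (m none none (some (k, l)) (some (k, l')) -
    if centered then m none none none (some (k, l)) * m none none none (some (k, l')) else 0)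

/-- The coefficients of the centered and standardized components with respect to the components
and the constant `1`. -/
def weight (L : Matrix (Fin p) (Fin p) ℝ) (R : Matrix (Fin q) (Fin q) ℝ) (m : Tensor p q)
    (a : Fin p × Fin q) : Idx p q → ℝ
  | none => -∑ c : Fin p × Fin q, L a.1 c.1 * R a.2 c.2 * m none none none (some c)
  | some c => L a.1 c.1 * R a.2 c.2

/-- Fourth moments after a linear change of variables. -/
def quartic (K : Fin p × Fin q → Idx p q → ℝ) (m : Tensor p q) (a b c d : Fin p × Fin q) : ℝ :=
  ∑ e₁, ∑ e₂, ∑ e₃, ∑ e₄, K a e₁ * K b e₂ * K c e₃ * K d e₄ * m e₁ e₂ e₃ e₄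

/-- The first inner column index in the FOBI kernel. -/
def innerCol (N : Fin 2) (l l' : Fin q) : Fin q := if N = 0 then l else l'

/-- The last column index in the FOBI kernel. -/
def lastCol (N : Fin 2) (l l' : Fin q) : Fin q := if N = 0 then l' else l

/-- The sum of an array over the fourth order terms of the entry `(k, k')` of the FOBI kernel. -/
def fobiSum (N : Fin 2) (T : Fin p × Fin q → Fin p × Fin q → Fin p × Fin q → Fin p × Fin q → ℝ)
    (k k' : Fin p) : ℝ :=
  ∑ t : Fin q × Fin p × Fin q, T (k, t.1) (t.2.1, innerCol N t.1 t.2.2) (t.2.1, t.2.2)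
    (k', lastCol N t.1 t.2.2)

/-- The left FOBI matrix as a function of the moments. -/
noncomputable def fobiMatrix (N : Fin 2) (L : Matrix (Fin p) (Fin p) ℝ)
    (R : Matrix (Fin q) (Fin q) ℝ) (m : Tensor p q) : Matrix (Fin p) (Fin p) ℝ :=
  fun k k' => (q : ℝ)⁻¹ * fobiSum N (quartic (weight L R m) m) k k'

/-- The structure of the moments of independent standardized components with third moments
`g`. -/
structure IsStdMoments (μ : Tensor p q) (g : Fin p → Fin q → ℝ) : Prop where
  one : ∀ a, μ none none none (some a) = 0
  two : ∀ a b, μ none none (some a) (some b) = if a = b then 1 else 0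
  three₁ : ∀ b c d, μ none (some b) (some c) (some d) = if b = c ∧ c = d then g d.1 d.2 else 0
  three₂ : ∀ b c d, μ (some b) none (some c) (some d) = if b = c ∧ c = d then g d.1 d.2 else 0
  three₃ : ∀ b c d, μ (some b) (some c) none (some d) = if b = c ∧ c = d then g d.1 d.2 else 0
  three₄ : ∀ b c d, μ (some b) (some c) (some d) none = if b = c ∧ c = d then g d.1 d.2 else 0
  four : ∀ a b c d, a ≠ d → μ (some a) (some b) (some c) (some d)
    = (if a = b ∧ c = d then 1 else 0) + if a = c ∧ b = d then 1 else 0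

/-- The multiplicity `Λ` of the contributions of the left covariance matrix to the inner
factors of the FOBI kernel. -/
def innerMult (N : Fin 2) (q : ℕ) : ℝ := if N = 0 then (q : ℝ) ^ 2 + q else 2 * q

/-- The linearization of the off-diagonal entries of the FOBI matrix. -/
noncomputable def fobiLin (N : Fin 2) (b : Fin p → ℝ) (g : Fin p → Fin q → ℝ)
    (s : Matrix (Fin p) (Fin p) ℝ) (m : Tensor p q) (k k' : Fin p) : ℝ :=
  (q : ℝ)⁻¹ * (fobiSum N (fun a b c d => m (some a) (some b) (some c) (some d)) k k'
    - ∑ l, (m none none none (some (k, l)) * g k' l + m none none none (some (k', l)) * g k l))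
  + s k k' * (b k + b k' + 2 * (q : ℝ)⁻¹ * innerMult N q)

end Tensors

/-! ### Linearization of the estimate in the moments -/

section Expansion

variable {ι : Type*} {f : Filter ι} {ρ : ι → ℝ} {p q : ℕ} {m : ι → Tensor p q} {μ : Tensor p q}
  {g : Fin p → Fin q → ℝ}

lemma firstOrder_mean (hm : ∀ a b c d, (fun t => m t a b c d - μ a b c d) =O[f] ρ)
    (hμ : IsStdMoments μ g) (a : Fin p × Fin q) :
    FirstOrder f ρ (fun t => m t none none none (some a)) 0 fun t => m t none none none (some a) :=
  (FirstOrder.of_isBigO (hm _ _ _ _)).congr (hμ.one a) fun t => by rw [hμ.one, sub_zero]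

/-- The product of two sample means is of second order. Hence both centering conventions have the
same linearization and lead to the same limit. -/
lemma firstOrder_cov (hρ : Tendsto ρ f (𝓝 0))
    (hm : ∀ a b c d, (fun t => m t a b c d - μ a b c d) =O[f] ρ) (hμ : IsStdMoments μ g)
    (centered : Bool) (a b : Fin p × Fin q) :
    FirstOrder f ρ (fun t => m t none none (some a) (some b) -
        if centered then m t none none none (some a) * m t none none none (some b) else 0)
      (if a = b then 1 else 0)
      fun t => m t none none (some a) (some b) - if a = b then 1 else 0 := by
  have h2 : FirstOrder f ρ (fun t => m t none none (some a) (some b)) (if a = b then 1 else 0)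
      fun t => m t none none (some a) (some b) - if a = b then 1 else 0 :=
    (FirstOrder.of_isBigO (hm _ _ _ _)).congr (hμ.two a b) fun t => by rw [hμ.two]
  cases centered
  · simpa using h2
  · have h3 := (h2.add (((firstOrder_mean hm hμ a).mul hρ
      (firstOrder_mean hm hμ b)).const_mul (-1))).congr (k := fun t => m t none none (some a)
        (some b) - if a = b then 1 else 0) (by rw [mul_zero, mul_zero, add_zero]) (by simp)
    exact h3.congr_left fun t => by simp [sub_eq_add_neg]

lemma firstOrder_leftCov (hρ : Tendsto ρ f (𝓝 0)) (hq : 0 < q)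
    (hm : ∀ a b c d, (fun t => m t a b c d - μ a b c d) =O[f] ρ) (hμ : IsStdMoments μ g)
    (centered : Bool) (k k' : Fin p) :
    FirstOrder f ρ (fun t => leftCov centered (m t) k k') ((1 : Matrix (Fin p) (Fin p) ℝ) k k')
      fun t => (q : ℝ)⁻¹ * ∑ l, (m t none none (some (k, l)) (some (k', l)) -
        (1 : Matrix (Fin p) (Fin p) ℝ) k k') := by
  have hq' : (q : ℝ) ≠ 0 := by positivity
  refine ((FirstOrder.sum (A := Finset.univ) fun l _ =>
    firstOrder_cov hρ hm hμ centered (k, l) (k', l)).const_mul (q : ℝ)⁻¹).congr ?_ fun t => ?_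
  · simp [Matrix.one_apply, hq']
  · simp [Matrix.one_apply]

lemma firstOrder_rightCov (hρ : Tendsto ρ f (𝓝 0)) (hp : 0 < p)
    (hm : ∀ a b c d, (fun t => m t a b c d - μ a b c d) =O[f] ρ) (hμ : IsStdMoments μ g)
    (centered : Bool) (l l' : Fin q) :
    FirstOrder f ρ (fun t => rightCov centered (m t) l l') ((1 : Matrix (Fin q) (Fin q) ℝ) l l')
      fun t => (p : ℝ)⁻¹ * ∑ k, (m t none none (some (k, l)) (some (k, l')) -
        (1 : Matrix (Fin q) (Fin q) ℝ) l l') := by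
  have hp' : (p : ℝ) ≠ 0 := by positivity
  refine ((FirstOrder.sum (A := Finset.univ) fun k _ =>
    firstOrder_cov hρ hm hμ centered (k, l) (k, l')).const_mul (p : ℝ)⁻¹).congr ?_ fun t => ?_
  · simp [Matrix.one_apply, hp']
  · simp [Matrix.one_apply]

variable {L s : ι → Matrix (Fin p) (Fin p) ℝ} {R r : ι → Matrix (Fin q) (Fin q) ℝ}

/-- The linear part of `weight`. -/
def weightLin (s : Matrix (Fin p) (Fin p) ℝ) (r : Matrix (Fin q) (Fin q) ℝ) (m : Tensor p q)
    (a : Fin p × Fin q) : Idx p q → ℝ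
  | none => -m none none none (some a)
  | some c => s a.1 c.1 * (1 : Matrix (Fin q) (Fin q) ℝ) a.2 c.2 +
      (1 : Matrix (Fin p) (Fin p) ℝ) a.1 c.1 * r a.2 c.2

/-- In the coefficient of the constant, the means already vanish in the limit, so `L` and `R` enter
there only through their limits. -/
lemma firstOrder_weight (hρ : Tendsto ρ f (𝓝 0))
    (hm : ∀ a b c d, (fun t => m t a b c d - μ a b c d) =O[f] ρ) (hμ : IsStdMoments μ g)
    (hL : ∀ i j, FirstOrder f ρ (fun t => L t i j) ((1 : Matrix (Fin p) (Fin p) ℝ) i j)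
      fun t => s t i j)
    (hR : ∀ i j, FirstOrder f ρ (fun t => R t i j) ((1 : Matrix (Fin q) (Fin q) ℝ) i j)
      fun t => r t i j) (a : Fin p × Fin q) (e : Idx p q) :
    FirstOrder f ρ (fun t => weight (L t) (R t) (m t) a e) (if e = some a then 1 else 0)
      fun t => weightLin (s t) (r t) (m t) a e := by
  have hLR : ∀ c : Fin p × Fin q, (1 : Matrix (Fin p) (Fin p) ℝ) a.1 c.1 *
      (1 : Matrix (Fin q) (Fin q) ℝ) a.2 c.2 = if a = c then 1 else 0 := by
    intro c
    simp only [Matrix.one_apply, Prod.ext_iff, ← ite_and, mul_ite, mul_one, mul_zero]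
    simp only [and_comm]
  cases e with
  | none =>
    have h2 := (FirstOrder.sum (A := Finset.univ) fun (c : Fin p × Fin q) _ =>
      ((hL a.1 c.1).mul hρ (hR a.2 c.2)).mul hρ (firstOrder_mean hm hμ c)).const_mul (-1)
    refine (h2.congr (by simp) fun t => ?_).congr_left fun t => ?_
    · simp only [hLR, mul_zero, zero_add]
      simp [weightLin]
    · simp [weight]
  | some c =>
    refine ((hL a.1 c.1).mul hρ (hR a.2 c.2)).congr ?_ fun t => rfl
    rw [hLR]
    simp only [Option.some.injEq, eq_comm]

/-- The limiting coefficients are Kronecker deltas, so the product rule perturbs one of the five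
factors at a time and the other sums collapse. -/
lemma firstOrder_quartic (hρ : Tendsto ρ f (𝓝 0))
    (hm : ∀ a b c d, (fun t => m t a b c d - μ a b c d) =O[f] ρ)
    {K k : ι → Fin p × Fin q → Idx p q → ℝ}
    (hK : ∀ a e, FirstOrder f ρ (fun t => K t a e) (if e = some a then 1 else 0)
      fun t => k t a e) (a b c d : Fin p × Fin q) :
    FirstOrder f ρ (fun t => quartic (K t) (m t) a b c d) (μ (some a) (some b) (some c) (some d))
      fun t => (m t (some a) (some b) (some c) (some d) - μ (some a) (some b) (some c) (some d)) +
        ∑ e, (k t a e * μ e (some b) (some c) (some d) + k t b e * μ (some a) e (some c) (some d) +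
          k t c e * μ (some a) (some b) e (some d) + k t d e * μ (some a) (some b) (some c) e) := by
  have h := FirstOrder.sum (f := f) (ρ := ρ) (A := Finset.univ) fun e₁ _ => FirstOrder.sum
    (A := Finset.univ) fun e₂ _ => FirstOrder.sum (A := Finset.univ) fun e₃ _ => FirstOrder.sum
    (A := Finset.univ) fun e₄ _ => ((((hK a e₁).mul hρ (hK b e₂)).mul hρ (hK c e₃)).mul hρ
      (hK d e₄)).mul hρ (FirstOrder.of_isBigO (hm e₁ e₂ e₃ e₄))
  refine h.congr ?_ fun t => ?_
  · simp
  · simp only [add_mul, Finset.sum_add_distrib]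
    simp
    ring

lemma FirstOrder.fobiSum {N : Fin 2}
    {T : ι → Fin p × Fin q → Fin p × Fin q → Fin p × Fin q → Fin p × Fin q → ℝ}
    {T₀ : Fin p × Fin q → Fin p × Fin q → Fin p × Fin q → Fin p × Fin q → ℝ}
    {l : ι → Fin p × Fin q → Fin p × Fin q → Fin p × Fin q → Fin p × Fin q → ℝ}
    (h : ∀ a b c d, FirstOrder f ρ (fun t => T t a b c d) (T₀ a b c d) fun t => l t a b c d)
    (k k' : Fin p) :
    FirstOrder f ρ (fun t => fobiSum N (T t) k k') (fobiSum N T₀ k k')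
      fun t => fobiSum N (l t) k k' :=
  FirstOrder.sum fun _ _ => h _ _ _ _

lemma sum_weightLin (s : Matrix (Fin p) (Fin p) ℝ) (r : Matrix (Fin q) (Fin q) ℝ)
    (m : Tensor p q) (a : Fin p × Fin q) (F : Idx p q → ℝ) :
    ∑ e, weightLin s r m a e * F e = -(m none none none (some a) * F none)
      + ∑ x, s a.1 x * F (some (x, a.2)) + ∑ y, r a.2 y * F (some (a.1, y)) := by
  rw [Fintype.sum_option, Fintype.sum_prod_type]
  simp [weightLin, add_mul, Finset.sum_add_distrib, Matrix.one_apply, ite_mul, mul_ite, add_assoc]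

/-- With the first and last entries in different rows, only two of the three pairings can
contribute; separating row from column conditions lets the row sums be evaluated first. -/
lemma IsStdMoments.four_of_ne (hμ : IsStdMoments μ g) {k x y k' : Fin p} (h : k ≠ k')
    (l l₁ l₂ l₃ : Fin q) :
    μ (some (k, l)) (some (x, l₁)) (some (y, l₂)) (some (k', l₃))
      = (if k = x then if y = k' then if l = l₁ ∧ l₂ = l₃ then 1 else 0 else 0 else 0)
        + if k = y then if x = k' then if l = l₂ ∧ l₁ = l₃ then 1 else 0 else 0 else 0 := by
  rw [hμ.four _ _ _ _ fun e => h (congrArg Prod.fst e)]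
  simp only [Prod.mk.injEq, ← ite_and]
  congr 1 <;> exact if_congr (by tauto) rfl rfl

/-- A pairing would force `k = x = k'`. A change of column indices alone never leaves this pattern,
which is why the right standardization has no first-order effect. -/
lemma IsStdMoments.four_eq_zero (hμ : IsStdMoments μ g) {k x k' : Fin p} (h : k ≠ k')
    (l l₁ l₂ l₃ : Fin q) :
    μ (some (k, l)) (some (x, l₁)) (some (x, l₂)) (some (k', l₃)) = 0 := by
  rw [hμ.four_of_ne h]
  by_cases h1 : k = x <;> by_cases h2 : x = k' <;> simp_all

lemma fobiSum_eq_zero (hμ : IsStdMoments μ g) (N : Fin 2) {k k' : Fin p} (h : k ≠ k') :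
    fobiSum N (fun a b c d => μ (some a) (some b) (some c) (some d)) k k' = 0 :=
  Finset.sum_eq_zero fun _ _ => hμ.four_eq_zero h _ _ _ _

/-- The left standardization moves the first row from `k` to some `x`. Independence leaves only `x =
k'`, a diagonal entry of the FOBI matrix; the centering leaves third moments in row `k'`. -/
lemma fobiSum_first (hμ : IsStdMoments μ g) (N : Fin 2) {k k' : Fin p} (h : k ≠ k')
    (s : Matrix (Fin p) (Fin p) ℝ) (r : Matrix (Fin q) (Fin q) ℝ) (m : Tensor p q) :
    fobiSum N (fun a b c d => ∑ e, weightLin s r m a e * μ e (some b) (some c) (some d)) k k'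
      = -∑ l, m none none none (some (k, l)) * g k' l
        + s k k' * fobiSum N (fun a b c d => μ (some a) (some b) (some c) (some d)) k' k' := by
  have h1 : ∑ x, s k x * fobiSum N (fun a b c d => μ (some a) (some b) (some c) (some d)) x k'
      = s k k' * fobiSum N (fun a b c d => μ (some a) (some b) (some c) (some d)) k' k' :=
    Finset.sum_eq_single_of_mem k' (Finset.mem_univ _) fun x _ hx => by
      rw [fobiSum_eq_zero hμ N hx, mul_zero]
  rw [← h1]
  simp only [fobiSum, sum_weightLin, hμ.four_eq_zero h, hμ.three₁, mul_zero, Finset.sum_const_zero,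
    add_zero, Finset.sum_add_distrib, Finset.mul_sum]
  congr 1
  · simp only [Fintype.sum_prod_type, Finset.sum_neg_distrib]
    congr 1
    refine Finset.sum_congr rfl fun l _ => ?_
    unfold innerCol lastCol
    by_cases hN : N = 0 <;> simp [hN, ite_and]
  · exact Finset.sum_comm

/-- Mirror image of `fobiSum_first`, with the last factor perturbed. -/
lemma fobiSum_last (hμ : IsStdMoments μ g) (N : Fin 2) {k k' : Fin p} (h : k ≠ k')
    (s : Matrix (Fin p) (Fin p) ℝ) (r : Matrix (Fin q) (Fin q) ℝ) (m : Tensor p q) :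
    fobiSum N (fun a b c d => ∑ e, weightLin s r m d e * μ (some a) (some b) (some c) e) k k'
      = -∑ l, m none none none (some (k', l)) * g k l
        + s k' k * fobiSum N (fun a b c d => μ (some a) (some b) (some c) (some d)) k k := by
  have h1 : ∑ x, s k' x * fobiSum N (fun a b c d => μ (some a) (some b) (some c) (some d)) k x
      = s k' k * fobiSum N (fun a b c d => μ (some a) (some b) (some c) (some d)) k k :=
    Finset.sum_eq_single_of_mem k (Finset.mem_univ _) fun x _ hx => by
      rw [fobiSum_eq_zero hμ N hx.symm, mul_zero]
  rw [← h1]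
  simp only [fobiSum, sum_weightLin, hμ.four_eq_zero h, hμ.three₄, mul_zero, Finset.sum_const_zero,
    add_zero, Finset.sum_add_distrib, Finset.mul_sum]
  congr 1
  · simp only [Fintype.sum_prod_type, Finset.sum_neg_distrib]
    congr 1
    refine Finset.sum_congr rfl fun l _ => ?_
    unfold innerCol lastCol
    by_cases hN : N = 0 <;> simp [hN, ite_and]
  · exact Finset.sum_comm

/-- Centering contributes nothing, since the remaining factors include entries of the two different
rows `k` and `k'`. The left standardization produces two pairings, with factors `s k' k` and `s k
k'`; counting admissible column pairs gives q² + q for `N = 0` and q + q for `N = 1`. -/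
lemma fobiSum_second (hμ : IsStdMoments μ g) (N : Fin 2) {k k' : Fin p} (h : k ≠ k')
    {s : Matrix (Fin p) (Fin p) ℝ} (hs : s k' k = s k k') (r : Matrix (Fin q) (Fin q) ℝ)
    (m : Tensor p q) :
    fobiSum N (fun a b c d => ∑ e, weightLin s r m b e * μ (some a) e (some c) (some d)) k k'
      = s k k' * innerMult N q := by
  have h3 : ∀ t : Fin q × Fin p × Fin q, μ (some (k, t.1)) none (some (t.2.1, t.2.2))
      (some (k', lastCol N t.1 t.2.2)) = 0 := by
    intro t
    rw [hμ.three₂, if_neg]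
    rintro ⟨h1, h2⟩
    exact h (congrArg Prod.fst (h1.trans h2))
  simp only [fobiSum, sum_weightLin, hμ.four_eq_zero h, h3, mul_zero, Finset.sum_const_zero,
    add_zero, neg_zero, zero_add]
  simp only [Fintype.sum_prod_type, hμ.four_of_ne h, mul_add, Finset.sum_add_distrib, mul_ite,
    mul_zero, mul_one, Finset.sum_ite_eq, Finset.mem_univ, if_true]
  unfold innerCol lastCol innerMult
  have e : ∀ x y : Fin q, (x = y ∧ y = x) ↔ x = y := fun x y => ⟨fun h => h.1, fun h => ⟨h, h.symm⟩⟩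
  by_cases hN : N = 0
  · simp [hN, hs]
    ring
  · simp [hN, hs, e]
    ring

lemma fobiSum_third (hμ : IsStdMoments μ g) (N : Fin 2) {k k' : Fin p} (h : k ≠ k')
    {s : Matrix (Fin p) (Fin p) ℝ} (hs : s k' k = s k k') (r : Matrix (Fin q) (Fin q) ℝ)
    (m : Tensor p q) :
    fobiSum N (fun a b c d => ∑ e, weightLin s r m c e * μ (some a) (some b) e (some d)) k k'
      = s k k' * innerMult N q := by
  have h3 : ∀ t : Fin q × Fin p × Fin q, μ (some (k, t.1)) (some (t.2.1, innerCol N t.1 t.2.2))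
      none (some (k', lastCol N t.1 t.2.2)) = 0 := by
    intro t
    rw [hμ.three₃, if_neg]
    rintro ⟨h1, h2⟩
    exact h (congrArg Prod.fst (h1.trans h2))
  simp only [fobiSum, sum_weightLin, hμ.four_eq_zero h, h3, mul_zero, Finset.sum_const_zero,
    add_zero, neg_zero, zero_add]
  simp only [Fintype.sum_prod_type, hμ.four_of_ne h, mul_add, Finset.sum_add_distrib, mul_ite,
    mul_zero, mul_one, Finset.sum_ite_eq, Finset.mem_univ, if_true]
  unfold innerCol lastCol innerMult
  have e : ∀ x y : Fin q, (x = y ∧ y = x) ↔ x = y := fun x y => ⟨fun h => h.1, fun h => ⟨h, h.symm⟩⟩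
  by_cases hN : N = 0
  · simp [hN, hs]
    ring
  · simp [hN, hs, e]
    ring

/-- First-order expansion of the off-diagonal entries of the FOBI matrix. -/
theorem firstOrder_fobiMatrix (hρ : Tendsto ρ f (𝓝 0)) (hq : 0 < q)
    (hm : ∀ a b c d, (fun t => m t a b c d - μ a b c d) =O[f] ρ) (hμ : IsStdMoments μ g)
    (N : Fin 2) {b : Fin p → ℝ}
    (hb : ∀ k, fobiSum N (fun a b c d => μ (some a) (some b) (some c) (some d)) k k = q * b k)
    (hL : ∀ i j, FirstOrder f ρ (fun t => L t i j) ((1 : Matrix (Fin p) (Fin p) ℝ) i j)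
      fun t => s t i j)
    (hs : ∀ t i j, s t j i = s t i j)
    (hR : ∀ i j, FirstOrder f ρ (fun t => R t i j) ((1 : Matrix (Fin q) (Fin q) ℝ) i j)
      fun t => r t i j) {k k' : Fin p} (h : k ≠ k') :
    FirstOrder f ρ (fun t => fobiMatrix N (L t) (R t) (m t) k k') 0
      fun t => fobiLin N b g (s t) (m t) k k' := by
  have hq' : (q : ℝ) ≠ 0 := by positivity
  refine ((FirstOrder.fobiSum (N := N) (firstOrder_quartic hρ hm
    (firstOrder_weight hρ hm hμ hL hR)) k k').const_mul (q : ℝ)⁻¹).congr ?_ fun t => ?_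
  · rw [fobiSum_eq_zero hμ N h, mul_zero]
  · have e1 := fobiSum_first hμ N h (s t) (r t) (m t)
    have e2 := fobiSum_second hμ N h (hs t k k') (r t) (m t)
    have e3 := fobiSum_third hμ N h (hs t k k') (r t) (m t)
    have e4 := fobiSum_last hμ N h (s t) (r t) (m t)
    have e0 := fobiSum_eq_zero hμ N h
    rw [hb] at e1 e4
    simp only [fobiSum] at e0 e1 e2 e3 e4
    simp only [fobiSum, fobiLin, Finset.sum_add_distrib, Finset.sum_sub_distrib, e0, e1, e2, e3, e4,
      hs t k k']
    field_simp
    ring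

/-- The diagonal of the FOBI matrix. -/
theorem tendsto_fobiMatrix (hρ : Tendsto ρ f (𝓝 0)) (hq : 0 < q)
    (hm : ∀ a b c d, (fun t => m t a b c d - μ a b c d) =O[f] ρ) (hμ : IsStdMoments μ g)
    (N : Fin 2) {b : Fin p → ℝ}
    (hb : ∀ k, fobiSum N (fun a b c d => μ (some a) (some b) (some c) (some d)) k k = q * b k)
    (hL : ∀ i j, FirstOrder f ρ (fun t => L t i j) ((1 : Matrix (Fin p) (Fin p) ℝ) i j)
      fun t => s t i j)
    (hR : ∀ i j, FirstOrder f ρ (fun t => R t i j) ((1 : Matrix (Fin q) (Fin q) ℝ) i j)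
      fun t => r t i j) :
    Tendsto (fun t => fobiMatrix N (L t) (R t) (m t)) f (𝓝 (Matrix.diagonal b)) := by
  have hq' : (q : ℝ) ≠ 0 := by positivity
  refine tendsto_matrix_iff.2 fun k k' => ?_
  have h1 := ((FirstOrder.fobiSum (N := N) (firstOrder_quartic hρ hm
    (firstOrder_weight hρ hm hμ hL hR)) k k').const_mul (q : ℝ)⁻¹).tendsto hρ
  have h0 : Matrix.diagonal b k k' = (q : ℝ)⁻¹ *
      fobiSum N (fun a b c d => μ (some a) (some b) (some c) (some d)) k k' := by
    by_cases h : k = k'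
    · subst h
      rw [hb, Matrix.diagonal_apply_eq, inv_mul_cancel_left₀ hq']
    · rw [fobiSum_eq_zero hμ N h, mul_zero, Matrix.diagonal_apply_ne _ h]
  rw [h0]
  exact h1

/-- The linearization of the left covariance matrix, multiplied by `-1/2`. -/
noncomputable def covLin (m : Tensor p q) : Matrix (Fin p) (Fin p) ℝ :=
  fun k k' => -(1 / 2) * ((q : ℝ)⁻¹ * ∑ l, (m none none (some (k, l)) (some (k', l)) -
    (1 : Matrix (Fin p) (Fin p) ℝ) k k'))

/-- The linearization of the left MFOBI estimate. -/
noncomputable def estimateLin (N : Fin 2) (b : Fin p → ℝ) (g : Fin p → Fin q → ℝ) (m : Tensor p q)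
    (k k' : Fin p) : ℝ :=
  if k = k' then covLin m k k else fobiLin N b g (covLin m) m k k' / (b k - b k') + covLin m k k'

lemma firstOrder_left (hρ : Tendsto ρ f (𝓝 0)) (hq : 0 < q)
    (hm : ∀ a b c d, (fun t => m t a b c d - μ a b c d) =O[f] ρ) (hμ : IsStdMoments μ g)
    {centered : Bool} (hL : ∀ t, IsSymmInvSqrt (leftCov centered (m t)) (L t)) (i j : Fin p) :
    FirstOrder f ρ (fun t => L t i j) ((1 : Matrix (Fin p) (Fin p) ℝ) i j)
      fun t => covLin (m t) i j :=
  (FirstOrder.invSqrt hρ (s := fun t k k' => (q : ℝ)⁻¹ * ∑ l, (m t none none (some (k, l))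
    (some (k', l)) - (1 : Matrix (Fin p) (Fin p) ℝ) k k'))
    (firstOrder_leftCov hρ hq hm hμ centered) (Eventually.of_forall hL) i j).congr rfl fun _ => rfl

/-- The first-order expansion of a left MFOBI estimate near the identity. -/
theorem isLittleO_estimate (hρ : Tendsto ρ f (𝓝 0)) (hp : 0 < p) (hq : 0 < q)
    (hm : ∀ a b c d, (fun t => m t a b c d - μ a b c d) =O[f] ρ)
    (hsym : ∀ t a b, m t none none a b = m t none none b a) (hμ : IsStdMoments μ g)
    (N : Fin 2) (centered : Bool) {b : Fin p → ℝ} (hinj : Function.Injective b)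
    (hb : ∀ k, fobiSum N (fun a b c d => μ (some a) (some b) (some c) (some d)) k k = q * b k)
    (hL : ∀ t, IsSymmInvSqrt (leftCov centered (m t)) (L t))
    (hR : ∀ t, IsSymmInvSqrt (rightCov centered (m t)) (R t))
    {W : ι → Matrix (Fin p) (Fin p) ℝ} (hW : ∀ t, W t ∈ Matrix.orthogonalGroup (Fin p) ℝ)
    (hdiag : ∀ t, ((W t)ᵀ * fobiMatrix N (L t) (R t) (m t) * W t).IsDiag)
    (hlim : Tendsto (fun t => (W t)ᵀ * L t) f (𝓝 1)) (k k' : Fin p) :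
    (fun t => ((W t)ᵀ * L t - 1) k k' - estimateLin N b g (m t) k k') =o[f] ρ := by
  have hL1 := firstOrder_left hρ hq hm hμ hL
  have hR1 := FirstOrder.invSqrt hρ (s := fun t l l' => (p : ℝ)⁻¹ * ∑ k, (m t none none
    (some (k, l)) (some (k, l')) - (1 : Matrix (Fin q) (Fin q) ℝ) l l'))
    (firstOrder_rightCov hρ hp hm hμ centered) (Eventually.of_forall hR)
  have hLlim : Tendsto L f (𝓝 1) := tendsto_matrix_iff.2 fun i j => (hL1 i j).tendsto hρ
  have hS : Tendsto (fun t => L t * leftCov centered (m t)) f (𝓝 1) := by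
    have hc : Continuous fun x : Matrix (Fin p) (Fin p) ℝ × Matrix (Fin p) (Fin p) ℝ =>
        x.1 * x.2 := by fun_prop
    have h2 : Tendsto (fun t => leftCov centered (m t)) f (𝓝 1) := tendsto_matrix_iff.2
      fun i j => (firstOrder_leftCov hρ hq hm hμ centered i j).tendsto hρ
    have := (hc.tendsto (1, 1)).comp (hLlim.prodMk_nhds h2)
    simpa [Function.comp_def] using this
  -- Since `L * L * S = 1`, the rotation is recovered from the estimate as Wᵀ = (Wᵀ L)(L S), and
  -- both factors tend to the identity.
  have hU : Tendsto (fun t => (W t)ᵀ) f (𝓝 1) := by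
    have hc : Continuous fun x : Matrix (Fin p) (Fin p) ℝ × Matrix (Fin p) (Fin p) ℝ =>
        x.1 * x.2 := by fun_prop
    have := (hc.tendsto (1, 1)).comp (hlim.prodMk_nhds hS)
    simp only [Function.comp_def, Matrix.mul_one] at this
    refine this.congr fun t => ?_
    have h1 := (hL t).sq_mul
    rw [Matrix.mul_assoc, ← Matrix.mul_assoc (L t), h1, Matrix.mul_one]
  have hUo : ∀ t, (W t)ᵀ ∈ Matrix.orthogonalGroup (Fin p) ℝ := fun t => by
    rw [Matrix.mem_orthogonalGroup_iff, Matrix.transpose_transpose]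
    exact (Matrix.mem_orthogonalGroup_iff' _ _).1 (hW t)
  have hE := isLittleO_eigenvectors hρ (B := fun t => fobiMatrix N (L t) (R t) (m t))
    (U := fun t => (W t)ᵀ) (l := fun t => fobiLin N b g (covLin (m t)) (m t)) hinj
    (tendsto_fobiMatrix hρ hq hm hμ N hb hL1 hR1)
    (fun k k' h => firstOrder_fobiMatrix hρ hq hm hμ N hb hL1
      (fun t i j => by simp only [covLin, hsym t (some (j, _)), Matrix.one_apply, eq_comm]) hR1 h)
    hU (Eventually.of_forall hUo)
    (Eventually.of_forall fun t => by simpa using hdiag t)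
  have hM := isLittleO_mul_sub_one hU
    (fun i j => ((hL1 i j).sub_isBigO hρ).congr_left fun t => rfl) k k'
  have hLo : (fun t => (L t - 1) k k' - covLin (m t) k k') =o[f] ρ :=
    (hL1 k k').rem.trans_isLittleO (isLittleO_sq_self hρ)
  by_cases h : k = k'
  · subst h
    refine ((hM.add (hE.2 k)).add hLo).congr_left fun t => ?_
    simp only [estimateLin, if_true, Matrix.sub_apply, Matrix.one_apply_eq]
    ring
  · refine ((hM.add (hE.1 k k' h)).add hLo).congr_left fun t => ?_
    simp only [estimateLin, h, if_false, Matrix.sub_apply, Matrix.one_apply_ne h]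
    ring

/-- The estimate with the eigenvectors closest to the identity is consistent. -/
theorem tendsto_closest_estimate (hρ : Tendsto ρ f (𝓝 0)) (hp : 0 < p) (hq : 0 < q)
    (hm : ∀ a b c d, (fun t => m t a b c d - μ a b c d) =O[f] ρ) (hμ : IsStdMoments μ g)
    (N : Fin 2) (centered : Bool) {b : Fin p → ℝ} (hinj : Function.Injective b)
    (hb : ∀ k, fobiSum N (fun a b c d => μ (some a) (some b) (some c) (some d)) k k = q * b k)
    (hL : ∀ t, IsSymmInvSqrt (leftCov centered (m t)) (L t))
    (hR : ∀ t, IsSymmInvSqrt (rightCov centered (m t)) (R t)) :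
    Tendsto (fun t => (diagonalizer (fobiMatrix N (L t) (R t) (m t)))ᵀ * L t) f (𝓝 1) := by
  have hL1 := firstOrder_left hρ hq hm hμ hL
  have hR1 := FirstOrder.invSqrt hρ (s := fun t l l' => (p : ℝ)⁻¹ * ∑ k, (m t none none
    (some (k, l)) (some (k, l')) - (1 : Matrix (Fin q) (Fin q) ℝ) l l'))
    (firstOrder_rightCov hρ hp hm hμ centered) (Eventually.of_forall hR)
  have hLlim : Tendsto L f (𝓝 1) := tendsto_matrix_iff.2 fun i j => (hL1 i j).tendsto hρ
  have hd := (tendsto_sqDistOne_diagonalizer hinj).comp (tendsto_fobiMatrix hρ hq hm hμ N hb hL1 hR1)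
  have hW : Tendsto (fun t => diagonalizer (fobiMatrix N (L t) (R t) (m t))) f (𝓝 1) := by
    refine tendsto_matrix_iff.2 fun i j => ?_
    rw [← tendsto_sub_nhds_zero_iff]
    have h1 := squeeze_zero (fun t => sq_nonneg _) (fun t => sq_sub_le_sqDistOne
      (diagonalizer (fobiMatrix N (L t) (R t) (m t))) i j) hd
    have h2 := h1.sqrt
    simp only [Real.sqrt_sq_eq_abs, Real.sqrt_zero] at h2
    exact (tendsto_zero_iff_abs_tendsto_zero _).2 h2
  have hc : Continuous fun x : Matrix (Fin p) (Fin p) ℝ × Matrix (Fin p) (Fin p) ℝ =>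
      x.1ᵀ * x.2 := by fun_prop
  have := (hc.tendsto (1, 1)).comp (hW.prodMk_nhds hLlim)
  simpa [Function.comp_def] using this

end Expansion

/-! ### Products of centered powers of independent variables -/

section IndependentFamily

variable {Ω J : Type*} [MeasurableSpace Ω] [Fintype J] {P : Measure Ω} {X : J → Ω → ℝ}

/-- The joint law is the product of the marginals, and products of integrable functions of separate
coordinates are integrable there. -/
lemma integrable_prod_comp (hX : iIndepFun X P) (mX : ∀ a, AEMeasurable (X a) P) {f : J → ℝ → ℝ}
    (hf : ∀ a, Measurable (f a)) (h : ∀ a, Integrable (fun ω => f a (X a ω)) P) :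
    Integrable (fun ω => ∏ a, f a (X a ω)) P := by
  have := hX.isProbabilityMeasure
  have hprob : ∀ a, IsProbabilityMeasure (P.map (X a)) := fun a =>
    Measure.isProbabilityMeasure_map (mX a)
  have h1 : Integrable (fun x : J → ℝ => ∏ a, f a (x a)) (Measure.pi fun a => P.map (X a)) :=
    Integrable.fintype_prod fun a =>
      (integrable_map_measure (hf a).aestronglyMeasurable (mX a)).2 (h a)
  rw [← hX.map_fun_eq_pi_map mX] at h1
  exact (integrable_map_measure h1.1 (aemeasurable_pi_lambda _ mX)).1 h1

lemma integral_prod_pow (hX : iIndepFun X P) (mX : ∀ a, AEMeasurable (X a) P) (n : J → ℕ) :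
    ∫ ω, ∏ a, X a ω ^ n a ∂P = ∏ a, ∫ ω, X a ω ^ n a ∂P :=
  hX.integral_fun_prod_comp (f := fun a x => x ^ n a) mX
    fun a => (measurable_id.pow_const (n a)).aestronglyMeasurable

/-- Centered monomials of degree at most three. -/
def centeredPow (g : ℝ) : ℕ → ℝ → ℝ
  | 0 => fun _ => 1
  | 1 => fun x => x
  | 2 => fun x => x ^ 2 - 1
  | 3 => fun x => x ^ 3 - g
  -- The value zero keeps the mean zero in every nonzero degree.
  | _ => fun _ => 0

lemma measurable_centeredPow (g : ℝ) (n : ℕ) : Measurable (centeredPow g n) := by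
  unfold centeredPow
  split <;> fun_prop

/-- Standardized independent random variables with finite eighth moments. -/
structure IsStdIndep (X : J → Ω → ℝ) (P : Measure Ω) : Prop where
  indep : iIndepFun X P
  memLp : ∀ a, MemLp (X a) 8 P
  mean : ∀ a, ∫ ω, X a ω ∂P = 0
  second : ∀ a, ∫ ω, X a ω ^ 2 ∂P = 1

namespace IsStdIndep

set_option linter.unusedSectionVars false in
lemma aemeasurable (h : IsStdIndep X P) (a : J) : AEMeasurable (X a) P :=
  (h.memLp a).1.aemeasurable

/-- Two applications of Hölder take L⁸ to L⁴ to L² for the fourth power; lower powers are dominated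
by 1 + x⁴. -/
lemma memLp_pow (h : IsStdIndep X P) (a : J) {n : ℕ} (hn : n ≤ 4) :
    MemLp (fun ω => X a ω ^ n) 2 P := by
  have := h.indep.isProbabilityMeasure
  have h4 : MemLp (fun ω => X a ω ^ 4) 2 P := by
    have h1 : MemLp (fun ω => X a ω * X a ω) 4 P :=
      (h.memLp a).mul' (h.memLp a) (hpqr := ⟨by
        rw [← two_mul]
        have : (8 : ENNReal) = 2 * 4 := by norm_num
        rw [this, ENNReal.mul_inv (by norm_num) (by norm_num), ← mul_assoc,
          ENNReal.mul_inv_cancel (by norm_num) (by norm_num), one_mul]⟩)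
    have h2 : MemLp (fun ω => (X a ω * X a ω) * (X a ω * X a ω)) 2 P :=
      h1.mul' h1 (hpqr := ⟨by
        rw [← two_mul]
        have : (4 : ENNReal) = 2 * 2 := by norm_num
        rw [this, ENNReal.mul_inv (by norm_num) (by norm_num), ← mul_assoc,
          ENNReal.mul_inv_cancel (by norm_num) (by norm_num), one_mul]⟩)
    refine h2.ae_eq (ae_of_all _ fun ω => ?_)
    ring
  refine ((memLp_const (1 : ℝ)).add h4).mono ((h.aemeasurable a).pow_const n).aestronglyMeasurable
    (ae_of_all _ fun ω => ?_)
  simp only [Pi.add_apply, norm_pow, Real.norm_eq_abs]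
  have h0 := abs_nonneg (X a ω)
  rw [abs_of_nonneg (by positivity : (0 : ℝ) ≤ 1 + X a ω ^ 4),
    ← (Even.pow_abs (by decide : Even 4) (X a ω))]
  rcases le_total (|X a ω|) 1 with h1 | h1
  · have := pow_le_one₀ (n := n) h0 h1
    have h3 : 0 ≤ |X a ω| ^ 4 := by positivity
    linarith
  · have := pow_le_pow_right₀ h1 hn
    linarith

lemma memLp_centeredPow (h : IsStdIndep X P) (g : ℝ) (a : J) (n : ℕ) :
    MemLp (fun ω => centeredPow g n (X a ω)) 2 P := by
  have := h.indep.isProbabilityMeasure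
  unfold centeredPow
  split
  · exact memLp_const _
  · simpa using h.memLp_pow a (n := 1) (by norm_num)
  · exact (h.memLp_pow a (n := 2) (by norm_num)).sub (memLp_const _)
  · exact (h.memLp_pow a (n := 3) (by norm_num)).sub (memLp_const _)
  · exact memLp_const _

lemma integral_centeredPow (h : IsStdIndep X P) (a : J) {n : ℕ} (hn : n ≠ 0) :
    ∫ ω, centeredPow (∫ ω, X a ω ^ 3 ∂P) n (X a ω) ∂P = 0 := by
  have := h.indep.isProbabilityMeasure
  unfold centeredPow
  split
  · exact absurd rfl hn
  · exact h.mean a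
  · rw [integral_sub ((h.memLp_pow a (by norm_num)).integrable one_le_two) (integrable_const _),
      h.second]
    simp
  · rw [integral_sub ((h.memLp_pow a (by norm_num)).integrable one_le_two) (integrable_const _)]
    simp
  · simp

end IsStdIndep

variable [DecidableEq J]

/-- The product of the centered powers of the variables in a list. -/
def centeredProd (g : J → ℝ) (l : List J) (x : J → ℝ) : ℝ :=
  ∏ a, centeredPow (g a) (l.count a) (x a)

lemma centeredProd_eq (g : J → ℝ) (l : List J) (x : J → ℝ) :
    centeredProd g l x = ∏ a ∈ l.toFinset, centeredPow (g a) (l.count a) (x a) := by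
  refine (Finset.prod_subset (Finset.subset_univ _) fun a _ ha => ?_).symm
  rw [List.count_eq_zero.2 fun h => ha (List.mem_toFinset.2 h)]
  rfl

lemma centeredProd_perm (g : J → ℝ) {l l' : List J} (h : l.Perm l') (x : J → ℝ) :
    centeredProd g l x = centeredProd g l' x := by
  simp only [centeredProd, h.count_eq]

lemma centeredProd_pair (g : J → ℝ) {a b : J} (hab : a ≠ b) (x : J → ℝ) :
    centeredProd g [a, b] x = x a * x b := by
  rw [centeredProd_eq]
  simp [hab, hab.symm, List.count_cons, centeredPow]

lemma centeredProd_cube (g : J → ℝ) {a b : J} (hab : a ≠ b) (x : J → ℝ) :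
    centeredProd g [a, a, a, b] x = (x a ^ 3 - g a) * x b := by
  rw [centeredProd_eq]
  simp [hab, hab.symm, List.count_cons, centeredPow]

lemma centeredProd_sq (g : J → ℝ) {a b c : J} (hab : a ≠ b) (hac : a ≠ c) (hbc : b ≠ c)
    (x : J → ℝ) : centeredProd g [a, a, b, c] x = (x a ^ 2 - 1) * (x b * x c) := by
  rw [centeredProd_eq]
  simp [hab, hab.symm, hac, hac.symm, hbc, hbc.symm, List.count_cons, centeredPow]

lemma centeredProd_four (g : J → ℝ) {a b c d : J} (hab : a ≠ b) (hac : a ≠ c) (had : a ≠ d)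
    (hbc : b ≠ c) (hbd : b ≠ d) (hcd : c ≠ d) (x : J → ℝ) :
    centeredProd g [a, b, c, d] x = x a * (x b * (x c * x d)) := by
  rw [centeredProd_eq]
  simp [hab, hab.symm, hac, hac.symm, hbc, hbc.symm, had, had.symm, hbd, hbd.symm, hcd, hcd.symm,
    List.count_cons, centeredPow]

namespace IsStdIndep

lemma memLp_centeredProd (h : IsStdIndep X P) (g : J → ℝ) (l : List J) :
    MemLp (fun ω => centeredProd g l fun a => X a ω) 2 P := by
  have hm : AEStronglyMeasurable (fun ω => centeredProd g l fun a => X a ω) P := by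
    refine (Finset.aemeasurable_fun_prod _ fun a _ => ?_).aestronglyMeasurable
    exact (measurable_centeredPow (g a) _).comp_aemeasurable (h.aemeasurable a)
  rw [memLp_two_iff_integrable_sq hm]
  simp only [centeredProd, ← Finset.prod_pow]
  exact integrable_prod_comp h.indep h.aemeasurable
    (f := fun a x => centeredPow (g a) (l.count a) x ^ 2)
    (fun a => (measurable_centeredPow (g a) _).pow_const 2)
    fun a => (h.memLp_centeredPow (g a) a _).integrable_sq

lemma integral_centeredProd_mul (h : IsStdIndep X P) (g : J → ℝ) (l l' : List J) :
    ∫ ω, centeredProd g l (fun a => X a ω) * centeredProd g l' (fun a => X a ω) ∂P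
      = ∏ a, ∫ ω, centeredPow (g a) (l.count a) (X a ω) * centeredPow (g a) (l'.count a) (X a ω)
        ∂P := by
  simp only [centeredProd, ← Finset.prod_mul_distrib]
  exact h.indep.integral_fun_prod_comp
    (f := fun a x => centeredPow (g a) (l.count a) x * centeredPow (g a) (l'.count a) x)
    h.aemeasurable fun a => ((measurable_centeredPow (g a) _).mul
      (measurable_centeredPow (g a) _)).aestronglyMeasurable

/-- The expectation factorizes, and a variable occurring in only one of the lists contributes the
mean of a centered power. -/
lemma integral_centeredProd_mul_eq_zero (h : IsStdIndep X P) {l l' : List J} {a : J}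
    (ha : ¬(a ∈ l ↔ a ∈ l')) :
    ∫ ω, centeredProd (fun a => ∫ ω, X a ω ^ 3 ∂P) l (fun a => X a ω) *
      centeredProd (fun a => ∫ ω, X a ω ^ 3 ∂P) l' (fun a => X a ω) ∂P = 0 := by
  rw [h.integral_centeredProd_mul]
  refine Finset.prod_eq_zero (Finset.mem_univ a) ?_
  by_cases h1 : a ∈ l
  · have h2 : a ∉ l' := fun h2 => ha ⟨fun _ => h2, fun _ => h1⟩
    rw [List.count_eq_zero.2 h2]
    simpa [centeredPow] using h.integral_centeredPow a (List.count_pos_iff.2 h1).ne'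
  · have h2 : a ∈ l' := by by_contra h2; exact ha ⟨fun h => absurd h h1, fun h => absurd h h2⟩
    rw [List.count_eq_zero.2 h1]
    simpa [centeredPow] using h.integral_centeredPow a (List.count_pos_iff.2 h2).ne'

end IsStdIndep

end IndependentFamily

/-! ### Population moments and limiting eigenvalues -/

section PopulationMoments

variable {Ω : Type*} [MeasurableSpace Ω] {P : Measure Ω} {p q : ℕ}
  {Y : Ω → Matrix (Fin p) (Fin q) ℝ}

/-- The population moments of a random matrix up to the fourth order. -/
noncomputable def momentTensor (P : Measure Ω) (Y : Ω → Matrix (Fin p) (Fin q) ℝ) : Tensor p q :=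
  fun a b c d => ∫ ω, monomials (Y ω) a b c d ∂P

/-- The third moments of the components of a random matrix. -/
noncomputable def skew (P : Measure Ω) (Y : Ω → Matrix (Fin p) (Fin q) ℝ) (k : Fin p) (l : Fin q) :
    ℝ :=
  ∫ ω, Y ω k l ^ 3 ∂P

/-- The multiplicity of a component in an index. -/
def mult (e : Idx p q) (a : Fin p × Fin q) : ℕ := if e = some a then 1 else 0

lemma aug_eq_prod (x : Matrix (Fin p) (Fin q) ℝ) (e : Idx p q) :
    aug x e = ∏ a : Fin p × Fin q, x a.1 a.2 ^ mult e a := by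
  cases e with
  | none => simp [aug, mult]
  | some b => simp [aug, mult, pow_ite, Finset.prod_ite_eq]

/-- The components of the random matrix are standardized and independent. -/
abbrev IsStdMatrix (Y : Ω → Matrix (Fin p) (Fin q) ℝ) (P : Measure Ω) : Prop :=
  IsStdIndep (fun (a : Fin p × Fin q) ω => Y ω a.1 a.2) P

lemma momentTensor_eq_prod (h : IsStdMatrix Y P) (e₁ e₂ e₃ e₄ : Idx p q) :
    momentTensor P Y e₁ e₂ e₃ e₄ = ∏ a : Fin p × Fin q,
      ∫ ω, Y ω a.1 a.2 ^ (mult e₁ a + mult e₂ a + mult e₃ a + mult e₄ a) ∂P := by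
  rw [← integral_prod_pow h.indep h.aemeasurable]
  simp only [momentTensor, monomials, aug_eq_prod, ← Finset.prod_mul_distrib, ← pow_add]

/-- A variable occurring exactly once contributes its mean as a factor. -/
lemma momentTensor_eq_zero (h : IsStdMatrix Y P) {e₁ e₂ e₃ e₄ : Idx p q} (a : Fin p × Fin q)
    (ha : mult e₁ a + mult e₂ a + mult e₃ a + mult e₄ a = 1) :
    momentTensor P Y e₁ e₂ e₃ e₄ = 0 := by
  rw [momentTensor_eq_prod h]
  refine Finset.prod_eq_zero (Finset.mem_univ a) ?_
  rw [ha]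
  simpa using h.mean a

lemma momentTensor_eq_one (h : IsStdMatrix Y P) {e₁ e₂ e₃ e₄ : Idx p q}
    (ha : ∀ a, mult e₁ a + mult e₂ a + mult e₃ a + mult e₄ a = 0 ∨
      mult e₁ a + mult e₂ a + mult e₃ a + mult e₄ a = 2) :
    momentTensor P Y e₁ e₂ e₃ e₄ = 1 := by
  have := h.indep.isProbabilityMeasure
  rw [momentTensor_eq_prod h]
  refine Finset.prod_eq_one fun a _ => ?_
  rcases ha a with h0 | h0 <;> rw [h0]
  · simp
  · exact h.second a

lemma momentTensor_eq_single (h : IsStdMatrix Y P) {e₁ e₂ e₃ e₄ : Idx p q} (a : Fin p × Fin q)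
    (ha : ∀ b ≠ a, mult e₁ b + mult e₂ b + mult e₃ b + mult e₄ b = 0) :
    momentTensor P Y e₁ e₂ e₃ e₄
      = ∫ ω, Y ω a.1 a.2 ^ (mult e₁ a + mult e₂ a + mult e₃ a + mult e₄ a) ∂P := by
  have := h.indep.isProbabilityMeasure
  rw [momentTensor_eq_prod h]
  refine Finset.prod_eq_single_of_mem a (Finset.mem_univ a) fun b _ hb => ?_
  rw [ha b hb]
  simp

lemma momentTensor_three (h : IsStdMatrix Y P) (b c d : Fin p × Fin q) :
    momentTensor P Y none (some b) (some c) (some d)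
      = if b = c ∧ c = d then skew P Y d.1 d.2 else 0 := by
  by_cases hbc : b = c
  · by_cases hcd : c = d
    · subst hbc hcd
      rw [momentTensor_eq_single h b fun a ha => by simp [mult, ha.symm]]
      simp [mult, skew]
    · rw [momentTensor_eq_zero h d (by simp [mult, hbc, hcd])]
      simp [hcd]
  · rw [if_neg fun e => hbc e.1]
    by_cases hcd : c = d
    · exact momentTensor_eq_zero h b (by simp [mult, ← hcd, Ne.symm hbc])
    · by_cases hbd : b = d
      · exact momentTensor_eq_zero h c (by simp [mult, ← hbd, hbc])
      · exact momentTensor_eq_zero h b (by simp [mult, Ne.symm hbc, Ne.symm hbd])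

lemma isStdMoments_momentTensor (h : IsStdMatrix Y P) :
    IsStdMoments (momentTensor P Y) (skew P Y) where
  one a := momentTensor_eq_zero h a (by simp [mult])
  two a b := by
    by_cases hab : a = b
    · subst hab
      rw [if_pos rfl]
      exact momentTensor_eq_one h fun c => by by_cases hc : a = c <;> simp [mult, hc]
    · rw [if_neg hab]
      exact momentTensor_eq_zero h a (by simp [mult, Ne.symm hab])
  three₁ := momentTensor_three h
  three₂ b c d := by
    rw [← momentTensor_three h]
    simp only [momentTensor, monomials]
    exact integral_congr_ae (ae_of_all _ fun ω => by ring)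
  three₃ b c d := by
    rw [← momentTensor_three h]
    simp only [momentTensor, monomials]
    exact integral_congr_ae (ae_of_all _ fun ω => by ring)
  three₄ b c d := by
    rw [← momentTensor_three h]
    simp only [momentTensor, monomials]
    exact integral_congr_ae (ae_of_all _ fun ω => by ring)
  four a b c d had := by
    by_cases hab : a = b
    · subst hab
      by_cases hcd : c = d
      · subst hcd
        rw [momentTensor_eq_one h fun e => by
          by_cases h1 : a = e <;> by_cases h2 : c = e <;> simp [mult, h1, h2]
          exact had (h1.trans h2.symm)]
        simp [had]
      · rw [momentTensor_eq_zero h d (by simp [mult, hcd, had])]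
        simp [hcd, had]
    · by_cases hac : a = c
      · subst hac
        by_cases hbd : b = d
        · subst hbd
          rw [momentTensor_eq_one h fun e => by
            by_cases h1 : a = e <;> by_cases h2 : b = e <;> simp [mult, h1, h2]
            exact had (h1.trans h2.symm)]
          simp [had]
        · rw [momentTensor_eq_zero h d (by simp [mult, hbd, had])]
          simp [hbd, had]
      · rw [momentTensor_eq_zero h a (by simp [mult, Ne.symm hab, Ne.symm hac, Ne.symm had])]
        simp [hab, hac]

/-- The diagonal entries of the population FOBI matrix. -/
noncomputable def fobiEigenvalue (N : Fin 2) (P : Measure Ω) (Y : Ω → Matrix (Fin p) (Fin q) ℝ)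
    (k : Fin p) : ℝ :=
  rowAvg (kurt P Y) k + q - 1 + (p - 1) * (if N = 0 then 1 else q)

/-- For fixed `l`, the row `m = k` contributes 1 for each of the q columns `l'` plus the excess β_kl
- 1 at `l' = l`. Each other row contributes 1 for `N = 0`, where only `l' = l` survives, and q for
`N = 1`. -/
lemma fobiSum_momentTensor (h : IsStdMatrix Y P) (hq : 0 < q) (N : Fin 2) (k : Fin p) :
    fobiSum N (fun a b c d => momentTensor P Y (some a) (some b) (some c) (some d)) k k
      = q * fobiEigenvalue N P Y k := by
  have hq' : (q : ℝ) ≠ 0 := by positivity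
  have h1 : ∀ l l', momentTensor P Y (some (k, l)) (some (k, innerCol N l l')) (some (k, l'))
      (some (k, lastCol N l l')) = 1 + if l = l' then kurt P Y k l - 1 else 0 := by
    intro l l'
    by_cases hl : l = l'
    · subst hl
      rw [if_pos rfl, momentTensor_eq_single h (k, l) fun b hb => by
        simp [mult, innerCol, lastCol, hb.symm]]
      simp [mult, innerCol, lastCol, kurt]
    · rw [if_neg hl, momentTensor_eq_one h, add_zero]
      intro a
      by_cases hN : N = 0 <;> by_cases h1 : (k, l) = a <;> by_cases h2 : (k, l') = a <;>
        simp [mult, innerCol, lastCol, hN, h1, h2]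
      · exact hl (Prod.ext_iff.1 (h1.trans h2.symm)).2
      · exact hl (Prod.ext_iff.1 (h1.trans h2.symm)).2
  have h2 : ∀ l l' m, m ≠ k → momentTensor P Y (some (k, l)) (some (m, innerCol N l l'))
      (some (m, l')) (some (k, lastCol N l l')) = if N = 0 then if l = l' then 1 else 0 else 1 := by
    intro l l' m hm
    by_cases hN : N = 0
    · rw [if_pos hN]
      by_cases hl : l = l'
      · subst hl
        rw [if_pos rfl]
        refine momentTensor_eq_one h fun a => ?_
        by_cases h1 : (k, l) = a <;> by_cases h2 : (m, l) = a <;>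
          simp [mult, innerCol, lastCol, hN, h1, h2]
        exact hm (Prod.ext_iff.1 (h2.trans h1.symm)).1
      · rw [if_neg hl]
        exact momentTensor_eq_zero h (k, l) (by simp [mult, innerCol, lastCol, hN, hm, Ne.symm hl])
    · rw [if_neg hN]
      refine momentTensor_eq_one h fun a => ?_
      by_cases h1 : (k, l) = a <;> by_cases h2 : (m, l') = a <;>
        simp [mult, innerCol, lastCol, hN, h1, h2]
      exact hm (Prod.ext_iff.1 (h2.trans h1.symm)).1
  have h3 : ∀ l, ∑ m, ∑ l', momentTensor P Y (some (k, l)) (some (m, innerCol N l l'))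
      (some (m, l')) (some (k, lastCol N l l'))
      = q + (kurt P Y k l - 1) + (p - 1) * (if N = 0 then 1 else q) := by
    intro l
    have hp : ((p - 1 : ℕ) : ℝ) = p - 1 := by
      rw [Nat.cast_sub (Nat.one_le_of_lt k.pos), Nat.cast_one]
    rw [← Finset.add_sum_erase _ _ (Finset.mem_univ k)]
    congr 1
    · simp only [h1, Finset.sum_add_distrib]
      simp
    · rw [Finset.sum_congr rfl fun m hm => Finset.sum_congr rfl fun l' _ =>
        h2 l l' m (Finset.ne_of_mem_erase hm)]
      by_cases hN : N = 0 <;> simp [hN, Finset.card_erase_of_mem, hp]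
  simp only [fobiSum, Fintype.sum_prod_type, h3, fobiEigenvalue, rowAvg, Finset.sum_add_distrib,
    Finset.sum_sub_distrib, Finset.sum_const, Finset.card_univ, Fintype.card_fin, nsmul_eq_mul]
  field_simp
  ring

/-- The eigenvalues are the row averages of the kurtoses shifted by a constant not depending on `k`.
-/
lemma fobiEigenvalue_injective (h : Function.Injective (rowAvg (kurt P Y))) (N : Fin 2) :
    Function.Injective (fobiEigenvalue N P Y) := by
  intro k k' hk
  apply h
  simpa [fobiEigenvalue] using hk

lemma memLp_aug (h : IsStdMatrix Y P) (e : Idx p q) : MemLp (fun ω => aug (Y ω) e) 8 P := by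
  have := h.indep.isProbabilityMeasure
  cases e with
  | none => exact memLp_const _
  | some a => exact h.memLp a

lemma memLp_monomials (h : IsStdMatrix Y P) (a b c d : Idx p q) :
    MemLp (fun ω => monomials (Y ω) a b c d) 2 P := by
  have h4 : ∀ a b : Idx p q, MemLp (fun ω => aug (Y ω) a * aug (Y ω) b) 4 P := fun a b =>
    (memLp_aug h b).mul' (memLp_aug h a) (hpqr := ⟨by
      rw [← two_mul]
      have : (8 : ENNReal) = 2 * 4 := by norm_num
      rw [this, ENNReal.mul_inv (by norm_num) (by norm_num), ← mul_assoc,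
        ENNReal.mul_inv_cancel (by norm_num) (by norm_num), one_mul]⟩)
  have h2 : MemLp (fun ω => (aug (Y ω) a * aug (Y ω) b) * (aug (Y ω) c * aug (Y ω) d)) 2 P :=
    (h4 c d).mul' (h4 a b) (hpqr := ⟨by
      rw [← two_mul]
      have : (4 : ENNReal) = 2 * 2 := by norm_num
      rw [this, ENNReal.mul_inv (by norm_num) (by norm_num), ← mul_assoc,
        ENNReal.mul_inv_cancel (by norm_num) (by norm_num), one_mul]⟩)
  refine h2.ae_eq (ae_of_all _ fun ω => ?_)
  simp only [monomials]
  ring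

end PopulationMoments

/-- Pythagoras; it reduces the variances of the influence function to sums over orthogonal
components. -/
lemma integral_sum_sq {Ω T : Type*} [MeasurableSpace Ω] {P : Measure Ω} [Fintype T]
    {f : T → Ω → ℝ} (hf : ∀ t, MemLp (f t) 2 P)
    (h : ∀ t u, t ≠ u → ∫ ω, f t ω * f u ω ∂P = 0) :
    ∫ ω, (∑ t, f t ω) ^ 2 ∂P = ∑ t, ∫ ω, f t ω ^ 2 ∂P := by
  have hi : ∀ t u, Integrable (fun ω => f t ω * f u ω) P := fun t u =>
    (hf t).integrable_mul (hf u)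
  simp only [sq, Finset.sum_mul_sum]
  rw [integral_finsetSum _ fun t _ => integrable_finsetSum _ fun u _ => hi t u]
  refine Finset.sum_congr rfl fun t _ => ?_
  rw [integral_finsetSum _ fun u _ => hi t u]
  exact Finset.sum_eq_single_of_mem t (Finset.mem_univ t) fun u _ hu => h t u hu.symm

/-! ### Orthogonal decomposition by the set of variables involved -/

section Chaos

set_option linter.unusedSectionVars false

variable {Ω J : Type*} [MeasurableSpace Ω] [Fintype J] [DecidableEq J] {P : Measure Ω}
  {X : J → Ω → ℝ}

/-- The product of centered powers of independent variables, as a random variable. -/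
noncomputable def chaosProd (P : Measure Ω) (X : J → Ω → ℝ) (l : List J) (ω : Ω) : ℝ :=
  centeredProd (fun a => ∫ ω, X a ω ^ 3 ∂P) l fun a => X a ω

/-- The span of the products of centered powers of exactly the variables in `S`. -/
def chaos (P : Measure Ω) (X : J → Ω → ℝ) (S : Finset J) : Submodule ℝ (Ω → ℝ) :=
  Submodule.span ℝ {f | ∃ l : List J, l.toFinset = S ∧ f = chaosProd P X l}

lemma chaosProd_mem (l : List J) {S : Finset J} (hl : l.toFinset = S) :
    chaosProd P X l ∈ chaos P X S :=
  Submodule.subset_span ⟨l, hl, rfl⟩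

namespace IsStdIndep

lemma memLp_of_mem_chaos (h : IsStdIndep X P) {S : Finset J} {f : Ω → ℝ} (hf : f ∈ chaos P X S) :
    MemLp f 2 P := by
  induction hf using Submodule.span_induction with
  | mem f hf =>
    obtain ⟨l, -, rfl⟩ := hf
    exact h.memLp_centeredProd _ l
  | zero => exact MemLp.zero
  | add f g _ _ hf hg => exact hf.add hg
  | smul c f _ hf => exact hf.const_smul c

lemma integrable_mul_of_mem_chaos (h : IsStdIndep X P) {S T : Finset J} {f g : Ω → ℝ}
    (hf : f ∈ chaos P X S) (hg : g ∈ chaos P X T) : Integrable (fun ω => f ω * g ω) P :=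
  (h.memLp_of_mem_chaos hf).integrable_mul (h.memLp_of_mem_chaos hg)

/-- Different supports differ in some variable, which makes generators orthogonal by
`integral_centeredProd_mul_eq_zero`; bilinearity does the rest. -/
lemma integral_mul_of_mem_chaos (h : IsStdIndep X P) {S T : Finset J} (hST : S ≠ T) {f g : Ω → ℝ}
    (hf : f ∈ chaos P X S) (hg : g ∈ chaos P X T) : ∫ ω, f ω * g ω ∂P = 0 := by
  induction hf using Submodule.span_induction with
  | mem f hf =>
    obtain ⟨l, hl, rfl⟩ := hf
    have hf := chaosProd_mem (P := P) (X := X) l hl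
    induction hg using Submodule.span_induction with
    | mem g hg =>
      obtain ⟨l', hl', rfl⟩ := hg
      obtain ⟨a, ha⟩ : ∃ a, ¬(a ∈ l ↔ a ∈ l') := by
        by_contra! hne
        refine hST ?_
        rw [← hl, ← hl']
        ext a
        simpa using hne a
      exact h.integral_centeredProd_mul_eq_zero ha
    | zero => simp
    | add g₁ g₂ h1 h2 hg₁ hg₂ =>
      simp only [Pi.add_apply, mul_add]
      rw [integral_add (h.integrable_mul_of_mem_chaos hf h1)
        (h.integrable_mul_of_mem_chaos hf h2), hg₁, hg₂, add_zero]
    | smul c g _ hg =>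
      simp only [Pi.smul_apply, smul_eq_mul, mul_left_comm _ c]
      rw [integral_const_mul, hg, mul_zero]
  | zero => simp
  | add f₁ f₂ h1 h2 hf₁ hf₂ =>
    simp only [Pi.add_apply, add_mul]
    rw [integral_add (h.integrable_mul_of_mem_chaos h1 hg)
      (h.integrable_mul_of_mem_chaos h2 hg), hf₁, hf₂, add_zero]
  | smul c f _ hf =>
    simp only [Pi.smul_apply, smul_eq_mul, mul_assoc]
    rw [integral_const_mul, hf, mul_zero]

/-- The empty product is the constant 1, so this is orthogonality to the chaos of the empty set. -/
lemma integral_of_mem_chaos (h : IsStdIndep X P) {S : Finset J} (hS : S ≠ ∅) {f : Ω → ℝ}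
    (hf : f ∈ chaos P X S) : ∫ ω, f ω ∂P = 0 := by
  have h1 := h.integral_mul_of_mem_chaos hS hf (chaosProd_mem (P := P) (X := X) [] (by simp))
  simpa [chaosProd, centeredProd, centeredPow] using h1

lemma integral_chaosProd_mul (h : IsStdIndep X P) {l l' : List J} {S : Finset J}
    (hl : l.toFinset ⊆ S) (hl' : l'.toFinset ⊆ S) :
    ∫ ω, chaosProd P X l ω * chaosProd P X l' ω ∂P = ∏ a ∈ S,
      ∫ ω, centeredPow (∫ ω, X a ω ^ 3 ∂P) (l.count a) (X a ω) *
        centeredPow (∫ ω, X a ω ^ 3 ∂P) (l'.count a) (X a ω) ∂P := by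
  have := h.indep.isProbabilityMeasure
  simp only [chaosProd]
  rw [h.integral_centeredProd_mul]
  refine (Finset.prod_subset (Finset.subset_univ S) fun a _ ha => ?_).symm
  rw [List.count_eq_zero.2 fun h => ha (hl (List.mem_toFinset.2 h)),
    List.count_eq_zero.2 fun h => ha (hl' (List.mem_toFinset.2 h))]
  simp [centeredPow]

lemma integral_centeredPow_one (h : IsStdIndep X P) (g : ℝ) (a : J) :
    ∫ ω, centeredPow g 1 (X a ω) * centeredPow g 1 (X a ω) ∂P = 1 := by
  simpa [centeredPow, ← sq] using h.second a

lemma integral_centeredPow_two (h : IsStdIndep X P) (g : ℝ) (a : J) :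
    ∫ ω, centeredPow g 2 (X a ω) * centeredPow g 2 (X a ω) ∂P = ∫ ω, X a ω ^ 4 ∂P - 1 := by
  have := h.indep.isProbabilityMeasure
  have i4 := (h.memLp_pow a (n := 4) le_rfl).integrable one_le_two
  have i2 := (h.memLp_pow a (n := 2) (by norm_num)).integrable one_le_two
  have e : ∀ ω, centeredPow g 2 (X a ω) * centeredPow g 2 (X a ω)
      = X a ω ^ 4 + -2 * X a ω ^ 2 + 1 := fun ω => by simp only [centeredPow]; ring
  simp only [e]
  rw [integral_add (i4.fun_add (i2.const_mul (-2))) (integrable_const _),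
    integral_add i4 (i2.const_mul (-2)), integral_const_mul, h.second]
  simp
  ring

lemma integral_centeredPow_three (h : IsStdIndep X P) (a : J) :
    ∫ ω, centeredPow (∫ ω, X a ω ^ 3 ∂P) 3 (X a ω) * centeredPow (∫ ω, X a ω ^ 3 ∂P) 3 (X a ω) ∂P
      = Var[fun ω => X a ω ^ 3; P] := by
  rw [variance_eq_integral ((h.aemeasurable a).pow_const 3)]
  simp only [centeredPow, sq]

lemma integral_centeredPow_three_one (h : IsStdIndep X P) (g : ℝ) (a : J) :
    ∫ ω, centeredPow g 3 (X a ω) * centeredPow g 1 (X a ω) ∂P = ∫ ω, X a ω ^ 4 ∂P := by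
  have := h.indep.isProbabilityMeasure
  have i4 := (h.memLp_pow a (n := 4) le_rfl).integrable one_le_two
  have i1 := (h.memLp_pow a (n := 1) (by norm_num)).integrable one_le_two
  simp only [pow_one] at i1
  have e : ∀ ω, centeredPow g 3 (X a ω) * centeredPow g 1 (X a ω)
      = X a ω ^ 4 - g * X a ω := fun ω => by simp only [centeredPow]; ring
  simp only [e]
  rw [integral_sub i4 (i1.const_mul g), integral_const_mul, h.mean, mul_zero, sub_zero]

lemma integral_sq_pair (h : IsStdIndep X P) {a b : J} (hab : a ≠ b) :
    ∫ ω, chaosProd P X [a, b] ω * chaosProd P X [a, b] ω ∂P = 1 := by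
  rw [h.integral_chaosProd_mul (S := {a, b}) (by simp) (by simp), Finset.prod_pair hab]
  simp [hab, hab.symm, h.integral_centeredPow_one]

lemma integral_sq_cube (h : IsStdIndep X P) {a b : J} (hab : a ≠ b) :
    ∫ ω, chaosProd P X [a, a, a, b] ω * chaosProd P X [a, a, a, b] ω ∂P
      = Var[fun ω => X a ω ^ 3; P] := by
  rw [h.integral_chaosProd_mul (S := {a, b}) (by simp) (by simp), Finset.prod_pair hab]
  simp [hab, hab.symm, h.integral_centeredPow_one, h.integral_centeredPow_three]

lemma integral_cube_pair (h : IsStdIndep X P) {a b : J} (hab : a ≠ b) :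
    ∫ ω, chaosProd P X [a, a, a, b] ω * chaosProd P X [a, b] ω ∂P = ∫ ω, X a ω ^ 4 ∂P := by
  rw [h.integral_chaosProd_mul (S := {a, b}) (by simp) (by simp), Finset.prod_pair hab]
  simp [hab, hab.symm, h.integral_centeredPow_one,
    h.integral_centeredPow_three_one]

lemma integral_cube_cube (h : IsStdIndep X P) {a b : J} (hab : a ≠ b) :
    ∫ ω, chaosProd P X [a, a, a, b] ω * chaosProd P X [b, b, b, a] ω ∂P
      = (∫ ω, X a ω ^ 4 ∂P) * ∫ ω, X b ω ^ 4 ∂P := by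
  rw [h.integral_chaosProd_mul (S := {a, b}) (by simp) (by simp [Finset.insert_subset_iff]),
    Finset.prod_pair hab]
  simp [hab, hab.symm, h.integral_centeredPow_three_one,
    fun g x => mul_comm (centeredPow g 1 x) (centeredPow g 3 x)]

lemma integral_sq_sq (h : IsStdIndep X P) {a b c : J} (hab : a ≠ b) (hac : a ≠ c) (hbc : b ≠ c) :
    ∫ ω, chaosProd P X [a, a, b, c] ω * chaosProd P X [a, a, b, c] ω ∂P
      = ∫ ω, X a ω ^ 4 ∂P - 1 := by
  rw [h.integral_chaosProd_mul (S := {a, b, c}) (by simp) (by simp),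
    Finset.prod_insert (by simp [hab, hac]), Finset.prod_pair hbc]
  simp [hab, hab.symm, hac, hac.symm, hbc, hbc.symm, h.integral_centeredPow_one,
    h.integral_centeredPow_two]

lemma integral_sq_four (h : IsStdIndep X P) {a b c d : J} (hab : a ≠ b) (hac : a ≠ c) (had : a ≠ d)
    (hbc : b ≠ c) (hbd : b ≠ d) (hcd : c ≠ d) :
    ∫ ω, chaosProd P X [a, b, c, d] ω * chaosProd P X [a, b, c, d] ω ∂P = 1 := by
  rw [h.integral_chaosProd_mul (S := {a, b, c, d}) (by simp) (by simp),
    Finset.prod_insert (by simp [hab, hac, had]), Finset.prod_insert (by simp [hbc, hbd]),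
    Finset.prod_pair hcd]
  simp [hab, hab.symm, hac, hac.symm, hbc, hbc.symm, had, had.symm, hbd, hbd.symm,
    hcd, hcd.symm, h.integral_centeredPow_one]

lemma integral_sq_double (h : IsStdIndep X P) (a : J) :
    ∫ ω, chaosProd P X [a, a] ω * chaosProd P X [a, a] ω ∂P = ∫ ω, X a ω ^ 4 ∂P - 1 := by
  rw [h.integral_chaosProd_mul (S := {a}) (by simp) (by simp), Finset.prod_singleton]
  simp [h.integral_centeredPow_two]

/-- The second moment of the component of the linearized estimate that involves exactly two
variables. -/
lemma integral_sq_cubes_sub (h : IsStdIndep X P) {a b : J} (hab : a ≠ b) (c : ℝ) :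
    ∫ ω, (chaosProd P X [a, a, a, b] ω + chaosProd P X [b, b, b, a] ω
        - c * chaosProd P X [a, b] ω) ^ 2 ∂P
      = Var[fun ω => X a ω ^ 3; P] + Var[fun ω => X b ω ^ 3; P] + c ^ 2
        + 2 * ((∫ ω, X a ω ^ 4 ∂P) * ∫ ω, X b ω ^ 4 ∂P)
        - 2 * c * (∫ ω, X a ω ^ 4 ∂P + ∫ ω, X b ω ^ 4 ∂P) := by
  have hi : ∀ l l' : List J, Integrable (fun ω => chaosProd P X l ω * chaosProd P X l' ω) P :=
    fun l l' => h.integrable_mul_of_mem_chaos (chaosProd_mem l rfl) (chaosProd_mem l' rfl)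
  have e : ∀ ω, (chaosProd P X [a, a, a, b] ω + chaosProd P X [b, b, b, a] ω
        - c * chaosProd P X [a, b] ω) ^ 2
      = chaosProd P X [a, a, a, b] ω * chaosProd P X [a, a, a, b] ω
        + chaosProd P X [b, b, b, a] ω * chaosProd P X [b, b, b, a] ω
        + c ^ 2 * (chaosProd P X [a, b] ω * chaosProd P X [a, b] ω)
        + 2 * (chaosProd P X [a, a, a, b] ω * chaosProd P X [b, b, b, a] ω)
        - 2 * c * (chaosProd P X [a, a, a, b] ω * chaosProd P X [a, b] ω
          + chaosProd P X [b, b, b, a] ω * chaosProd P X [b, a] ω) := by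
    intro ω
    have : chaosProd P X [b, a] ω = chaosProd P X [a, b] ω :=
      centeredProd_perm _ (List.Perm.swap a b []) _
    rw [this]
    ring
  simp only [e]
  have i1 := hi [a, a, a, b] [a, a, a, b]
  have i2 := hi [b, b, b, a] [b, b, b, a]
  have i3 := (hi [a, b] [a, b]).const_mul (c ^ 2)
  have i4 := (hi [a, a, a, b] [b, b, b, a]).const_mul 2
  have i5 := hi [a, a, a, b] [a, b]
  have i6 := hi [b, b, b, a] [b, a]
  rw [integral_sub (((i1.fun_add i2).fun_add i3).fun_add i4) ((i5.fun_add i6).const_mul _),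
    integral_add ((i1.fun_add i2).fun_add i3) i4, integral_add (i1.fun_add i2) i3, integral_add i1 i2,
    integral_const_mul, integral_const_mul, integral_const_mul, integral_add i5 i6,
    h.integral_sq_cube hab, h.integral_sq_cube hab.symm, h.integral_sq_pair hab,
    h.integral_cube_cube hab, h.integral_cube_pair hab, h.integral_cube_pair hab.symm, mul_one]

end IsStdIndep

end Chaos

/-! ### Sums over the index triples of the FOBI kernel -/

section Sums

variable {p q : ℕ}

lemma sum_rows {k k' : Fin p} (h : k ≠ k') (A B : Fin q → Fin q → ℝ)
    (C : Fin p → Fin q → Fin q → ℝ) :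
    ∑ t : Fin q × Fin p × Fin q, (if t.2.1 = k then A t.1 t.2.2 else
        if t.2.1 = k' then B t.1 t.2.2 else C t.2.1 t.1 t.2.2)
      = ∑ l, ∑ l', A l l' + ∑ l, ∑ l', B l l' +
        ∑ m ∈ Finset.univ \ {k, k'}, ∑ l, ∑ l', C m l l' := by
  have e : ∀ F : Fin p → ℝ, ∑ m, F m = F k + F k' + ∑ m ∈ Finset.univ \ {k, k'}, F m := by
    intro F
    rw [← Finset.sum_sdiff (Finset.subset_univ {k, k'}), Finset.sum_pair h]
    ring
  simp only [Fintype.sum_prod_type]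
  rw [Finset.sum_comm, e]
  congr 1
  · simp [h.symm]
  · refine Finset.sum_congr rfl fun m hm => ?_
    simp only [Finset.mem_sdiff, Finset.mem_insert, Finset.mem_singleton, not_or] at hm
    simp [hm.2.1, hm.2.2]

lemma sum_offdiag_left (U V : Fin q → ℝ) :
    ∑ l, ∑ l', (if l = l' then U l else V l) = ∑ l, U l + (q - 1) * ∑ l, V l := by
  have e : ∀ l l' : Fin q, (if l = l' then U l else V l) = V l + if l = l' then U l - V l else 0 := by
    intro l l'; split_ifs <;> ring
  simp only [e, Finset.sum_add_distrib, Finset.sum_ite_eq, Finset.mem_univ, if_true,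
    Finset.sum_const, Finset.card_univ, Fintype.card_fin, nsmul_eq_mul, Finset.sum_sub_distrib,
    ← Finset.mul_sum]
  ring

lemma sum_offdiag_right (U V : Fin q → ℝ) :
    ∑ l, ∑ l', (if l = l' then U l else V l') = ∑ l, U l + (q - 1) * ∑ l, V l := by
  rw [Finset.sum_comm, ← sum_offdiag_left]
  refine Finset.sum_congr rfl fun l _ => Finset.sum_congr rfl fun l' _ => ?_
  by_cases h : l = l'
  · subst h; simp
  · simp [h, Ne.symm h]

lemma card_sdiff_pair {k k' : Fin p} (h : k ≠ k') :
    ((Finset.univ \ {k, k'} : Finset (Fin p)).card : ℝ) = p - 2 := by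
  have h1 := Finset.card_sdiff_add_card_eq_card (Finset.subset_univ ({k, k'} : Finset (Fin p)))
  rw [Finset.card_pair h, Finset.card_univ, Fintype.card_fin] at h1
  have h2 : ((Finset.univ \ {k, k'} : Finset (Fin p)).card : ℝ) + 2 = p := by exact_mod_cast h1
  linarith

/-- With `y` and `z` the rows `k` and `k'`, this is what remains of the FOBI kernel once the
orthogonal components are removed. The terms y z³ from the middle rows `k` and `k'` cancel, leaving
the third-moment correction of `fobiLin` and a multiple of ∑ y z. -/
lemma sum_fobi_remainder (N : Fin 2) {k k' : Fin p} (h : k ≠ k') (y z g g' : Fin q → ℝ)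
    (c : ℝ) :
    ∑ t : Fin q × Fin p × Fin q, (if t.2.1 = k then
          if t.1 = t.2.2 then g t.1 * z t.1 - (z t.1 ^ 3 - g' t.1) * y t.1 + c * (y t.1 * z t.1)
          else if N = 0 then y t.2.2 * z t.2.2 else y t.1 * z t.1
        else if t.2.1 = k' then
          if t.1 = t.2.2 then y t.1 * z t.1 ^ 3 else y t.1 * z t.1
        else if N = 0 then if t.1 = t.2.2 then y t.1 * z t.1 else 0
        else y t.1 * z t.1)
      = ∑ l, (y l * g' l + z l * g l) +
        (∑ l, y l * z l) * (c + 2 * (q - 1) + (p - 2) * if N = 0 then 1 else q) := by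
  have e1 : ∑ l, (g l * z l - (z l ^ 3 - g' l) * y l + c * (y l * z l)) + ∑ l, y l * z l ^ 3
      = ∑ l, (y l * g' l + z l * g l) + c * ∑ l, y l * z l := by
    rw [Finset.mul_sum, ← Finset.sum_add_distrib, ← Finset.sum_add_distrib]
    exact Finset.sum_congr rfl fun l _ => by ring
  by_cases hN : N = 0
  · simp only [hN, if_true]
    rw [sum_rows h (fun l l' => if l = l' then
        g l * z l - (z l ^ 3 - g' l) * y l + c * (y l * z l) else y l' * z l')
      (fun l l' => if l = l' then y l * z l ^ 3 else y l * z l)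
      (fun _ l l' => if l = l' then y l * z l else 0),
      sum_offdiag_right _ fun l => y l * z l, sum_offdiag_left _ fun l => y l * z l]
    simp only [Finset.sum_ite_eq, Finset.mem_univ, if_true, Finset.sum_const, nsmul_eq_mul,
      card_sdiff_pair h]
    linear_combination e1
  · simp only [hN, if_false]
    rw [sum_rows h (fun l l' => if l = l' then
        g l * z l - (z l ^ 3 - g' l) * y l + c * (y l * z l) else y l * z l)
      (fun l l' => if l = l' then y l * z l ^ 3 else y l * z l)
      (fun _ l _ => y l * z l),
      sum_offdiag_left _ fun l => y l * z l, sum_offdiag_left _ fun l => y l * z l]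
    simp only [Finset.sum_const, nsmul_eq_mul, card_sdiff_pair h, Finset.card_univ,
      Fintype.card_fin, ← Finset.mul_sum]
    linear_combination e1

end Sums

/-! ### Orthogonal components of the off-diagonal entries -/

section OffDiagonal

variable {Ω : Type*} [MeasurableSpace Ω] {P : Measure Ω} {p q : ℕ}
  {Y : Ω → Matrix (Fin p) (Fin q) ℝ}

/-- Products of centered powers of the components of a random matrix. -/
noncomputable abbrev matrixProd (P : Measure Ω) (Y : Ω → Matrix (Fin p) (Fin q) ℝ)
    (l : List (Fin p × Fin q)) : Ω → ℝ :=
  chaosProd P (fun (a : Fin p × Fin q) ω => Y ω a.1 a.2) l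

/-- The orthogonal components of the off-diagonal entries of the linearized estimate. -/
noncomputable def offComponent (N : Fin 2) (P : Measure Ω) (Y : Ω → Matrix (Fin p) (Fin q) ℝ)
    (c : ℝ) (k k' : Fin p) (t : Fin q × Fin p × Fin q) (ω : Ω) : ℝ :=
  if t.2.1 = k then
    if t.1 = t.2.2 then matrixProd P Y [(k, t.1), (k, t.1), (k, t.1), (k', t.1)] ω
      + matrixProd P Y [(k', t.1), (k', t.1), (k', t.1), (k, t.1)] ω
      - c * matrixProd P Y [(k, t.1), (k', t.1)] ω
    else if N = 0 then matrixProd P Y [(k, t.1), (k, t.1), (k, t.2.2), (k', t.2.2)] ω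
    else matrixProd P Y [(k, t.2.2), (k, t.2.2), (k, t.1), (k', t.1)] ω
  else if t.2.1 = k' then
    if t.1 = t.2.2 then 0
    else matrixProd P Y [(k', t.2.2), (k', t.2.2), (k, t.1), (k', t.1)] ω
  else if N = 0 then
    if t.1 = t.2.2 then matrixProd P Y [(t.2.1, t.1), (t.2.1, t.1), (k, t.1), (k', t.1)] ω
    else matrixProd P Y [(k, t.1), (t.2.1, t.1), (t.2.1, t.2.2), (k', t.2.2)] ω
  else matrixProd P Y [(t.2.1, t.2.2), (t.2.1, t.2.2), (k, t.1), (k', t.1)] ω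

/-- The variables that enter a component of the linearized estimate. -/
def offSupport (N : Fin 2) (k k' : Fin p) (t : Fin q × Fin p × Fin q) :
    Finset (Fin p × Fin q) :=
  {(k, t.1), (t.2.1, innerCol N t.1 t.2.2), (t.2.1, t.2.2), (k', lastCol N t.1 t.2.2)}

lemma offComponent_mem_chaos (N : Fin 2) (c : ℝ) {k k' : Fin p} (h : k ≠ k')
    (t : Fin q × Fin p × Fin q) :
    offComponent N P Y c k k' t ∈
      chaos P (fun (a : Fin p × Fin q) ω => Y ω a.1 a.2) (offSupport N k k' t) := by
  obtain ⟨l, m, l'⟩ := t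
  by_cases h1 : m = k
  · by_cases h2 : l = l'
    · subst h1 h2
      have e : offComponent N P Y c m k' (l, m, l) = matrixProd P Y [(m, l), (m, l), (m, l), (k', l)]
          + matrixProd P Y [(k', l), (k', l), (k', l), (m, l)]
          - c • matrixProd P Y [(m, l), (k', l)] := by
        ext ω; simp [offComponent]
      rw [e]
      refine Submodule.sub_mem _ (Submodule.add_mem _ (chaosProd_mem _ ?_) (chaosProd_mem _ ?_))
        (Submodule.smul_mem _ _ (chaosProd_mem _ ?_)) <;>
      · ext a; simp [offSupport, innerCol, lastCol]; try tauto
    · subst h1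
      by_cases h3 : N = 0
      · subst h3
        have e : offComponent 0 P Y c m k' (l, m, l') =
            matrixProd P Y [(m, l), (m, l), (m, l'), (k', l')] := by
          ext ω; simp [offComponent, h2]
        rw [e]
        refine chaosProd_mem _ ?_
        ext a; simp [offSupport, innerCol, lastCol]
      · have e : offComponent N P Y c m k' (l, m, l') =
            matrixProd P Y [(m, l'), (m, l'), (m, l), (k', l)] := by
          ext ω; simp [offComponent, h2, h3]
        rw [e]
        refine chaosProd_mem _ ?_
        ext a; simp [offSupport, innerCol, lastCol, h3]; tauto
  · by_cases h4 : m = k'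
    · subst h4
      by_cases h2 : l = l'
      · have e : offComponent N P Y c k m (l, m, l') = 0 := by
          ext ω; simp [offComponent, h2, h1]
        rw [e]
        exact Submodule.zero_mem _
      · have e : offComponent N P Y c k m (l, m, l') =
            matrixProd P Y [(m, l'), (m, l'), (k, l), (m, l)] := by
          ext ω; simp [offComponent, h2, h1]
        rw [e]
        refine chaosProd_mem _ ?_
        by_cases h3 : N = 0 <;>
        · ext a; simp [offSupport, innerCol, lastCol, h3]; tauto
    · by_cases h3 : N = 0
      · subst h3
        by_cases h2 : l = l'
        · have e : offComponent 0 P Y c k k' (l, m, l') =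
              matrixProd P Y [(m, l), (m, l), (k, l), (k', l)] := by
            ext ω; simp [offComponent, h1, h2, h4]
          rw [e]
          refine chaosProd_mem _ ?_
          subst h2
          ext a; simp [offSupport, innerCol, lastCol]; tauto
        · have e : offComponent 0 P Y c k k' (l, m, l') =
              matrixProd P Y [(k, l), (m, l), (m, l'), (k', l')] := by
            ext ω; simp [offComponent, h1, h2, h4]
          rw [e]
          refine chaosProd_mem _ ?_
          ext a; simp [offSupport, innerCol, lastCol]
      · have e : offComponent N P Y c k k' (l, m, l') =
            matrixProd P Y [(m, l'), (m, l'), (k, l), (k', l)] := by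
          ext ω; simp [offComponent, h1, h3, h4]
        rw [e]
        refine chaosProd_mem _ ?_
        ext a; simp [offSupport, innerCol, lastCol, h3]; tauto

/-- The triple can be read off from the support, except that for `l = l'` the middle rows `k` and
`k'` give the same set {(k, l), (k', l)}. For that reason `offComponent` merges the two cubic terms
into the one with middle row `k` and is zero for the other. -/
lemma offSupport_eq (N : Fin 2) {k k' : Fin p} (h : k ≠ k') {t u : Fin q × Fin p × Fin q}
    (he : offSupport N k k' t = offSupport N k k' u) :
    t = u ∨ (t.2.1 = k' ∧ t.1 = t.2.2) ∨ (u.2.1 = k' ∧ u.1 = u.2.2) := by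
  obtain ⟨l, m, l'⟩ := t
  obtain ⟨l₂, m₂, l₂'⟩ := u
  have hm : ∀ a, a ∈ offSupport N k k' (l, m, l') ↔ a ∈ offSupport N k k' (l₂, m₂, l₂') := by
    rw [he]; simp
  by_cases h3 : N = 0
  · simp only [offSupport, innerCol, lastCol, h3, if_true, Finset.mem_insert,
      Finset.mem_singleton] at hm
    have a1 := hm (k, l)
    have a2 := hm (m, l)
    have a3 := hm (m, l')
    have a4 := hm (k', l')
    have b1 := hm (k, l₂)
    have b2 := hm (m₂, l₂)
    have b3 := hm (m₂, l₂')
    have b4 := hm (k', l₂')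
    clear hm he
    simp only [Prod.mk.injEq] at *
    grind
  · simp only [offSupport, innerCol, lastCol, h3, if_false, Finset.mem_insert,
      Finset.mem_singleton] at hm
    have a1 := hm (k, l)
    have a3 := hm (m, l')
    have a4 := hm (k', l)
    have b1 := hm (k, l₂)
    have b3 := hm (m₂, l₂')
    have b4 := hm (k', l₂)
    clear hm he
    simp only [Prod.mk.injEq] at *
    grind

lemma offSupport_ne_empty (N : Fin 2) (k k' : Fin p) (t : Fin q × Fin p × Fin q) :
    offSupport N k k' t ≠ ∅ :=
  Finset.insert_ne_empty _ _

lemma integral_offComponent_mul (h : IsStdMatrix Y P) (N : Fin 2) (c : ℝ) {k k' : Fin p}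
    (hk : k ≠ k') {t u : Fin q × Fin p × Fin q} (htu : t ≠ u) :
    ∫ ω, offComponent N P Y c k k' t ω * offComponent N P Y c k k' u ω ∂P = 0 := by
  have hz : ∀ t : Fin q × Fin p × Fin q, t.2.1 = k' ∧ t.1 = t.2.2 →
      ∀ ω, offComponent N P Y c k k' t ω = 0 := fun t ht ω => by
    simp [offComponent, ht.1, ht.2, hk.symm]
  by_cases he : offSupport N k k' t = offSupport N k k' u
  · rcases offSupport_eq N hk he with h1 | h1 | h1
    · exact absurd h1 htu
    · simp [hz t h1]
    · simp [hz u h1]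
  · exact h.integral_mul_of_mem_chaos he (offComponent_mem_chaos N c hk t)
      (offComponent_mem_chaos N c hk u)

lemma matrixProd_pair {a b : Fin p × Fin q} (hab : a ≠ b) (ω : Ω) :
    matrixProd P Y [a, b] ω = Y ω a.1 a.2 * Y ω b.1 b.2 :=
  centeredProd_pair _ hab _

lemma matrixProd_cube {a b : Fin p × Fin q} (hab : a ≠ b) (ω : Ω) :
    matrixProd P Y [a, a, a, b] ω = (Y ω a.1 a.2 ^ 3 - skew P Y a.1 a.2) * Y ω b.1 b.2 :=
  centeredProd_cube _ hab _

lemma matrixProd_sq {a b c : Fin p × Fin q} (hab : a ≠ b) (hac : a ≠ c) (hbc : b ≠ c) (ω : Ω) :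
    matrixProd P Y [a, a, b, c] ω = (Y ω a.1 a.2 ^ 2 - 1) * (Y ω b.1 b.2 * Y ω c.1 c.2) :=
  centeredProd_sq _ hab hac hbc _

lemma matrixProd_four {a b c d : Fin p × Fin q} (hab : a ≠ b) (hac : a ≠ c) (had : a ≠ d)
    (hbc : b ≠ c) (hbd : b ≠ d) (hcd : c ≠ d) (ω : Ω) :
    matrixProd P Y [a, b, c, d] ω
      = Y ω a.1 a.2 * (Y ω b.1 b.2 * (Y ω c.1 c.2 * Y ω d.1 d.2)) :=
  centeredProd_four _ hab hac had hbc hbd hcd _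

/-- The terms of the FOBI kernel, up to lower order terms, are components of the linearized
estimate. -/
lemma fobi_term_eq (N : Fin 2) (c : ℝ) {k k' : Fin p} (hk : k ≠ k') (t : Fin q × Fin p × Fin q)
    (ω : Ω) :
    Y ω k t.1 * Y ω t.2.1 (innerCol N t.1 t.2.2) * Y ω t.2.1 t.2.2 * Y ω k' (lastCol N t.1 t.2.2)
      = offComponent N P Y c k k' t ω + if t.2.1 = k then
          if t.1 = t.2.2 then skew P Y k t.1 * Y ω k' t.1
            - (Y ω k' t.1 ^ 3 - skew P Y k' t.1) * Y ω k t.1 + c * (Y ω k t.1 * Y ω k' t.1)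
          else if N = 0 then Y ω k t.2.2 * Y ω k' t.2.2 else Y ω k t.1 * Y ω k' t.1
        else if t.2.1 = k' then
          if t.1 = t.2.2 then Y ω k t.1 * Y ω k' t.1 ^ 3 else Y ω k t.1 * Y ω k' t.1
        else if N = 0 then if t.1 = t.2.2 then Y ω k t.1 * Y ω k' t.1 else 0
        else Y ω k t.1 * Y ω k' t.1 := by
  obtain ⟨l, m, l'⟩ := t
  have d : ∀ {a b : Fin p} {x y : Fin q}, a ≠ b → (a, x) ≠ (b, y) :=
    fun h e => h (congrArg Prod.fst e)
  have d' : ∀ {a b : Fin p} {x y : Fin q}, x ≠ y → (a, x) ≠ (b, y) :=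
    fun h e => h (congrArg Prod.snd e)
  simp only [offComponent]
  by_cases h1 : m = k
  · subst h1
    by_cases h2 : l = l'
    · subst h2
      rw [if_pos rfl, if_pos rfl, if_pos rfl, if_pos rfl, matrixProd_cube (d hk),
        matrixProd_cube (d hk.symm), matrixProd_pair (d hk)]
      simp only [innerCol, lastCol, ite_self]
      ring
    · rw [if_pos rfl, if_neg h2, if_pos rfl, if_neg h2]
      by_cases h3 : N = 0
      · rw [if_pos h3, if_pos h3, matrixProd_sq (d' h2) (d hk) (d hk)]
        simp only [innerCol, lastCol, h3, if_true]
        ring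
      · rw [if_neg h3, if_neg h3, matrixProd_sq (d' (Ne.symm h2)) (d hk) (d hk)]
        simp only [innerCol, lastCol, h3, if_false]
        ring
  · rw [if_neg h1, if_neg h1]
    by_cases h4 : m = k'
    · subst h4
      rw [if_pos rfl, if_pos rfl]
      by_cases h2 : l = l'
      · subst h2
        rw [if_pos rfl, if_pos rfl]
        simp only [innerCol, lastCol, ite_self]
        ring
      · rw [if_neg h2, if_neg h2, matrixProd_sq (d hk.symm) (d' (Ne.symm h2)) (d hk)]
        by_cases h3 : N = 0 <;> simp only [innerCol, lastCol, h3, if_true, if_false] <;> ring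
    · rw [if_neg h4, if_neg h4]
      by_cases h3 : N = 0
      · rw [if_pos h3, if_pos h3]
        by_cases h2 : l = l'
        · subst h2
          rw [if_pos rfl, if_pos rfl, matrixProd_sq (d h1) (d h4) (d hk)]
          simp only [innerCol, lastCol, ite_self]
          ring
        · rw [if_neg h2, if_neg h2, matrixProd_four (d (Ne.symm h1)) (d (Ne.symm h1)) (d hk)
            (d' h2) (d h4) (d h4)]
          simp only [innerCol, lastCol, h3, if_true]
          ring
      · rw [if_neg h3, if_neg h3, matrixProd_sq (d h1) (d h4) (d hk)]
        simp only [innerCol, lastCol, h3, if_false]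
        ring

/-- The orthogonal decomposition of the off-diagonal entries of the linearized estimate. -/
lemma estimateLin_eq_sum (hq : 0 < q) (N : Fin 2) {k k' : Fin p} (hk : k ≠ k')
    (hb : fobiEigenvalue N P Y k ≠ fobiEigenvalue N P Y k') (ω : Ω) :
    q * (fobiEigenvalue N P Y k - fobiEigenvalue N P Y k') *
        estimateLin N (fobiEigenvalue N P Y) (skew P Y) (monomials (Y ω)) k k'
      = ∑ t, offComponent N P Y (rowAvg (kurt P Y) k + 3) k k' t ω := by
  have hq' : (q : ℝ) ≠ 0 := by positivity
  have hb' := sub_ne_zero.2 hb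
  set A : ℝ := ∑ l, Y ω k l * Y ω k' l with hA
  have h1 : covLin (monomials (Y ω)) k k' = -(1 / 2) * ((q : ℝ)⁻¹ * A) := by
    simp [covLin, monomials, aug, hk, hA]
  have h3 : fobiSum N (fun a b c d => monomials (Y ω) (some a) (some b) (some c) (some d)) k k'
      = ∑ t, offComponent N P Y (rowAvg (kurt P Y) k + 3) k k' t ω +
        (∑ l, (Y ω k l * skew P Y k' l + Y ω k' l * skew P Y k l) +
          A * (fobiEigenvalue N P Y k + (q : ℝ)⁻¹ * innerMult N q)) := by
    -- This identity fixes the constant `c`. Off the diagonal `covLin` is -A/(2q); the term s(b_k +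
    -- b_k' + 2Λ/q) of `fobiLin` and the added `covLin`, scaled by b_k - b_k', together cancel
    -- exactly A(b_k + Λ/q).
    have h4 : rowAvg (kurt P Y) k + 3 + 2 * ((q : ℝ) - 1) + (p - 2) * (if N = 0 then 1 else q)
        = fobiEigenvalue N P Y k + (q : ℝ)⁻¹ * innerMult N q := by
      by_cases hN : N = 0 <;> simp only [fobiEigenvalue, innerMult, hN, if_true, if_false] <;>
        field_simp <;> ring
    rw [← h4, ← sum_fobi_remainder N hk, ← Finset.sum_add_distrib]
    exact Finset.sum_congr rfl fun t _ => fobi_term_eq N _ hk t ω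
  rw [estimateLin, if_neg hk, fobiLin, h3, h1]
  simp only [monomials, aug, one_mul]
  field_simp
  ring

lemma integral_sq_offComponent (h : IsStdMatrix Y P) (N : Fin 2) (c : ℝ) {k k' : Fin p}
    (hk : k ≠ k') (t : Fin q × Fin p × Fin q) :
    ∫ ω, offComponent N P Y c k k' t ω ^ 2 ∂P = if t.2.1 = k then
        if t.1 = t.2.2 then varCube P Y k t.1 + varCube P Y k' t.1 + c ^ 2
          + 2 * (kurt P Y k t.1 * kurt P Y k' t.1) - 2 * c * (kurt P Y k t.1 + kurt P Y k' t.1)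
        else if N = 0 then kurt P Y k t.1 - 1 else kurt P Y k t.2.2 - 1
      else if t.2.1 = k' then if t.1 = t.2.2 then 0 else kurt P Y k' t.2.2 - 1
      else if N = 0 then if t.1 = t.2.2 then kurt P Y t.2.1 t.1 - 1 else 1
      else kurt P Y t.2.1 t.2.2 - 1 := by
  obtain ⟨l, m, l'⟩ := t
  have d : ∀ {a b : Fin p} {x y : Fin q}, a ≠ b → (a, x) ≠ (b, y) :=
    fun h e => h (congrArg Prod.fst e)
  have d' : ∀ {a b : Fin p} {x y : Fin q}, x ≠ y → (a, x) ≠ (b, y) :=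
    fun h e => h (congrArg Prod.snd e)
  simp only [offComponent]
  by_cases h1 : m = k
  · subst h1
    simp only [if_true]
    by_cases h2 : l = l'
    · subst h2
      simp only [if_true]
      exact h.integral_sq_cubes_sub (d hk) c
    · by_cases h3 : N = 0
      · simp only [h2, h3, if_true, if_false, sq]
        exact h.integral_sq_sq (d' h2) (d hk) (d hk)
      · simp only [h2, h3, if_false, sq]
        exact h.integral_sq_sq (d' (Ne.symm h2)) (d hk) (d hk)
  · by_cases h4 : m = k'
    · subst h4
      by_cases h2 : l = l'
      · simp [h1, h2]
      · simp only [h1, h2, if_true, if_false, sq]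
        exact h.integral_sq_sq (d hk.symm) (d' (Ne.symm h2)) (d hk)
    · by_cases h3 : N = 0
      · by_cases h2 : l = l'
        · simp only [h1, h2, h3, h4, if_true, if_false, sq]
          exact h.integral_sq_sq (d h1) (d h4) (d hk)
        · simp only [h1, h2, h3, h4, if_true, if_false, sq]
          exact h.integral_sq_four (d (Ne.symm h1)) (d (Ne.symm h1)) (d hk) (d' h2) (d h4) (d h4)
      · simp only [h1, h3, h4, if_false, sq]
        exact h.integral_sq_sq (d h1) (d h4) (d hk)

lemma sum_integral_sq_offComponent (h : IsStdMatrix Y P) (hq : 0 < q) (N : Fin 2)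
    {k k' : Fin p} (hk : k ≠ k') :
    ∑ t, ∫ ω, offComponent N P Y (rowAvg (kurt P Y) k + 3) k k' t ω ^ 2 ∂P
      = q * (rowAvg (varCube P Y) k + rowAvg (varCube P Y) k' - rowAvg (kurt P Y) k ^ 2
      + 2 * rowCov (kurt P Y) k k' + ((q : ℝ) - 1) * rowAvg (kurt P Y) k
      + ((q : ℝ) - 7) * rowAvg (kurt P Y) k' + cConst N q (rowAvg (kurt P Y)) k k') := by
  have hq' : (q : ℝ) ≠ 0 := by positivity
  have e : ∀ (α : Fin p → Fin q → ℝ) (k : Fin p), ∑ l, α k l = q * rowAvg α k := fun α k => by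
    rw [rowAvg, mul_inv_cancel_left₀ hq']
  have e' : ∑ l, kurt P Y k l * kurt P Y k' l
      = q * (rowCov (kurt P Y) k k' + rowAvg (kurt P Y) k * rowAvg (kurt P Y) k') := by
    rw [rowCov, sub_add_cancel, mul_inv_cancel_left₀ hq']
  simp only [integral_sq_offComponent h N _ hk]
  -- The asymmetry in `k` and `k'` comes from this `c`: c² - 2c(β̄_k + β̄_k') + 2(δ + β̄_k β̄_k') =
  -- -β̄_k² + 2δ - 6β̄_k' + 9. The triples with `l ≠ l'` and middle row `k` or `k'` add (q - 1)(β̄_k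
  -- + β̄_k' - 2) after division by q, and the other middle rows supply the rest of `cConst`.
  set c := rowAvg (kurt P Y) k + 3 with hc
  by_cases hN : N = 0
  · simp only [hN, if_true]
    rw [sum_rows hk (fun l l' => if l = l' then varCube P Y k l + varCube P Y k' l + c ^ 2
          + 2 * (kurt P Y k l * kurt P Y k' l) - 2 * c * (kurt P Y k l + kurt P Y k' l)
          else kurt P Y k l - 1)
        (fun l l' => if l = l' then 0 else kurt P Y k' l' - 1)
        (fun m l l' => if l = l' then kurt P Y m l - 1 else 1),
      sum_offdiag_left _ fun l => kurt P Y k l - 1,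
      sum_offdiag_right (fun _ => 0) fun l => kurt P Y k' l - 1]
    simp only [sum_offdiag_left _ fun _ : Fin q => (1 : ℝ), Finset.sum_add_distrib,
      Finset.sum_sub_distrib, ← Finset.mul_sum, e, e', Finset.sum_const, Finset.card_univ,
      Fintype.card_fin, nsmul_eq_mul, card_sdiff_pair hk, cConst, if_true, hc]
    ring
  · simp only [hN, if_false]
    rw [sum_rows hk (fun l l' => if l = l' then varCube P Y k l + varCube P Y k' l + c ^ 2
          + 2 * (kurt P Y k l * kurt P Y k' l) - 2 * c * (kurt P Y k l + kurt P Y k' l)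
          else kurt P Y k l' - 1)
        (fun l l' => if l = l' then 0 else kurt P Y k' l' - 1)
        (fun m l l' => kurt P Y m l' - 1),
      sum_offdiag_right _ fun l => kurt P Y k l - 1,
      sum_offdiag_right (fun _ => 0) fun l => kurt P Y k' l - 1]
    simp only [Finset.sum_add_distrib,
      Finset.sum_sub_distrib, ← Finset.mul_sum, e, e', Finset.sum_const, Finset.card_univ,
      Fintype.card_fin, nsmul_eq_mul, card_sdiff_pair hk, cConst, hN, if_false, hc]
    ring

end OffDiagonal

/-! ### Mean and variance of the influence function -/

section Variance

variable {Ω : Type*} [MeasurableSpace Ω] {P : Measure Ω} {p q : ℕ}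
  {Y : Ω → Matrix (Fin p) (Fin q) ℝ}

/-- The value of the linearized estimate at one observation, the entry `(k, k')` being stored at
the index `(k', k)` of the column-stacking vectorization. -/
noncomputable def influence (N : Fin 2) (P : Measure Ω) (Y : Ω → Matrix (Fin p) (Fin q) ℝ)
    (x : Matrix (Fin p) (Fin q) ℝ) (a : Fin p × Fin p) : ℝ :=
  estimateLin N (fobiEigenvalue N P Y) (skew P Y) (monomials x) a.2 a.1

/-- On the diagonal only the covariance matrix matters: the influence is -1/2 times the average of
z² - 1 over the row. -/
lemma influence_diag (N : Fin 2) (k : Fin p) (ω : Ω) :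
    influence N P Y (Y ω) (k, k)
      = ∑ l, -(1 / 2) * (q : ℝ)⁻¹ * matrixProd P Y [(k, l), (k, l)] ω := by
  rw [← Finset.mul_sum]
  simp [influence, estimateLin, covLin, monomials, aug, chaosProd, centeredProd_eq, centeredPow, sq]
  ring

lemma influence_off (hq : 0 < q) (N : Fin 2) {k k' : Fin p} (hk : k ≠ k')
    (hb : fobiEigenvalue N P Y k ≠ fobiEigenvalue N P Y k') (ω : Ω) :
    influence N P Y (Y ω) (k', k) = ∑ t, (q * (fobiEigenvalue N P Y k - fobiEigenvalue N P Y k'))⁻¹ *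
      offComponent N P Y (rowAvg (kurt P Y) k + 3) k k' t ω := by
  have hq' : (q : ℝ) ≠ 0 := by positivity
  rw [← Finset.mul_sum, ← estimateLin_eq_sum hq N hk hb, influence,
    inv_mul_cancel_left₀ (mul_ne_zero hq' (sub_ne_zero.2 hb))]

/-- The influence function is a sum of orthogonal variables with mean zero. -/
lemma memLp_influence (h : IsStdMatrix Y P) (hq : 0 < q) (N : Fin 2)
    (hb : Function.Injective (fobiEigenvalue N P Y)) (a : Fin p × Fin p) :
    MemLp (fun ω => influence N P Y (Y ω) a) 2 P := by
  obtain ⟨k', k⟩ := a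
  by_cases hk : k = k'
  · subst hk
    simp only [influence_diag]
    exact memLp_finsetSum _ fun l _ =>
      (h.memLp_of_mem_chaos (chaosProd_mem [(k, l), (k, l)] rfl)).const_mul _
  · simp only [influence_off hq N hk (hb.ne hk)]
    exact memLp_finsetSum _ fun t _ =>
      (h.memLp_of_mem_chaos (offComponent_mem_chaos N _ hk t)).const_mul _

lemma integral_influence (h : IsStdMatrix Y P) (hq : 0 < q) (N : Fin 2)
    (hb : Function.Injective (fobiEigenvalue N P Y)) (a : Fin p × Fin p) :
    ∫ ω, influence N P Y (Y ω) a ∂P = 0 := by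
  have := h.indep.isProbabilityMeasure
  obtain ⟨k', k⟩ := a
  by_cases hk : k = k'
  · subst hk
    simp only [influence_diag]
    rw [integral_finsetSum _ fun l _ => ((h.memLp_of_mem_chaos
      (chaosProd_mem [(k, l), (k, l)] rfl)).integrable one_le_two).const_mul _]
    refine Finset.sum_eq_zero fun l _ => ?_
    rw [integral_const_mul, h.integral_of_mem_chaos (S := {(k, l)}) (by simp)
      (chaosProd_mem [(k, l), (k, l)] (by simp)), mul_zero]
  · simp only [influence_off hq N hk (hb.ne hk)]
    rw [integral_finsetSum _ fun t _ => ((h.memLp_of_mem_chaos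
      (offComponent_mem_chaos N _ hk t)).integrable one_le_two).const_mul _]
    refine Finset.sum_eq_zero fun t _ => ?_
    rw [integral_const_mul, h.integral_of_mem_chaos (offSupport_ne_empty N k k' t)
      (offComponent_mem_chaos N _ hk t), mul_zero]

lemma variance_influence (h : IsStdMatrix Y P) (hq : 0 < q) (N : Fin 2)
    (hb : Function.Injective (fobiEigenvalue N P Y)) (a : Fin p × Fin p) :
    Var[fun ω => influence N P Y (Y ω) a; P] = ∫ ω, influence N P Y (Y ω) a ^ 2 ∂P :=
  variance_of_integral_eq_zero (memLp_influence h hq N hb a).aestronglyMeasurable.aemeasurable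
    (integral_influence h hq N hb a)

theorem variance_influence_diag (h : IsStdMatrix Y P) (hq : 0 < q) (N : Fin 2)
    (hb : Function.Injective (fobiEigenvalue N P Y)) (k : Fin p) :
    Var[fun ω => influence N P Y (Y ω) (k, k); P] = asvDiag P Y k := by
  have hq' : (q : ℝ) ≠ 0 := by positivity
  have hl : ∀ l, matrixProd P Y [(k, l), (k, l)] ∈
      chaos P (fun (a : Fin p × Fin q) ω => Y ω a.1 a.2) {(k, l)} :=
    fun l => chaosProd_mem _ (by simp)
  rw [variance_influence h hq N hb]
  simp only [influence_diag]
  rw [integral_sum_sq (fun l => (h.memLp_of_mem_chaos (hl l)).const_mul _)]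
  · simp only [mul_pow, integral_const_mul]
    have e : ∀ l, ∫ ω, matrixProd P Y [(k, l), (k, l)] ω ^ 2 ∂P = kurt P Y k l - 1 := fun l => by
      simp only [sq]
      exact h.integral_sq_double _
    simp only [e, ← Finset.mul_sum, Finset.sum_sub_distrib, asvDiag, rowAvg, Finset.sum_const,
      Finset.card_univ, Fintype.card_fin, nsmul_eq_mul]
    field_simp
    ring
  · intro l l' hll
    simp only [mul_mul_mul_comm _ (matrixProd P Y _ _)]
    rw [integral_const_mul, h.integral_mul_of_mem_chaos (by simpa using hll) (hl l) (hl l'),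
      mul_zero]

theorem variance_influence_off (h : IsStdMatrix Y P) (hq : 0 < q) (N : Fin 2)
    (hb : Function.Injective (fobiEigenvalue N P Y)) {k k' : Fin p} (hk : k ≠ k') :
    Var[fun ω => influence N P Y (Y ω) (k', k); P] = asvOff N P Y k k' := by
  have hq' : (q : ℝ) ≠ 0 := by positivity
  have hb' := sub_ne_zero.2 (hb.ne hk)
  have hd : fobiEigenvalue N P Y k - fobiEigenvalue N P Y k'
      = rowAvg (kurt P Y) k - rowAvg (kurt P Y) k' := by
    simp only [fobiEigenvalue]
    ring
  rw [variance_influence h hq N hb]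
  simp only [influence_off hq N hk (hb.ne hk)]
  rw [integral_sum_sq fun t => (h.memLp_of_mem_chaos (offComponent_mem_chaos N _ hk t)).const_mul _]
  · simp only [mul_pow, integral_const_mul]
    rw [← Finset.mul_sum, sum_integral_sq_offComponent h hq N hk, asvOff, ← hd]
    field_simp
  · intro t u htu
    simp only [mul_mul_mul_comm _ (offComponent _ _ _ _ _ _ _ _)]
    rw [integral_const_mul, integral_offComponent_mul h N _ hk htu, mul_zero]

end Variance

/-! ### Averages -/

section Average

/-- The average of the first `n` terms of a sequence. -/
noncomputable def avg (n : ℕ) (u : ℕ → ℝ) : ℝ := (n : ℝ)⁻¹ * ∑ i ∈ Finset.range n, u i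

variable (n : ℕ) (u v : ℕ → ℝ)

lemma avg_add : avg n (fun i => u i + v i) = avg n u + avg n v := by
  simp [avg, Finset.sum_add_distrib, mul_add]

lemma avg_const_mul (c : ℝ) : avg n (fun i => c * u i) = c * avg n u := by
  simp [avg, ← Finset.mul_sum, mul_left_comm]

lemma avg_sub : avg n (fun i => u i - v i) = avg n u - avg n v := by
  simp [avg, Finset.sum_sub_distrib, mul_sub]

lemma avg_mul_const (c : ℝ) : avg n (fun i => u i * c) = avg n u * c := by
  simp only [mul_comm _ c, avg_const_mul]

lemma avg_div_const (c : ℝ) : avg n (fun i => u i / c) = avg n u / c := by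
  simp only [div_eq_mul_inv, avg_mul_const]

lemma avg_sum {ι : Type*} (s : Finset ι) (w : ι → ℕ → ℝ) :
    avg n (fun i => ∑ j ∈ s, w j i) = ∑ j ∈ s, avg n (w j) := by
  simp only [avg]
  rw [Finset.sum_comm, Finset.mul_sum]

/-- For `n = 0` every average is `0`; that sample size is later discarded through
`eventually_ne_zero`. -/
lemma avg_const {n : ℕ} (hn : n ≠ 0) (c : ℝ) : avg n (fun _ => c) = c := by
  have : (n : ℝ) ≠ 0 := by exact_mod_cast hn
  simp [avg, this]

lemma avg_centered_mul {n : ℕ} (hn : n ≠ 0) :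
    avg n (fun i => (u i - avg n u) * (v i - avg n v)) = avg n (fun i => u i * v i)
      - avg n u * avg n v := by
  have e : ∀ i, (u i - avg n u) * (v i - avg n v)
      = u i * v i - u i * avg n v - avg n u * v i + avg n u * avg n v := fun i => by ring
  simp only [e, avg_add, avg_sub, avg_mul_const, avg_const_mul, avg_const hn]
  ring

end Average

/-! ### Sample statistics as functions of the empirical moments -/

section Sample

variable {p q : ℕ}

/-- The empirical moments of the first `n` terms of a sequence of matrices. -/
noncomputable def empMoments (n : ℕ) (x : ℕ → Matrix (Fin p) (Fin q) ℝ) : Tensor p q :=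
  fun a b c d => avg n fun i => monomials (x i) a b c d

variable (n : ℕ) (x : ℕ → Matrix (Fin p) (Fin q) ℝ)

lemma empMoments_one (a : Fin p × Fin q) :
    empMoments n x none none none (some a) = avg n fun i => x i a.1 a.2 := by
  simp [empMoments, monomials, aug]

lemma empMoments_two (a b : Fin p × Fin q) :
    empMoments n x none none (some a) (some b) = avg n fun i => x i a.1 a.2 * x i b.1 b.2 := by
  simp [empMoments, monomials, aug]

lemma sampleMean_apply (k : Fin p) (l : Fin q) :
    sampleMean n x k l = avg n fun i => x i k l := by
  simp [sampleMean, avg, Matrix.sum_apply]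

lemma avg_center {n : ℕ} (hn : n ≠ 0) (centered : Bool) (a b : Fin p × Fin q) :
    avg n (fun i => (x i a.1 a.2 - center centered n x a.1 a.2) *
      (x i b.1 b.2 - center centered n x b.1 b.2))
    = empMoments n x none none (some a) (some b) - if centered then
        empMoments n x none none none (some a) * empMoments n x none none none (some b) else 0 := by
  rw [empMoments_one, empMoments_one, empMoments_two]
  cases centered
  · simp [center]
  · simp only [center, if_true, sampleMean_apply]
    exact avg_centered_mul _ _ hn

lemma sampleCovL_eq {n : ℕ} (hn : n ≠ 0) (centered : Bool) :
    sampleCovL centered n x = leftCov centered (empMoments n x) := by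
  ext k k'
  simp only [leftCov, ← avg_center x hn, ← avg_sum]
  simp [sampleCovL, avg, Matrix.sum_apply, Matrix.mul_apply]

lemma sampleCovR_eq {n : ℕ} (hn : n ≠ 0) (centered : Bool) :
    sampleCovR centered n x = rightCov centered (empMoments n x) := by
  ext l l'
  simp only [rightCov, ← avg_center x hn, ← avg_sum]
  simp [sampleCovR, avg, Matrix.sum_apply, Matrix.mul_apply]

lemma fobiKernel_apply (N : Fin 2) (y : Matrix (Fin p) (Fin q) ℝ) (k k' : Fin p) :
    fobiKernel N y k k'
      = fobiSum N (fun a b c d => y a.1 a.2 * y b.1 b.2 * y c.1 c.2 * y d.1 d.2) k k' := by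
  by_cases hN : N = 0
  · simp only [fobiKernel, fobiSum, innerCol, lastCol, hN, if_true, Fintype.sum_prod_type,
      Matrix.mul_apply, Matrix.transpose_apply, Finset.sum_mul]
    rw [Finset.sum_comm, Finset.sum_congr rfl fun m _ => Finset.sum_comm, Finset.sum_comm]
  · simp only [fobiKernel, fobiSum, innerCol, lastCol, hN, if_false, Fintype.sum_prod_type,
      Matrix.smul_apply, smul_eq_mul, Matrix.mul_apply, Matrix.transpose_apply, Finset.mul_sum,
      Finset.sum_mul]
    refine Finset.sum_congr rfl fun l _ => Finset.sum_congr rfl fun m _ =>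
      Finset.sum_congr rfl fun l' _ => by ring

/-- The augmented constant component absorbs the sample mean, making the centered and standardized
matrix linear in `aug y`. -/
lemma standardized_apply (L : Matrix (Fin p) (Fin p) ℝ) (R : Matrix (Fin q) (Fin q) ℝ)
    (y : Matrix (Fin p) (Fin q) ℝ) (k : Fin p) (l : Fin q) :
    (L * (y - sampleMean n x) * Rᵀ) k l
      = ∑ e, weight L R (empMoments n x) (k, l) e * aug y e := by
  simp only [Fintype.sum_option, weight, aug, empMoments_one, ← sampleMean_apply,
    Fintype.sum_prod_type, Matrix.mul_apply, Matrix.transpose_apply, Finset.sum_mul,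
    Matrix.sub_apply, mul_one]
  rw [Finset.sum_comm, neg_add_eq_sub, ← Finset.sum_sub_distrib]
  refine Finset.sum_congr rfl fun a _ => ?_
  rw [← Finset.sum_sub_distrib]
  exact Finset.sum_congr rfl fun b _ => by ring

/-- Expanding the four linear forms and averaging the monomials before the coefficients are applied
gives the quartic form of the empirical moments. -/
lemma sampleFobiL_eq (N : Fin 2) (L : Matrix (Fin p) (Fin p) ℝ) (R : Matrix (Fin q) (Fin q) ℝ) :
    sampleFobiL N L R n x = fobiMatrix N L R (empMoments n x) := by
  ext k k'
  have e : sampleFobiL N L R n x k k' = (q : ℝ)⁻¹ *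
      avg n fun i => fobiKernel N (L * (x i - sampleMean n x) * Rᵀ) k k' := by
    simp [sampleFobiL, avg, Matrix.sum_apply]
  rw [e, fobiMatrix]
  congr 1
  simp only [fobiKernel_apply, fobiSum, avg_sum]
  refine Finset.sum_congr rfl fun t _ => ?_
  simp only [standardized_apply, quartic, empMoments, ← avg_const_mul, ← avg_sum]
  congr 1
  ext i
  simp only [mul_assoc]
  simp only [Finset.sum_mul]
  simp only [Finset.mul_sum, monomials]
  refine Finset.sum_congr rfl fun e₁ _ => Finset.sum_congr rfl fun e₂ _ =>
    Finset.sum_congr rfl fun e₃ _ => Finset.sum_congr rfl fun e₄ _ => by ring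

lemma isSymm_sampleFobiL (N : Fin 2) (L : Matrix (Fin p) (Fin p) ℝ)
    (R : Matrix (Fin q) (Fin q) ℝ) : (sampleFobiL N L R n x).IsSymm := by
  have h : ∀ y : Matrix (Fin p) (Fin q) ℝ, (fobiKernel N y)ᵀ = fobiKernel N y := by
    intro y
    by_cases hN : N = 0 <;> simp [fobiKernel, hN, Matrix.transpose_mul, Matrix.mul_assoc]
  simp [Matrix.IsSymm, sampleFobiL, Matrix.transpose_sum, h]

/-- `estimateLin` is affine in the moments, and averages of at least one term commute with affine
maps. This turns the linearization into a sample average. -/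
lemma estimateLin_empMoments {n : ℕ} (hn : n ≠ 0) (N : Fin 2) (b : Fin p → ℝ)
    (g : Fin p → Fin q → ℝ) (k k' : Fin p) :
    estimateLin N b g (empMoments n x) k k'
      = avg n fun i => estimateLin N b g (monomials (x i)) k k' := by
  have h : ∀ k k' : Fin p, covLin (empMoments n x) k k'
      = avg n fun i => covLin (monomials (x i)) k k' := by
    intro k k'
    simp only [covLin, avg_const_mul, avg_sum, avg_sub, avg_const hn, empMoments]
  by_cases hk : k = k'
  · subst hk
    simp only [estimateLin, if_true, h]
  · simp only [estimateLin, if_neg hk, fobiLin, h, avg_add, avg_div_const, avg_const_mul, avg_sub,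
      avg_sum, avg_mul_const, fobiSum]
    rfl

end Sample

/-! ### Convergence in probability as convergence along a filter -/

section ProbFilter

variable {Ω : Type*} [MeasurableSpace Ω] {P : Measure Ω}

/-- The sets of pairs `(n, ω)` whose sections at `n` have a probability that tends to one. A
sequence of random variables converges to a constant in probability if and only if it converges
along this filter. -/
def probFilter (P : Measure Ω) : Filter (ℕ × Ω) where
  sets := {A | Tendsto (fun n => P {ω | (n, ω) ∉ A}) atTop (𝓝 0)}
  univ_sets := by simp
  sets_of_superset {A B} hA hAB := tendsto_of_tendsto_of_tendsto_of_le_of_le tendsto_const_nhds hA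
    (fun _ => zero_le) fun n => measure_mono fun ω hω h => hω (hAB h)
  inter_sets {A B} hA hB := by
    refine tendsto_of_tendsto_of_tendsto_of_le_of_le tendsto_const_nhds
      (by simpa using Tendsto.add hA hB) (fun _ => zero_le) fun n => ?_
    refine (measure_mono fun ω hω => ?_).trans (measure_union_le _ _)
    by_cases h : (n, ω) ∈ A
    · exact Or.inr fun h' => hω ⟨h, h'⟩
    · exact Or.inl h

lemma eventually_probFilter {Q : ℕ × Ω → Prop} :
    (∀ᶠ t in probFilter P, Q t) ↔ Tendsto (fun n => P {ω | ¬Q (n, ω)}) atTop (𝓝 0) :=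
  Iff.rfl

lemma eventually_probFilter_of_ae {Q : ℕ × Ω → Prop} (h : ∀ᶠ n in atTop, ∀ᵐ ω ∂P, Q (n, ω)) :
    ∀ᶠ t in probFilter P, Q t :=
  eventually_probFilter.2 (tendsto_const_nhds.congr' (h.mono fun _ hn => (ae_iff.1 hn).symm))

lemma tendstoInMeasure_iff_probFilter {E : Type*} [PseudoEMetricSpace E] {X : ℕ → Ω → E} {c : E} :
    TendstoInMeasure P X atTop (fun _ => c) ↔
      Tendsto (fun t => X t.1 t.2) (probFilter P) (𝓝 c) := by
  rw [Metric.nhds_basis_eball.tendsto_right_iff]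
  refine forall_congr' fun ε => imp_congr_right fun _ => ?_
  rw [eventually_probFilter]
  simp only [Metric.mem_eball, not_lt]

/-- A quantity of smaller order than one with second moments of order `n⁻¹` is negligible after
multiplication with `√n`. -/
lemma tendsto_sqrt_mul_of_isLittleO [IsProbabilityMeasure P] {r ρ : ℕ × Ω → ℝ} {C : ℝ}
    (hr : r =o[probFilter P] ρ) (hi : ∀ n, Integrable (fun ω => ρ (n, ω) ^ 2) P)
    (hC : ∀ n ≠ 0, ∫ ω, ρ (n, ω) ^ 2 ∂P ≤ (n : ℝ)⁻¹ * C) :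
    Tendsto (fun t => √(t.1 : ℝ) * r t) (probFilter P) (𝓝 0) := by
  have hC0 : 0 ≤ C := by
    have := (integral_nonneg fun ω => sq_nonneg (ρ (1, ω))).trans (hC 1 one_ne_zero)
    simpa using this
  rw [Metric.tendsto_nhds]
  intro η hη
  rw [eventually_probFilter, ENNReal.tendsto_nhds_zero]
  intro δ hδ
  -- The bound here is what Markov's inequality gives for ρ² ≥ η²/(c²n). Where |r| ≤ c|ρ|, the event
  -- √n |r| ≥ η forces that inequality, and `c` may be taken as small as needed because r = o(ρ).
  obtain ⟨c, hc0, hc⟩ : ∃ c : ℝ, 0 < c ∧ ENNReal.ofReal (c ^ 2 * C / η ^ 2) ≤ δ / 2 := by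
    have h1 : Tendsto (fun c : ℝ => ENNReal.ofReal (c ^ 2 * C / η ^ 2)) (𝓝[>] 0) (𝓝 0) := by
      have hc : Continuous fun c : ℝ => ENNReal.ofReal (c ^ 2 * C / η ^ 2) :=
        ENNReal.continuous_ofReal.comp (by fun_prop)
      have := (hc.tendsto 0).mono_left (nhdsWithin_le_nhds (s := Set.Ioi 0))
      simpa using this
    obtain ⟨c, h2, h3⟩ := ((h1.eventually_le_const (u := δ / 2)
      (ENNReal.half_pos hδ.ne')).and self_mem_nhdsWithin).exists
    exact ⟨c, h3, h2⟩
  have h1 := eventually_probFilter.1 (hr.def hc0)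
  filter_upwards [ENNReal.tendsto_nhds_zero.1 h1 (δ / 2) (ENNReal.half_pos hδ.ne'),
    eventually_ne_atTop 0] with n hn hn0
  have hnpos : (0 : ℝ) < n := by exact_mod_cast Nat.pos_of_ne_zero hn0
  have h2 : P {ω | η ^ 2 / (c ^ 2 * n) ≤ ρ (n, ω) ^ 2} ≤ δ / 2 := by
    refine le_trans ?_ hc
    have h3 := mul_meas_ge_le_integral_of_nonneg (μ := P) (f := fun ω => ρ (n, ω) ^ 2)
      (ae_of_all _ fun ω => sq_nonneg _) (hi n) (η ^ 2 / (c ^ 2 * n))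
    rw [← ofReal_measureReal]
    refine ENNReal.ofReal_le_ofReal ?_
    have h4 := h3.trans (hC n hn0)
    have h5 : 0 < η ^ 2 / (c ^ 2 * n) := by positivity
    rw [← le_div_iff₀' h5] at h4
    refine h4.trans_eq ?_
    field_simp
  have h6 : {ω | ¬dist (√((n, ω) : ℕ × Ω).1 * r (n, ω)) 0 < η} ⊆
      {ω | ¬‖r (n, ω)‖ ≤ c * ‖ρ (n, ω)‖} ∪ {ω | η ^ 2 / (c ^ 2 * n) ≤ ρ (n, ω) ^ 2} := by
    intro ω hω
    by_cases h7 : ‖r (n, ω)‖ ≤ c * ‖ρ (n, ω)‖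
    · refine Or.inr ?_
      simp only [Set.mem_ofPred_eq, not_lt, dist_zero_right, norm_mul] at hω ⊢
      rw [Real.norm_of_nonneg (Real.sqrt_nonneg _)] at hω
      have h8 : η ≤ √n * (c * ‖ρ (n, ω)‖) :=
        hω.trans (mul_le_mul_of_nonneg_left h7 (Real.sqrt_nonneg _))
      have h9 := pow_le_pow_left₀ hη.le h8 2
      rw [mul_pow, mul_pow, Real.sq_sqrt hnpos.le, Real.norm_eq_abs, sq_abs] at h9
      rw [div_le_iff₀ (by positivity)]
      linarith
    · exact Or.inl h7
  calc P {ω | ¬dist (√((n, ω) : ℕ × Ω).1 * r (n, ω)) 0 < η} ≤ _ := measure_mono h6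
    _ ≤ _ := measure_union_le _ _
    _ ≤ δ / 2 + δ / 2 := add_le_add hn h2
    _ = δ := ENNReal.add_halves δ

end ProbFilter

/-! ### Mean square error of averages -/

section Averages

variable {Ω : Type*} [MeasurableSpace Ω] {P : Measure Ω}

lemma integral_sq_avg_sub [IsProbabilityMeasure P] {X : ℕ → Ω → ℝ} (hX : MemLp (X 0) 2 P)
    (hindep : iIndepFun X P) (hident : ∀ n, IdentDistrib (X n) (X 0) P P) {n : ℕ} (hn : n ≠ 0) :
    ∫ ω, (avg n (fun i => X i ω) - ∫ ω, X 0 ω ∂P) ^ 2 ∂P = (n : ℝ)⁻¹ * Var[X 0; P] := by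
  have hn' : (n : ℝ) ≠ 0 := by exact_mod_cast hn
  have hm : ∀ i, MemLp (X i) 2 P := fun i => (hident i).symm.memLp_snd hX
  have hi : ∀ i, Integrable (X i) P := fun i => (hm i).integrable one_le_two
  have hA : AEMeasurable (fun ω => avg n fun i => X i ω) P :=
    (memLp_finsetSum (Finset.range n) fun i _ => hm i).aestronglyMeasurable.aemeasurable.const_mul _
  have hmean : ∫ ω, avg n (fun i => X i ω) ∂P = ∫ ω, X 0 ω ∂P := by
    simp only [avg]
    rw [integral_const_mul, integral_finsetSum _ fun i _ => hi i,
      Finset.sum_congr rfl fun i _ => (hident i).integral_eq]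
    simp [hn']
  rw [← hmean, ← variance_eq_integral hA]
  simp only [avg, variance_const_mul]
  have h := IndepFun.variance_sum (s := Finset.range n) (X := X) (fun i _ => hm i)
    fun i _ j _ hij => hindep.indepFun hij
  have e : (∑ i ∈ Finset.range n, X i) = fun ω => ∑ i ∈ Finset.range n, X i ω := by
    ext ω; simp
  rw [e, Finset.sum_congr rfl fun i _ => (hident i).variance_eq] at h
  rw [h]
  simp
  field_simp

lemma memLp_avg {X : ℕ → Ω → ℝ} (hX : ∀ i, MemLp (X i) 2 P) (n : ℕ) :
    MemLp (fun ω => avg n fun i => X i ω) 2 P :=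
  (memLp_finsetSum (Finset.range n) fun i _ => hX i).const_mul _

end Averages

/-! ### Positive definiteness of the sample covariance matrices -/

section Positive

variable {p q : ℕ}

lemma posSemidef_sampleCovL (centered : Bool) (n : ℕ) (x : ℕ → Matrix (Fin p) (Fin q) ℝ) :
    (sampleCovL centered n x).PosSemidef := by
  refine Matrix.PosSemidef.smul (Matrix.PosSemidef.smul (Matrix.posSemidef_sum _ fun i _ => ?_)
    (by positivity)) (by positivity)
  simpa using Matrix.posSemidef_self_mul_conjTranspose (x i - center centered n x)

lemma posSemidef_sampleCovR (centered : Bool) (n : ℕ) (x : ℕ → Matrix (Fin p) (Fin q) ℝ) :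
    (sampleCovR centered n x).PosSemidef := by
  refine Matrix.PosSemidef.smul (Matrix.PosSemidef.smul (Matrix.posSemidef_sum _ fun i _ => ?_)
    (by positivity)) (by positivity)
  simpa using Matrix.posSemidef_conjTranspose_mul_self (x i - center centered n x)

/-- Determinants converge to 1, and an invertible positive semidefinite matrix is positive definite.
-/
lemma eventually_posDef {ι : Type*} {f : Filter ι} {S : ι → Matrix (Fin p) (Fin p) ℝ}
    (hS : ∀ t, (S t).PosSemidef) (h : Tendsto S f (𝓝 1)) : ∀ᶠ t in f, (S t).PosDef := by
  have hdet : Tendsto (fun t => (S t).det) f (𝓝 1) := by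
    have hc : Continuous fun A : Matrix (Fin p) (Fin p) ℝ => A.det := by fun_prop
    have := (hc.tendsto 1).comp h
    simpa [Function.comp_def] using this
  filter_upwards [hdet.eventually_ne one_ne_zero] with t ht
  exact (hS t).posDef_iff_isUnit.2 ((Matrix.isUnit_iff_isUnit_det _).2 ht.isUnit)

end Positive

/-! ### Measurability of the statistics and of the closest estimate -/

section Measurability

variable {p q : ℕ}

instance {m n : ℕ} : SecondCountableTopology (Matrix (Fin m) (Fin n) ℝ) :=
  inferInstanceAs (SecondCountableTopology (Fin m → Fin n → ℝ))

lemma continuous_sampleMean (n : ℕ) :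
    Continuous fun x : ℕ → Matrix (Fin p) (Fin q) ℝ => sampleMean n x := by
  simp only [sampleMean]
  fun_prop

lemma continuous_center (centered : Bool) (n : ℕ) :
    Continuous fun x : ℕ → Matrix (Fin p) (Fin q) ℝ => center centered n x := by
  cases centered
  · simpa [center] using continuous_const
  · simpa [center] using continuous_sampleMean n

lemma continuous_sampleCovL (centered : Bool) (n : ℕ) :
    Continuous fun x : ℕ → Matrix (Fin p) (Fin q) ℝ => sampleCovL centered n x := by
  have := continuous_center (p := p) (q := q) centered n
  simp only [sampleCovL]
  fun_prop

lemma continuous_sampleCovR (centered : Bool) (n : ℕ) :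
    Continuous fun x : ℕ → Matrix (Fin p) (Fin q) ℝ => sampleCovR centered n x := by
  have := continuous_center (p := p) (q := q) centered n
  simp only [sampleCovR]
  fun_prop

lemma continuous_fobiKernel (N : Fin 2) :
    Continuous fun y : Matrix (Fin p) (Fin q) ℝ => fobiKernel N y := by
  by_cases hN : N = 0 <;> simp only [fobiKernel, hN, if_true, if_false] <;> fun_prop

lemma continuous_sampleFobiL (N : Fin 2) (n : ℕ) :
    Continuous fun y : (Matrix (Fin p) (Fin p) ℝ × Matrix (Fin q) (Fin q) ℝ) ×
      (ℕ → Matrix (Fin p) (Fin q) ℝ) => sampleFobiL N y.1.1 y.1.2 n y.2 := by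
  have h1 := continuous_sampleMean (p := p) (q := q) n
  have h2 := continuous_fobiKernel (p := p) (q := q) N
  simp only [sampleFobiL]
  have h3 : ∀ i, Continuous fun y : (Matrix (Fin p) (Fin p) ℝ × Matrix (Fin q) (Fin q) ℝ) ×
      (ℕ → Matrix (Fin p) (Fin q) ℝ) => y.1.1 * (y.2 i - sampleMean n y.2) * y.1.2ᵀ := by
    fun_prop
  exact ((continuous_finsetSum (Finset.range n) fun i _ => h2.comp (h3 i)).const_smul
    (n : ℝ)⁻¹).const_smul (q : ℝ)⁻¹

/-- The left MFOBI estimate whose rotation is closest to the identity. -/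
noncomputable def closestEstimate (N : Fin 2) (centered : Bool) (n : ℕ)
    (x : ℕ → Matrix (Fin p) (Fin q) ℝ) : Matrix (Fin p) (Fin p) ℝ :=
  (diagonalizer (sampleFobiL N (invSqrt (sampleCovL centered n x))
    (invSqrt (sampleCovR centered n x)) n x))ᵀ * invSqrt (sampleCovL centered n x)

lemma measurable_closestEstimate (N : Fin 2) (centered : Bool) (n : ℕ) :
    Measurable fun x : ℕ → Matrix (Fin p) (Fin q) ℝ => closestEstimate N centered n x := by
  have hL : Measurable fun x : ℕ → Matrix (Fin p) (Fin q) ℝ =>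
      invSqrt (sampleCovL centered n x) :=
    measurable_invSqrt.comp (continuous_sampleCovL centered n).measurable
  have hR : Measurable fun x : ℕ → Matrix (Fin p) (Fin q) ℝ =>
      invSqrt (sampleCovR centered n x) :=
    measurable_invSqrt.comp (continuous_sampleCovR centered n).measurable
  have hD := measurable_diagonalizer.comp
    ((continuous_sampleFobiL N n).measurable.comp ((hL.prodMk hR).prodMk measurable_id))
  have hc : Continuous fun y : Matrix (Fin p) (Fin p) ℝ × Matrix (Fin p) (Fin p) ℝ =>
      y.1ᵀ * y.2 := by fun_prop
  exact hc.measurable.comp (hD.prodMk hL)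

lemma isLeftEstimate_closestEstimate (N : Fin 2) (centered : Bool) (n : ℕ)
    (x : ℕ → Matrix (Fin p) (Fin q) ℝ) (hL : (sampleCovL centered n x).PosDef)
    (hR : (sampleCovR centered n x).PosDef) :
    IsLeftEstimate N centered n x (closestEstimate N centered n x) :=
  ⟨_, _, _, isSymmInvSqrt_invSqrt hL, isSymmInvSqrt_invSqrt hR, (diagonalizer_mem _).1.1,
    isDiag_of_mem_diagonalizers (isSymm_sampleFobiL n x N _ _) (diagonalizer_mem _).1, rfl⟩

/-- The matrix with the given entries. -/
def ofEntries (x : Fin p × Fin q → ℝ) : Matrix (Fin p) (Fin q) ℝ := fun k l => x (k, l)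

lemma measurable_ofEntries : Measurable (ofEntries (p := p) (q := q)) :=
  measurable_matrix_iff.2 fun k l => measurable_pi_apply (k, l)

lemma measurable_monomials (a b c d : Idx p q) :
    Measurable fun x : Matrix (Fin p) (Fin q) ℝ => monomials x a b c d := by
  have h : ∀ e : Idx p q, Measurable fun x : Matrix (Fin p) (Fin q) ℝ => aug x e := by
    intro e
    cases e with
    | none => exact measurable_const
    | some a => exact measurable_matrix_iff.1 measurable_id a.1 a.2
  exact (((h a).mul (h b)).mul (h c)).mul (h d)

lemma measurable_influence {Ω : Type*} [MeasurableSpace Ω] (N : Fin 2) (P : Measure Ω)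
    (Y : Ω → Matrix (Fin p) (Fin q) ℝ) (a : Fin p × Fin p) :
    Measurable fun x => influence N P Y x a := by
  have h := measurable_monomials (p := p) (q := q)
  have hc : ∀ k k' : Fin p, Measurable fun x : Matrix (Fin p) (Fin q) ℝ =>
      covLin (monomials x) k k' := by
    intro k k'
    simp only [covLin]
    fun_prop
  by_cases hk : a.2 = a.1
  · simp only [influence, estimateLin, hk, if_true, hc]
  · simp only [influence, estimateLin, hk, if_false, fobiLin, fobiSum]
    fun_prop

end Measurability

/-! ### The scale of the expansions -/

section Deviation

variable {p q : ℕ}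

/-- The Euclidean distance between two arrays of moments. -/
noncomputable def deviation (m μ : Tensor p q) : ℝ :=
  √(∑ e : Idx p q × Idx p q × Idx p q × Idx p q,
    (m e.1 e.2.1 e.2.2.1 e.2.2.2 - μ e.1 e.2.1 e.2.2.1 e.2.2.2) ^ 2)

lemma deviation_sq (m μ : Tensor p q) :
    deviation m μ ^ 2 = ∑ e : Idx p q × Idx p q × Idx p q × Idx p q,
      (m e.1 e.2.1 e.2.2.1 e.2.2.2 - μ e.1 e.2.1 e.2.2.1 e.2.2.2) ^ 2 :=
  Real.sq_sqrt (Finset.sum_nonneg fun _ _ => sq_nonneg _)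

lemma abs_sub_le_deviation (m μ : Tensor p q) (a b c d : Idx p q) :
    |m a b c d - μ a b c d| ≤ deviation m μ :=
  Real.abs_le_sqrt (Finset.single_le_sum (f := fun e : Idx p q × Idx p q × Idx p q × Idx p q =>
    (m e.1 e.2.1 e.2.2.1 e.2.2.2 - μ e.1 e.2.1 e.2.2.1 e.2.2.2) ^ 2) (fun _ _ => sq_nonneg _)
    (Finset.mem_univ (a, b, c, d)))

lemma isBigO_deviation {ι : Type*} {f : Filter ι} (m : ι → Tensor p q) (μ : Tensor p q)
    (a b c d : Idx p q) :
    (fun t => m t a b c d - μ a b c d) =O[f] fun t => deviation (m t) μ :=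
  IsBigO.of_bound 1 (Eventually.of_forall fun t => by
    rw [one_mul, Real.norm_eq_abs]
    exact (abs_sub_le_deviation _ _ a b c d).trans (le_abs_self _))

end Deviation

/-! ### Consistency and asymptotic normality along a random sample -/

lemma isConsistent_iff {Ω : Type*} [MeasurableSpace Ω] {P : Measure Ω} {p : ℕ}
    {Γ : ℕ → Ω → Matrix (Fin p) (Fin p) ℝ} :
    IsConsistent P Γ ↔ Tendsto (fun t : ℕ × Ω => Γ t.1 t.2) (probFilter P) (𝓝 1) := by
  rw [tendsto_matrix_iff]
  refine forall_congr' fun k => forall_congr' fun k' => ?_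
  exact tendstoInMeasure_iff_probFilter (X := fun n ω => Γ n ω k k')

/-- A random sample from the distribution of a matrix with standardized independent
components. -/
structure IsSample {Ω : Type*} [MeasurableSpace Ω] {p q : ℕ} (P : Measure Ω)
    (Z : ℕ → Ω → Matrix (Fin p) (Fin q) ℝ) : Prop where
  ident : ∀ i, IdentDistrib (fun ω (kl : Fin p × Fin q) => Z i ω kl.1 kl.2)
    (fun ω (kl : Fin p × Fin q) => Z 0 ω kl.1 kl.2) P P
  indep : iIndepFun (fun i ω (kl : Fin p × Fin q) => Z i ω kl.1 kl.2) P
  std : IsStdMatrix (Z 0) P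

namespace IsSample

variable {Ω : Type*} [MeasurableSpace Ω] {P : Measure Ω} {p q : ℕ}
  {Z : ℕ → Ω → Matrix (Fin p) (Fin q) ℝ}

lemma aemeasurable (h : IsSample P Z) (i : ℕ) : AEMeasurable (Z i) P :=
  measurable_ofEntries.comp_aemeasurable (h.ident i).aemeasurable_fst

lemma identDistrib_comp {β : Type*} [MeasurableSpace β] (h : IsSample P Z)
    {φ : Matrix (Fin p) (Fin q) ℝ → β} (hφ : Measurable φ) (i : ℕ) :
    IdentDistrib (fun ω => φ (Z i ω)) (fun ω => φ (Z 0 ω)) P P :=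
  (h.ident i).comp (hφ.comp measurable_ofEntries)

lemma iIndepFun_comp {β : Type*} [MeasurableSpace β] (h : IsSample P Z)
    {φ : Matrix (Fin p) (Fin q) ℝ → β} (hφ : Measurable φ) :
    iIndepFun (fun i ω => φ (Z i ω)) P :=
  h.indep.comp (fun _ x => φ (ofEntries x)) fun _ => hφ.comp measurable_ofEntries

/-- The empirical moments of the sample, at a sample size and an outcome. -/
noncomputable def moments (Z : ℕ → Ω → Matrix (Fin p) (Fin q) ℝ) (t : ℕ × Ω) : Tensor p q :=
  empMoments t.1 fun i => Z i t.2

lemma tendsto_fst : Tendsto Prod.fst (probFilter P) atTop := by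
  intro A hA
  exact eventually_probFilter_of_ae (Q := fun t => t.1 ∈ A)
    ((show ∀ᶠ n in atTop, n ∈ A from hA).mono fun n hn => ae_of_all _ fun _ => hn)

lemma eventually_ne_zero : ∀ᶠ t in probFilter P, t.1 ≠ 0 :=
  tendsto_fst.eventually (eventually_ne_atTop 0)

lemma eigenvalue (h : IsSample P Z) (hq : 0 < q) (N : Fin 2) (k : Fin p) :
    fobiSum N (fun a b c d => momentTensor P (Z 0) (some a) (some b) (some c) (some d)) k k
      = q * fobiEigenvalue N P (Z 0) k :=
  fobiSum_momentTensor h.std hq N k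

variable [IsProbabilityMeasure P]

lemma memLp_moments_sub (h : IsSample P Z) (n : ℕ) (a b c d : Idx p q) :
    MemLp (fun ω => moments Z (n, ω) a b c d - momentTensor P (Z 0) a b c d) 2 P :=
  (memLp_avg (fun i => (h.identDistrib_comp (measurable_monomials a b c d) i).symm.memLp_snd
    (memLp_monomials h.std a b c d)) n).sub (memLp_const _)

lemma integrable_sq_deviation (h : IsSample P Z) (n : ℕ) :
    Integrable (fun ω => deviation (moments Z (n, ω)) (momentTensor P (Z 0)) ^ 2) P := by
  simp only [deviation_sq]
  exact integrable_finsetSum _ fun e _ => (h.memLp_moments_sub n _ _ _ _).integrable_sq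

lemma integral_sq_deviation (h : IsSample P Z) {n : ℕ} (hn : n ≠ 0) :
    ∫ ω, deviation (moments Z (n, ω)) (momentTensor P (Z 0)) ^ 2 ∂P = (n : ℝ)⁻¹ *
      ∑ e : Idx p q × Idx p q × Idx p q × Idx p q,
        Var[fun ω => monomials (Z 0 ω) e.1 e.2.1 e.2.2.1 e.2.2.2; P] := by
  simp only [deviation_sq]
  rw [integral_finsetSum _ fun e _ => (h.memLp_moments_sub n _ _ _ _).integrable_sq,
    Finset.mul_sum]
  refine Finset.sum_congr rfl fun e _ => ?_
  have hm := measurable_monomials (p := p) (q := q) e.1 e.2.1 e.2.2.1 e.2.2.2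
  exact integral_sq_avg_sub (X := fun i ω => monomials (Z i ω) e.1 e.2.1 e.2.2.1 e.2.2.2)
    (memLp_monomials h.std _ _ _ _) (h.iIndepFun_comp hm) (h.identDistrib_comp hm) hn

/-- The deviation of the moments has mean square of order 1/n, so remainders of smaller order than
it vanish at the scale √n. -/
lemma tendsto_sqrt_mul (h : IsSample P Z) {r : ℕ × Ω → ℝ}
    (hr : r =o[probFilter P] fun t => deviation (moments Z t) (momentTensor P (Z 0))) :
    Tendsto (fun t => √(t.1 : ℝ) * r t) (probFilter P) (𝓝 0) :=
  tendsto_sqrt_mul_of_isLittleO hr h.integrable_sq_deviation fun _ hn =>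
    (h.integral_sq_deviation hn).le

/-- The law of large numbers for the empirical moments. -/
lemma tendsto_deviation (h : IsSample P Z) :
    Tendsto (fun t => deviation (moments Z t) (momentTensor P (Z 0))) (probFilter P) (𝓝 0) := by
  have h1 : Tendsto (fun t : ℕ × Ω => (√(t.1 : ℝ))⁻¹) (probFilter P) (𝓝 0) :=
    (tendsto_inv_atTop_zero.comp (Real.tendsto_sqrt_atTop.comp tendsto_natCast_atTop_atTop)).comp
      tendsto_fst
  -- The deviation divided by √n is of smaller order than the deviation; `tendsto_sqrt_mul`
  -- multiplies the factor √n back.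
  have h2 := ((isLittleO_one_iff ℝ).2 h1).mul_isBigO
    (isBigO_refl (fun t => deviation (moments Z t) (momentTensor P (Z 0))) (probFilter P))
  simp only [one_mul] at h2
  refine (h.tendsto_sqrt_mul h2).congr' ?_
  filter_upwards [eventually_ne_zero] with t ht
  have : √(t.1 : ℝ) ≠ 0 := by positivity
  rw [mul_inv_cancel_left₀ this]

lemma eventually_posDef (h : IsSample P Z) (hp : 0 < p) (hq : 0 < q) (centered : Bool) :
    ∀ᶠ t in probFilter P, t.1 ≠ 0 ∧ (sampleCovL centered t.1 fun i => Z i t.2).PosDef ∧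
      (sampleCovR centered t.1 fun i => Z i t.2).PosDef := by
  have hρ := h.tendsto_deviation
  have hm := isBigO_deviation (f := probFilter P) (moments Z) (momentTensor P (Z 0))
  have hμ := isStdMoments_momentTensor h.std
  have hL : Tendsto (fun t : ℕ × Ω => sampleCovL centered t.1 fun i => Z i t.2) (probFilter P)
      (𝓝 1) := by
    refine Tendsto.congr' ?_ (tendsto_matrix_iff.2
      fun i j => (firstOrder_leftCov hρ hq hm hμ centered i j).tendsto hρ)
    filter_upwards [eventually_ne_zero] with t ht
    exact (sampleCovL_eq _ ht centered).symm
  have hR : Tendsto (fun t : ℕ × Ω => sampleCovR centered t.1 fun i => Z i t.2) (probFilter P)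
      (𝓝 1) := by
    refine Tendsto.congr' ?_ (tendsto_matrix_iff.2
      fun i j => (firstOrder_rightCov hρ hp hm hμ centered i j).tendsto hρ)
    filter_upwards [eventually_ne_zero] with t ht
    exact (sampleCovR_eq _ ht centered).symm
  exact eventually_ne_zero.and ((MFOBI.eventually_posDef (fun _ => posSemidef_sampleCovL _ _ _) hL).and
    (MFOBI.eventually_posDef (fun _ => posSemidef_sampleCovR _ _ _) hR))

/-- The estimate whose rotation is closest to the identity is consistent. -/
theorem tendsto_closestEstimate (h : IsSample P Z) (hp : 0 < p) (hq : 0 < q) (N : Fin 2)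
    (centered : Bool) (hinj : Function.Injective (fobiEigenvalue N P (Z 0))) :
    Tendsto (fun t : ℕ × Ω => closestEstimate N centered t.1 fun i => Z i t.2) (probFilter P)
      (𝓝 1) := by
  have hgood := h.eventually_posDef hp hq centered
  -- The deterministic expansion assumes its hypotheses at every point, so it is applied on the
  -- subtype of good pairs. This set belongs to the filter, so mapping the comap filter back
  -- recovers `probFilter P`.
  set good : Set (ℕ × Ω) := {t | t.1 ≠ 0 ∧ (sampleCovL centered t.1 fun i => Z i t.2).PosDef ∧
      (sampleCovR centered t.1 fun i => Z i t.2).PosDef} with hgood_def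
  have hv : Tendsto ((↑) : good → ℕ × Ω) (comap (↑) (probFilter P)) (probFilter P) := tendsto_comap
  have h1 := tendsto_closest_estimate (h.tendsto_deviation.comp hv) hp hq
    (isBigO_deviation (fun t : good => moments Z t) (momentTensor P (Z 0)))
    (isStdMoments_momentTensor h.std) N centered hinj (h.eigenvalue hq N)
    (L := fun t => invSqrt (sampleCovL centered t.1.1 fun i => Z i t.1.2))
    (R := fun t => invSqrt (sampleCovR centered t.1.1 fun i => Z i t.1.2))
    (fun t => by
      have := isSymmInvSqrt_invSqrt t.2.2.1
      rwa [sampleCovL_eq _ t.2.1] at this ⊢)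
    (fun t => by
      have := isSymmInvSqrt_invSqrt t.2.2.2
      rwa [sampleCovR_eq _ t.2.1] at this ⊢)
  have hmap : map ((↑) : good → ℕ × Ω) (comap (↑) (probFilter P)) = probFilter P :=
    map_comap_of_mem (by rw [Subtype.range_coe]; exact hgood)
  rw [← hmap]
  refine tendsto_map'_iff.2 (h1.congr fun t => ?_)
  simp only [Function.comp_def, closestEstimate, sampleFobiL_eq, moments]

/-- The linearization of consistent estimates. -/
theorem isLittleO_leftEstimate (h : IsSample P Z) (hp : 0 < p) (hq : 0 < q) (N : Fin 2)
    (centered : Bool) (hinj : Function.Injective (fobiEigenvalue N P (Z 0)))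
    {Γ : ℕ × Ω → Matrix (Fin p) (Fin p) ℝ}
    (hΓ : ∀ᶠ t in probFilter P, IsLeftEstimate N centered t.1 (fun i => Z i t.2) (Γ t))
    (hlim : Tendsto Γ (probFilter P) (𝓝 1)) (k k' : Fin p) :
    (fun t => (Γ t - 1) k k' - estimateLin N (fobiEigenvalue N P (Z 0)) (skew P (Z 0))
        (moments Z t) k k')
      =o[probFilter P] fun t => deviation (moments Z t) (momentTensor P (Z 0)) := by
  have hgood := eventually_ne_zero.and hΓ
  set good : Set (ℕ × Ω) := {t | t.1 ≠ 0 ∧ IsLeftEstimate N centered t.1 (fun i => Z i t.2) (Γ t)}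
    with hgood_def
  have hv : Tendsto ((↑) : good → ℕ × Ω) (comap (↑) (probFilter P)) (probFilter P) := tendsto_comap
  -- The factors of the estimate are chosen pointwise; convergence along the filter requires no
  -- measurability of them.
  choose L R W hL hR hW hdiag hG using fun t : good => t.2.2
  have h1 := isLittleO_estimate (h.tendsto_deviation.comp hv) hp hq
    (isBigO_deviation (fun t : good => moments Z t) (momentTensor P (Z 0)))
    (fun t a b => by simp only [moments, empMoments, monomials]; congr 1; ext i; ring)
    (isStdMoments_momentTensor h.std) N centered hinj (h.eigenvalue hq N)
    (L := L) (R := R)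
    (fun t => by rw [moments, ← sampleCovL_eq _ t.2.1]; exact hL t)
    (fun t => by rw [moments, ← sampleCovR_eq _ t.2.1]; exact hR t) hW
    (fun t => by rw [moments, ← sampleFobiL_eq]; exact hdiag t)
    ((hlim.comp hv).congr fun t => hG t) k k'
  have hmap : map ((↑) : good → ℕ × Ω) (comap (↑) (probFilter P)) = probFilter P :=
    map_comap_of_mem (by rw [Subtype.range_coe]; exact hgood)
  rw [← hmap]
  refine isLittleO_map.2 (h1.congr_left fun t => ?_)
  simp only [Function.comp_def, hG]

/-- The asymptotic distribution of the averages of the influence function. -/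
theorem tendstoInDistribution_influence (h : IsSample P Z) (hq : 0 < q) (N : Fin 2)
    (hinj : Function.Injective (fobiEigenvalue N P (Z 0))) :
    TendstoInDistribution (fun (n : ℕ) ω => WithLp.toLp 2 fun a => (√(n : ℝ))⁻¹ *
        ∑ i ∈ Finset.range n, influence N P (Z 0) (Z i ω) a)
      atTop id (fun _ => P)
      (multivariateGaussian 0 (covMatrix P fun a ω => influence N P (Z 0) (Z 0 ω) a)) := by
  have hm : Measurable fun x => influence N P (Z 0) x :=
    measurable_pi_lambda _ fun a => measurable_influence N P (Z 0) a
  exact tendstoInDistribution_sqrt_smul_sum (X := fun i a ω => influence N P (Z 0) (Z i ω) a)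
    (memLp_influence h.std hq N hinj) (integral_influence h.std hq N hinj) (h.iIndepFun_comp hm)
    (h.identDistrib_comp hm)

/-- The remainder in the linearization of consistent estimates is negligible. -/
theorem tendsto_leftEstimate_sub (h : IsSample P Z) (hp : 0 < p) (hq : 0 < q)
    (N : Fin 2) (centered : Bool) (hinj : Function.Injective (fobiEigenvalue N P (Z 0)))
    {Γ : ℕ → Ω → Matrix (Fin p) (Fin p) ℝ} (hΓ : IsLeftEstimateSeq N centered P Z Γ)
    (hlim : IsConsistent P Γ) (a : Fin p × Fin p) :
    Tendsto (fun t : ℕ × Ω => √(t.1 : ℝ) * (Γ t.1 t.2 - 1) a.2 a.1 - (√(t.1 : ℝ))⁻¹ *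
      ∑ i ∈ Finset.range t.1, influence N P (Z 0) (Z i t.2) a) (probFilter P) (𝓝 0) := by
  have hG : ∀ᶠ t in probFilter P, IsLeftEstimate N centered t.1 (fun i => Z i t.2) (Γ t.1 t.2) := by
    have h1 : ∀ᶠ t in probFilter P, (sampleCovL centered t.1 fun i => Z i t.2).PosDef →
        (sampleCovR centered t.1 fun i => Z i t.2).PosDef →
        IsLeftEstimate N centered t.1 (fun i => Z i t.2) (Γ t.1 t.2) :=
      eventually_probFilter_of_ae (Eventually.of_forall hΓ.2)
    exact (h1.and (h.eventually_posDef hp hq centered)).mono fun t ht => ht.1 ht.2.2.1 ht.2.2.2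
  have hlim' : Tendsto (fun t : ℕ × Ω => Γ t.1 t.2) (probFilter P) (𝓝 1) :=
    isConsistent_iff.1 hlim
  have h2 := h.tendsto_sqrt_mul (h.isLittleO_leftEstimate hp hq N centered hinj hG hlim' a.2 a.1)
  refine h2.congr' ?_
  filter_upwards [eventually_ne_zero] with t ht
  have h3 : √(t.1 : ℝ) * (t.1 : ℝ)⁻¹ = (√(t.1 : ℝ))⁻¹ := by
    have h4 : (0 : ℝ) < t.1 := by exact_mod_cast Nat.pos_of_ne_zero ht
    have h5 := Real.sq_sqrt h4.le
    have h6 : √(t.1 : ℝ) ≠ 0 := by positivity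
    field_simp
    exact h5
  simp only [moments, estimateLin_empMoments _ ht, avg, influence, mul_sub, ← mul_assoc, h3]

/-- The asymptotic normality of consistent estimates. -/
theorem tendstoInDistribution_leftEstimate (h : IsSample P Z) (hp : 0 < p) (hq : 0 < q)
    (N : Fin 2) (centered : Bool) (hinj : Function.Injective (fobiEigenvalue N P (Z 0)))
    {Γ : ℕ → Ω → Matrix (Fin p) (Fin p) ℝ} (hΓ : IsLeftEstimateSeq N centered P Z Γ)
    (hlim : IsConsistent P Γ) :
    TendstoInDistribution (fun (n : ℕ) ω => WithLp.toLp 2 (√(n : ℝ) • (Γ n ω - 1).vec))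
      atTop id (fun _ => P)
      (multivariateGaussian 0 (covMatrix P fun a ω => influence N P (Z 0) (Z 0 ω) a)) := by
  -- Slutsky: the scaled error differs from the normalized sum of influences by a term tending to
  -- zero in probability.
  refine tendstoInDistribution_of_tendstoInMeasure_sub
    (fun (n : ℕ) ω => WithLp.toLp 2 (√(n : ℝ) • (Γ n ω - 1).vec)) id
    (h.tendstoInDistribution_influence hq N hinj)
    (tendstoInMeasure_iff_probFilter.2 ?_) fun n => ?_
  · exact ((PiLp.continuous_toLp 2 fun _ : Fin p × Fin p => ℝ).tendsto 0).comp
      (tendsto_pi_nhds.2 (h.tendsto_leftEstimate_sub hp hq N centered hinj hΓ hlim))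
  · refine (WithLp.measurable_toLp 2 (Fin p × Fin p → ℝ)).comp_aemeasurable
      (aemeasurable_pi_lambda _ fun a => ?_)
    exact ((hΓ.1 n a.2 a.1).sub_const _).const_mul _

end IsSample

end MFOBI

/-! ### The main theorem -/

theorem mainTheorem2 {Ω : Type*} [MeasurableSpace Ω] (P : Measure Ω) [IsProbabilityMeasure P]
    (p q : ℕ) (hp : 0 < p) (hq : 0 < q)
    (Z : ℕ → Ω → Matrix (Fin p) (Fin q) ℝ)
    -- random sample
    (h_iid : ∀ i, IdentDistrib (fun ω (kl : Fin p × Fin q) => Z i ω kl.1 kl.2)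
      (fun ω (kl : Fin p × Fin q) => Z 0 ω kl.1 kl.2) P P)
    (h_indep : iIndepFun (fun i ω (kl : Fin p × Fin q) => Z i ω kl.1 kl.2) P)
    -- finite eighth moments
    (h_mom : ∀ k l, MemLp (fun ω => Z 0 ω k l) 8 P)
    -- mutually independent standardized components
    (h_comp : iIndepFun (fun (kl : Fin p × Fin q) ω => Z 0 ω kl.1 kl.2) P)
    (h_mean : ∀ k l, ∫ ω, Z 0 ω k l ∂P = 0)
    (h_var : ∀ k l, Var[fun ω => Z 0 ω k l; P] = 1)
    -- distinct row averages and distinct column averages of the kurtoses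
    (h_row : Function.Injective (MFOBI.rowAvg (MFOBI.kurt P (Z 0))))
    (h_col : Function.Injective (MFOBI.colAvg (MFOBI.kurt P (Z 0))))
    (N : Fin 2) (centered : Bool) :
    (∃ Γ : ℕ → Ω → Matrix (Fin p) (Fin p) ℝ,
      MFOBI.IsLeftEstimateSeq N centered P Z Γ ∧ MFOBI.IsConsistent P Γ) ∧
    ∃ V : Matrix (Fin p × Fin p) (Fin p × Fin p) ℝ,
      V.PosSemidef ∧
      -- the index `(k', k)` of the column-stacking `vec` is the entry in row `k`, column `k'`
      (∀ k, V (k, k) (k, k) = MFOBI.asvDiag P (Z 0) k) ∧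
      (∀ k k', k ≠ k' → V (k', k) (k', k) = MFOBI.asvOff N P (Z 0) k k') ∧
      ∀ Γ : ℕ → Ω → Matrix (Fin p) (Fin p) ℝ,
        MFOBI.IsLeftEstimateSeq N centered P Z Γ → MFOBI.IsConsistent P Γ →
        TendstoInDistribution
          (fun (n : ℕ) ω => WithLp.toLp 2 (√(n : ℝ) • (Γ n ω - 1).vec))
          atTop id (fun _ => P) (multivariateGaussian 0 V) := by
  have hstd : MFOBI.IsStdMatrix (Z 0) P :=
    { indep := h_comp
      memLp := fun a => h_mom a.1 a.2
      mean := fun a => h_mean a.1 a.2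
      second := fun a => by
        rw [← h_var a.1 a.2, variance_of_integral_eq_zero
          (h_mom a.1 a.2).aestronglyMeasurable.aemeasurable (h_mean a.1 a.2)] }
  have h : MFOBI.IsSample P Z := ⟨h_iid, h_indep, hstd⟩
  have hinj := MFOBI.fobiEigenvalue_injective h_row N
  have hF := MFOBI.memLp_influence hstd hq N hinj
  refine ⟨⟨fun n ω => MFOBI.closestEstimate N centered n fun i => Z i ω, ⟨fun n k k' => ?_,
    fun n => ae_of_all _ fun ω hL hR => ?_⟩,
    MFOBI.isConsistent_iff.2 (h.tendsto_closestEstimate hp hq N centered hinj)⟩,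
    MFOBI.covMatrix P fun a ω => MFOBI.influence N P (Z 0) (Z 0 ω) a,
    MFOBI.posSemidef_covMatrix hF, fun k => ?_, fun k k' hk => ?_, fun Γ hΓ hlim =>
      h.tendstoInDistribution_leftEstimate hp hq N centered hinj hΓ hlim⟩
  · exact ((MFOBI.measurable_matrix_iff.1 (MFOBI.measurable_closestEstimate N centered n)
      k k').comp_aemeasurable (aemeasurable_pi_lambda _ h.aemeasurable))
  · exact MFOBI.isLeftEstimate_closestEstimate N centered n _ hL hR
  · rw [← MFOBI.variance_influence_diag hstd hq N hinj, ← covariance_self (hF _).aemeasurable]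
    rfl
  · rw [← MFOBI.variance_influence_off hstd hq N hinj hk, ← covariance_self (hF _).aemeasurable]
    rfl
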